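/- Lattices here are positive definite: a lattice is a discrete subgroup $L$ that spans a finite dimensional real Euclidean space $E$ with inner product $(\cdot,\cdot)$, and $O(L)$ is the group of linear isometries of $E$ that map $L$ onto itself; two lattices are isometric if some linear isometry of their ambient spaces carries one onto the other. $L$ is even if all inner products of its vectors are integers and $(x,x)$ is an even integer for all $x\in L$; it is rootless if it has no vector with $(x,x)=2$. For a subgroup $M$ of $L$ put $M^*=\{x\in \mathbb{R}M : (x,y)\in\mathbb{Z} \text{ for all } y\in M\}$; the discriminant group of an even lattice $L$ is $\mathcal{D}(L)=L^*/L$, on which $O(L)$ acts naturally. A sublattice $M\le L$ is semiselfdual (SSD) if $2M^*\le M$. An SSD involution of $L$ is an element $t\in O(L)$ of order $2$ for which there is an SSD sublattice $M\le L$ such that $t$ is $-1$ on $M$ and $1$ on $\{x\in L : (x,M)=0\}$. Finally, $O^+(4,5)$ is the group of invertible linear maps of $\mathbb{F}_5^4$ that preserve the quadratic form $x_1y_1+x_2y_2$ (the nonsingular form of maximal Witt index). **Theorem.** Let $R$ be a rootless even lattice of rank $8$ whose discriminant group is isomorphic, as an abelian group, to $5^4=(\mathbb{Z}/5\mathbb{Z})^4$.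 Then: (i) $R$ is unique up to isometry, that is, every rootless even lattice of rank $8$ with discriminant group isomorphic to $(\mathbb{Z}/5\mathbb{Z})^4$ is isometric to $R$; (ii) $O(R)\cong O^+(4,5)$ as groups; (iii) $O(R)$ acts faithfully on $\mathcal{D}(R)$, and $O(R)$ contains no SSD involutions. -/

import Mathlib

open scoped RealInnerProductSpace

namespace EuclideanLattice

section Lattice

variable {E : Type*} [NormedAddCommGroup E] [InnerProductSpace ℝ E]
variable {E' : Type*} [NormedAddCommGroup E'] [InnerProductSpace ℝ E']

/-- The dual `M* = {x ∈ ℝM | (x, y) ∈ ℤ for all y ∈ M}` of a subgroup `M` of a Euclidean space.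
It is taken inside the subspace spanned by `M`, not inside the whole ambient space.  (When `M` is
an integral lattice, `M*` is contained in the rational span of `M`.) -/
def dual (M : Submodule ℤ E) : Submodule ℤ E where
  carrier := {x | x ∈ Submodule.span ℝ (M : Set E) ∧ ∀ y ∈ M, ∃ k : ℤ, ⟪x, y⟫ = (k : ℝ)}
  zero_mem' := ⟨Submodule.zero_mem _, fun _ _ => ⟨0, by simp⟩⟩
  add_mem' := by
    rintro x x' ⟨hx, h⟩ ⟨hx', h'⟩
    refine ⟨Submodule.add_mem _ hx hx', fun y hy => ?_⟩
    obtain ⟨k, hk⟩ := h y hy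
    obtain ⟨k', hk'⟩ := h' y hy
    exact ⟨k + k', by rw [inner_add_left, hk, hk']; push_cast; rfl⟩
  smul_mem' := by
    rintro c x ⟨hx, h⟩
    refine ⟨zsmul_mem hx c, fun y hy => ?_⟩
    obtain ⟨k, hk⟩ := h y hy
    refine ⟨c * k, ?_⟩
    rw [← Int.cast_smul_eq_zsmul ℝ c x, real_inner_smul_left, hk]
    push_cast
    rfl

/-- A lattice is even if its inner products are integers and the norms `(x, x)` of its vectors are
even integers. -/
def IsEven (L : Submodule ℤ E) : Prop :=
  (∀ x ∈ L, ∀ y ∈ L, ∃ k : ℤ, ⟪x, y⟫ = (k : ℝ)) ∧ ∀ x ∈ L, ∃ k : ℤ, ⟪x, x⟫ = 2 * (k : ℝ)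

/-- A lattice is rootless if it contains no vector of norm `(x, x) = 2`. -/
def IsRootless (L : Submodule ℤ E) : Prop := ∀ x ∈ L, ⟪x, x⟫ ≠ 2

/-- The discriminant group `L* / L` of an integral lattice `L`. -/
abbrev DiscriminantGroup (L : Submodule ℤ E) : Type _ := dual L ⧸ L.submoduleOf (dual L)

/-- Two lattices are isometric if some linear isometry of their ambient Euclidean spaces carries
the first onto the second (both lattices are going to span their ambient spaces). -/
def Isometric (L : Submodule ℤ E) (L' : Submodule ℤ E') : Prop :=
  ∃ f : E ≃ₗᵢ[ℝ] E', ∀ x, f x ∈ L' ↔ x ∈ L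

/-- The isometry group `O(L)` of a lattice `L` that spans `E`: the linear isometries of `E` that
map `L` onto itself. -/
def isometryGroup (L : Submodule ℤ E) : Subgroup (E ≃ₗᵢ[ℝ] E) where
  carrier := {g | ∀ x, g x ∈ L ↔ x ∈ L}
  one_mem' := fun _ => Iff.rfl
  mul_mem' := fun {g h} hg hh x => (hg (h x)).trans (hh x)
  inv_mem' := by
    intro g hg x
    have h := hg (g⁻¹ x)
    rw [show g (g⁻¹ x) = x from g.apply_symm_apply x] at h
    exact h.symm

theorem isometryGroup_mem_dual {L : Submodule ℤ E} (g : isometryGroup L) {x : E}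
    (hx : x ∈ dual L) : g.1 x ∈ dual L := by
  refine ⟨?_, fun y hy => ?_⟩
  · have h : Submodule.span ℝ (L : Set E) ≤
        (Submodule.span ℝ (L : Set E)).comap g.1.toLinearEquiv.toLinearMap :=
      Submodule.span_le.2 fun z hz => Submodule.subset_span ((g.2 z).2 hz)
    exact h hx.1
  · obtain ⟨k, hk⟩ := hx.2 _ ((g⁻¹.2 y).2 hy)
    refine ⟨k, ?_⟩
    rw [← hk, ← g.1.inner_map_map x]
    exact congrArg (fun z => ⟪g.1 x, z⟫) (g.1.apply_symm_apply y).symm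

/-- The endomorphism `x + L ↦ g x + L` of `L* / L` induced by an isometry `g` of `L`. -/
def discriminantMap {L : Submodule ℤ E} (g : isometryGroup L) :
    DiscriminantGroup L →ₗ[ℤ] DiscriminantGroup L :=
  Submodule.mapQ _ _
    ((g.1.toLinearEquiv.toLinearMap.restrictScalars ℤ).restrict
      fun _ hx => isometryGroup_mem_dual g hx)
    fun x hx => (g.2 x.1).2 hx

/-- The natural action of `O(L)` on the discriminant group `L* / L`. -/
def discriminantAction (L : Submodule ℤ E) :
    isometryGroup L →* Module.End ℤ (DiscriminantGroup L) where
  toFun := discriminantMap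
  map_one' := by
    refine LinearMap.ext fun x => ?_
    obtain ⟨x, rfl⟩ := Submodule.Quotient.mk_surjective _ x
    rfl
  map_mul' g h := by
    refine LinearMap.ext fun x => ?_
    obtain ⟨x, rfl⟩ := Submodule.Quotient.mk_surjective _ x
    rfl

/-- A lattice `M` is semiselfdual (SSD) if `2 M* ≤ M`. -/
def IsSSD (M : Submodule ℤ E) : Prop := ∀ x ∈ dual M, (2 : ℤ) • x ∈ M

/-- `t ∈ O(L)` is an SSD involution if it has order two and there is an SSD sublattice `M` of `L`
such that `t` is `-1` on `M` and `1` on the annihilator `{x ∈ L | (x, M) = 0}` of `M` in `L`. -/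
def IsSSDInvolution (L : Submodule ℤ E) (t : isometryGroup L) : Prop :=
  orderOf t = 2 ∧ ∃ M : Submodule ℤ E, M ≤ L ∧ IsSSD M ∧
    (∀ x ∈ M, t.1 x = -x) ∧ ∀ x ∈ L, (∀ y ∈ M, ⟪x, y⟫ = 0) → t.1 x = x

end Lattice

section Orthogonal

/-- The orthogonal group of a quadratic form: the invertible linear maps that preserve it. -/
def orthogonalGroup {F V : Type*} [CommRing F] [AddCommGroup V] [Module F V]
    (q : QuadraticForm F V) : Subgroup (V ≃ₗ[F] V) where
  carrier := {g | ∀ v, q (g v) = q v}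
  one_mem' := fun _ => rfl
  mul_mem' := fun {g h} hg hh v => (hg (h v)).trans (hh v)
  inv_mem' := by
    intro g hg v
    have h := hg (g⁻¹ v)
    rw [show g (g⁻¹ v) = v from g.apply_symm_apply v] at h
    exact h.symm

/-- The nonsingular quadratic form `x₁ y₁ + ⋯ + xₙ yₙ` of maximal Witt index on `F²ⁿ`. -/
def hyperbolicForm (n : ℕ) (F : Type*) [CommRing F] : QuadraticForm F (Fin n ⊕ Fin n → F) :=
  ∑ i : Fin n, QuadraticMap.proj (Sum.inl i) (Sum.inr i)

/-- The orthogonal group of plus type `O⁺(2n, q)`, where `F` is the field with `q` elements. -/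
abbrev OPlus (n : ℕ) (F : Type*) [CommRing F] : Type _ := orthogonalGroup (hyperbolicForm n F)

end Orthogonal

end EuclideanLattice

/-! Scaled by five halves, the norm induces a nondegenerate quadratic form on the discriminant
group, a four-dimensional space over the field with five elements. The rank is divisible by eight,
so by Milgram's formula (`IsEven.sum_discriminantPhase_pos`) its Gauss sum is positive. The form of
minus type would have a negative one, so the form is hyperbolic (`exists_hyperbolicCoord`).

A maximal totally singular subspace then gives an even self-dual lattice `U` above `R`, which is
`E₈` (`exists_isE8`). Inside `U`, the sublattice `R` is cut out by integrality against two vectors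
`y`, `y'` of the dual of `R`. The affine Weyl group moves `5 y`, modulo `5 U`, into the fundamental
alcove dilated by five. If it landed anywhere but at the vertex over the node of mark five, the
roots integral on `y` would contain a `D₄` or an `A₅`, and every linear map from such a root lattice
to `ℤ/5` kills a root: `R` would have a root. So the roots integral on `y` contain a system `A₄ +
A₄`, whose minimal weights of norm `4/5` are in the dual of `R` (`exists_frame`).

Computing with these weights shows that every class of norm `4/5` modulo `2` contains a vector of
norm `4/5`, that no dual vector has norm `2/5`, and that the vectors of norm `4/5` generate the
dual. Rootlessness makes the short vector of a class unique. Two short vectors that are neither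
equal nor opposite have inner product `n/5` with `|n| ≤ 2`, so the discriminant form determines `n`.
Therefore each isometry of discriminant forms permutes short vectors with their inner products and
lifts to an isometry of the lattices (`exists_isometry`), in only one way (`eq_one_of_coord_eq`).
This gives uniqueness, the isometry group and faithfulness at once.

An SSD involution moves a dual vector by `-2` times its projection to `ℝM`. This projection is in
`M*`, so the displacement is in `R`: the involution would act trivially on the discriminant group
and be the identity. -/

namespace EuclideanLattice

open MeasureTheory Module

/-! ### Covolume of self-dual lattices and Minkowski's theorem for cylinders -/

section Minkowski

variable {E : Type*} [NormedAddCommGroup E] [InnerProductSpace ℝ E]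

/-- A lattice is self-dual if it consists of the vectors that have integral inner products with
all its elements. -/
def IsSelfDual (L : Submodule ℤ E) : Prop :=
  ∀ x, x ∈ L ↔ ∀ y ∈ L, ∃ k : ℤ, ⟪x, y⟫ = (k : ℝ)

theorem _root_.Module.Basis.exists_int_sum_eq {ι : Type*} [Fintype ι] {L : Submodule ℤ E}
    (b : Basis ι ℤ L) {y : E} (hy : y ∈ L) : ∃ c : ι → ℤ, y = ∑ i, (c i : ℝ) • (b i : E) := by
  refine ⟨fun i => b.repr ⟨y, hy⟩ i, ?_⟩
  have := congrArg (Subtype.val) (b.sum_repr ⟨y, hy⟩)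
  rw [Submodule.coe_sum] at this
  refine this.symm.trans (Finset.sum_congr rfl fun i _ => ?_)
  rw [Int.cast_smul_eq_zsmul, Submodule.coe_smul]

variable [FiniteDimensional ℝ E]

/-- The Gram matrix of a basis is integral, and so is its inverse, because self-duality puts the
dual basis into the lattice. Its determinant is therefore a unit of `ℤ`, and it is the square of the
covolume. -/
theorem IsSelfDual.covolume_eq_one [MeasurableSpace E] [BorelSpace E] {L : Submodule ℤ E}
    [DiscreteTopology L] [IsZLattice ℝ L] (h : IsSelfDual L) : ZLattice.covolume L = 1 := by
  classical
  let b := Module.Free.chooseBasis ℤ L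
  set ι := Module.Free.ChooseBasisIndex ℤ L
  let B : Basis ι ℝ E := b.ofZLatticeBasis ℝ L
  have hB : ∀ i, B i = b i := fun i => b.ofZLatticeBasis_apply ℝ L i
  have e : Fin (finrank ℝ E) ≃ ι := (Fintype.equivOfCardEq (by
    rw [Fintype.card_fin, finrank_eq_card_basis B]))
  let o : OrthonormalBasis ι ℝ E := (stdOrthonormalBasis ℝ E).reindex e
  have hdual : ∀ j, ∃ d ∈ L, ∀ i, ⟪d, (b i : E)⟫ = if i = j then (1 : ℝ) else 0 := by
    intro j
    let f : E →L[ℝ] ℝ := LinearMap.toContinuousLinearMap (B.coord j)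
    have hf : ∀ i, ⟪(InnerProductSpace.toDual ℝ E).symm f, (b i : E)⟫ =
        if i = j then (1 : ℝ) else 0 := by
      intro i
      rw [InnerProductSpace.toDual_symm_apply]
      simp [f, ← hB, Finsupp.single_apply]
    refine ⟨_, (h _).2 fun y hy => ?_, hf⟩
    obtain ⟨c, hc⟩ := b.exists_int_sum_eq hy
    refine ⟨c j, ?_⟩
    rw [hc, inner_sum]
    simp [inner_smul_right, hf]
  choose d hdL hd using hdual
  have hG : ∀ i j, ∃ k : ℤ, ⟪(b i : E), (b j : E)⟫ = (k : ℝ) :=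
    fun i j => (h _).1 (b i).2 _ (b j).2
  choose G hG using hG
  let P : Matrix ι ι ℝ := o.toBasis.toMatrix (fun i => (b i : E))
  have hPP : P.transpose * P = (Matrix.of G).map (Int.castRingHom ℝ) := by
    ext i j
    rw [Matrix.mul_apply, Matrix.map_apply]
    simp only [Matrix.of_apply, eq_intCast, ← hG]
    rw [← o.sum_inner_mul_inner]
    refine Finset.sum_congr rfl fun k _ => ?_
    simp [P, Basis.toMatrix_apply, o.repr_apply_apply, real_inner_comm]
  choose N hN using fun j => b.exists_int_sum_eq (hdL j)
  have hNG : Matrix.of N * Matrix.of G = 1 := by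
    ext j i
    have h1 := hd j i
    rw [hN, sum_inner] at h1
    simp only [inner_smul_left, hG] at h1
    rw [Matrix.mul_apply, Matrix.one_apply]
    simp only [Matrix.of_apply]
    have : ((∑ k, N j k * G k i : ℤ) : ℝ) = ((if j = i then 1 else 0 : ℤ) : ℝ) := by
      push_cast
      simpa [eq_comm (a := j)] using h1
    exact_mod_cast this
  have hu : IsUnit (Matrix.of G).det := by
    have := congrArg Matrix.det hNG
    rw [Matrix.det_mul, Matrix.det_one] at this
    exact IsUnit.of_mul_eq_one_right _ this
  have hsq : P.det ^ 2 = ((Matrix.of G).det : ℝ) := by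
    have := congrArg Matrix.det hPP
    rw [Matrix.det_mul, Matrix.det_transpose, ← RingHom.mapMatrix_apply, ← RingHom.map_det] at this
    rw [sq, this]; simp
  have hP1 : |P.det| = 1 := by
    rcases Int.isUnit_iff.1 hu with h1 | h1
    · rw [h1] at hsq
      rw [← sq_eq_sq₀ (abs_nonneg _) zero_le_one, sq_abs, hsq]; simp
    · rw [h1] at hsq
      have := sq_nonneg P.det
      rw [hsq] at this
      norm_num at this
  rw [ZLattice.covolume_eq_det_mul_measureReal L volume b o.toBasis,
    measureReal_congr (ZSpan.fundamentalDomain_ae_parallelepiped o.toBasis volume)]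
  have : volume.real (parallelepiped (o.toBasis : ι → E)) = 1 := by
    rw [measureReal_def, OrthonormalBasis.coe_toBasis, o.volume_parallelepiped]; simp
  rw [this, mul_one, Basis.det_apply]
  exact hP1

theorem volume_cylinder [MeasurableSpace E] [BorelSpace E] {k m : ℕ} [NeZero m]
    (o : OrthonormalBasis (Fin k ⊕ Fin m) ℝ E)
    (s c : ℝ) :
    volume {x : E | (∀ i, |⟪o (Sum.inl i), x⟫| < s) ∧ ∑ j, ⟪o (Sum.inr j), x⟫ ^ 2 < c} =
      ENNReal.ofReal (2 * s) ^ k *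
        volume (Metric.ball (0 : EuclideanSpace ℝ (Fin m)) (√c)) := by
  have h1 : MeasurePreserving (fun x : E => (MeasurableEquiv.sumPiEquivProdPi (fun _ => ℝ))
      (WithLp.ofLp (o.repr x))) :=
    (volume_measurePreserving_sumPiEquivProdPi (fun _ : Fin k ⊕ Fin m => ℝ)).comp
      ((PiLp.volume_preserving_ofLp _).comp o.measurePreserving_repr)
  set A : Set (Fin k → ℝ) := Set.univ.pi fun _ => Set.Ioo (-s) s
  set B : Set (Fin m → ℝ) := WithLp.toLp 2 ⁻¹' (Metric.ball (0 : EuclideanSpace ℝ (Fin m)) (√c))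
  have hset : {x : E | (∀ i, |⟪o (Sum.inl i), x⟫| < s) ∧ ∑ j, ⟪o (Sum.inr j), x⟫ ^ 2 < c} =
      (fun x : E => (MeasurableEquiv.sumPiEquivProdPi (fun _ => ℝ))
      (WithLp.ofLp (o.repr x))) ⁻¹' (A ×ˢ B) := by
    ext x
    simp only [Set.mem_ofPred_eq, Set.mem_preimage, Set.mem_prod, A, B, Set.mem_univ_pi,
      Metric.mem_ball, dist_zero_right, EuclideanSpace.norm_eq, MeasurableEquiv.coe_sumPiEquivProdPi,
      Equiv.sumPiEquivProdPi, Equiv.coe_fn_mk, Set.mem_Ioo, ← abs_lt,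
      Real.sqrt_lt_sqrt_iff (Finset.sum_nonneg fun i _ => sq_nonneg _), Real.norm_eq_abs, sq_abs,
      o.repr_apply_apply]
  have hB : MeasurableSet B :=
    (PiLp.volume_preserving_toLp (Fin m)).measurable measurableSet_ball
  have hA : MeasurableSet A := MeasurableSet.univ_pi fun _ => measurableSet_Ioo
  rw [hset, h1.measure_preimage (hA.prod hB).nullMeasurableSet, Measure.volume_eq_prod,
    Measure.prod_prod, (PiLp.volume_preserving_toLp (Fin m)).measure_preimage
      measurableSet_ball.nullMeasurableSet]
  congr 1
  simp only [A, Real.volume_pi_Ioo]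
  rw [Finset.prod_const]
  congr 1
  · congr 1; ring
  · simp

/-- Minkowski's theorem for a body that is a box along `v` and a ball across it. Along lattice
vectors integrality can turn the box bound into exact inner products, while the ball bounds the
remaining norm. -/
theorem IsSelfDual.exists_mem_cylinder [MeasurableSpace E] [BorelSpace E] {L : Submodule ℤ E}
    [DiscreteTopology L] [IsZLattice ℝ L] (h : IsSelfDual L) {k m : ℕ} [NeZero m]
    (hE : finrank ℝ E = k + m) {v : Fin k → E} (hv : Orthonormal ℝ v) {s c : ℝ}
    (hvol : ENNReal.ofReal (2 ^ (k + m)) < ENNReal.ofReal (2 * s) ^ k *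
        volume (Metric.ball (0 : EuclideanSpace ℝ (Fin m)) (√c))) :
    ∃ x ∈ L, x ≠ 0 ∧ (∀ i, |⟪v i, x⟫| < s) ∧ ⟪x, x⟫ - ∑ i, ⟪v i, x⟫ ^ 2 < c := by
  classical
  obtain ⟨o, ho⟩ : ∃ o : OrthonormalBasis (Fin k ⊕ Fin m) ℝ E, ∀ i, o (Sum.inl i) = v i := by
    have hcard : finrank ℝ E = Fintype.card (Fin k ⊕ Fin m) := by simpa using hE
    obtain ⟨o, ho⟩ := Orthonormal.exists_orthonormalBasis_extension_of_card_eq (𝕜 := ℝ) hcard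
      (v := Sum.elim v (fun _ => 0)) (s := Set.range Sum.inl) (by
        have e : (Set.range (Sum.inl : Fin k → Fin k ⊕ Fin m)) ≃ Fin k :=
          (Equiv.ofInjective _ Sum.inl_injective).symm
        constructor
        · rintro ⟨_, i, rfl⟩
          simpa using hv.1 i
        · rintro ⟨_, i, rfl⟩ ⟨_, j, rfl⟩ hij
          have : i ≠ j := fun h => hij (by subst h; rfl)
          simpa using hv.2 this)
    exact ⟨o, fun i => ho _ ⟨i, rfl⟩⟩
  set S : Set E := {x : E | (∀ i, |⟪o (Sum.inl i), x⟫| < s) ∧ ∑ j, ⟪o (Sum.inr j), x⟫ ^ 2 < c}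
  have hS := volume_cylinder o s c
  let b := Module.Free.chooseBasis ℤ L
  have hfund := ZLattice.isAddFundamentalDomain b (volume : Measure E)
  have hcov := h.covolume_eq_one
  rw [ZLattice.covolume_eq_measure_fundamentalDomain L volume hfund] at hcov
  have hconv : Convex ℝ S := by
    have h1 : ∀ i, Convex ℝ {x : E | |⟪o (Sum.inl i), x⟫| < s} := by
      intro i
      have : {x : E | |⟪o (Sum.inl i), x⟫| < s} =
          (innerSL ℝ (o (Sum.inl i))).toLinearMap ⁻¹' (Set.Ioo (-s) s) := by
        ext x; simp [abs_lt]
      rw [this]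
      exact (convex_Ioo _ _).linear_preimage _
    have h2 : Convex ℝ {x : E | ∑ j, ⟪o (Sum.inr j), x⟫ ^ 2 < c} := by
      have : ConvexOn ℝ Set.univ (fun x : E => ∑ j, ⟪o (Sum.inr j), x⟫ ^ 2) := by
        have h3 : ∀ t : Finset (Fin m),
            ConvexOn ℝ Set.univ (fun x : E => ∑ j ∈ t, ⟪o (Sum.inr j), x⟫ ^ 2) := by
          intro t
          induction t using Finset.induction_on with
          | empty => simpa using convexOn_const (0 : ℝ) convex_univ
          | insert j t hj ih =>
            simp only [Finset.sum_insert hj]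
            refine ConvexOn.add ?_ ih
            have := ((even_two : Even 2).convexOn_pow (𝕜 := ℝ)).comp_linearMap
              (innerSL ℝ (o (Sum.inr j))).toLinearMap
            exact this
        exact h3 _
      simpa using this.convex_lt c
    have : S = (⋂ i, {x : E | |⟪o (Sum.inl i), x⟫| < s}) ∩
        {x : E | ∑ j, ⟪o (Sum.inr j), x⟫ ^ 2 < c} := by
      ext x; simp [S]
    rw [this]
    exact (convex_iInter h1).inter h2
  have hsymm : ∀ x ∈ S, -x ∈ S := by
    rintro x ⟨h1, h2⟩
    exact ⟨by simpa using h1, by simpa using h2⟩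
  have : Countable L.toAddSubgroup := inferInstanceAs (Countable L)
  obtain ⟨x, hx0, hxS⟩ := exists_ne_zero_mem_lattice_of_measure_mul_two_pow_lt_measure
    (L := L.toAddSubgroup) hfund hsymm hconv (by
      rw [hS, hE]
      refine lt_of_le_of_lt ?_ hvol
      rw [measureReal_def] at hcov
      have : volume (ZSpan.fundamentalDomain (b.ofZLatticeBasis ℝ L)) = 1 :=
        (ENNReal.toReal_eq_one_iff _).1 hcov
      rw [this, one_mul, ENNReal.ofReal_pow (by norm_num)]
      simp)
  refine ⟨x, x.2, fun h0 => hx0 (Subtype.ext h0), fun i => by rw [← ho]; exact hxS.1 i, ?_⟩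
  have hsum := o.sum_inner_mul_inner (x : E) (x : E)
  rw [Fintype.sum_sum_type] at hsum
  have h2 := hxS.2
  have h3 : ∑ i, ⟪v i, (x : E)⟫ ^ 2 + ∑ j, ⟪o (Sum.inr j), (x : E)⟫ ^ 2 = ⟪(x : E), (x : E)⟫ := by
    rw [← hsum]
    congr 1
    · refine Finset.sum_congr rfl fun i _ => ?_
      rw [ho, real_inner_comm (v i), sq]
    · refine Finset.sum_congr rfl fun i _ => ?_
      rw [real_inner_comm (o _), sq]
  linarith

end Minkowski


/-! ### Orthogonal systems of short vectors -/

section ShortVectors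

theorem le_volume_ball_of_even {m : ℕ} (k : ℕ) (hm : m = 2 * k) (hk : 0 < k) {r W : ℝ}
    (hr : 0 ≤ r) (hW : W ≤ Real.pi ^ k / (k.factorial : ℝ)) :
    ENNReal.ofReal (r ^ m * W) ≤ volume (Metric.ball (0 : EuclideanSpace ℝ (Fin m)) r) := by
  have : Nontrivial (EuclideanSpace ℝ (Fin m)) :=
    Module.nontrivial_of_finrank_pos (R := ℝ) (by rw [finrank_euclideanSpace_fin]; omega)
  rw [InnerProductSpace.volume_ball_of_dim_even (k := k) (by rw [finrank_euclideanSpace_fin, hm]),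
    finrank_euclideanSpace_fin, ENNReal.ofReal_mul (by positivity), ENNReal.ofReal_pow hr]
  gcongr

theorem le_volume_ball_of_odd {m : ℕ} (k : ℕ) (hm : m = 2 * k + 1) {r W : ℝ}
    (hr : 0 ≤ r) (hW : W ≤ Real.pi ^ k * 2 ^ (k + 1) / (m.doubleFactorial : ℝ)) :
    ENNReal.ofReal (r ^ m * W) ≤ volume (Metric.ball (0 : EuclideanSpace ℝ (Fin m)) r) := by
  rw [InnerProductSpace.volume_ball_of_dim_odd (k := k) (by rw [finrank_euclideanSpace_fin, hm]),
    finrank_euclideanSpace_fin, ENNReal.ofReal_mul (by positivity), ENNReal.ofReal_pow hr]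
  gcongr

/-- Lower bounds for the volumes of the unit balls in dimensions `1` to `8`. -/
noncomputable def unitBallBound : ℕ → ℝ
  | 1 => 2
  | 2 => 3.1
  | 3 => 4.18
  | 4 => 4.9
  | 5 => 5.2
  | 6 => 5.1
  | 7 => 4.7
  | 8 => 4
  | _ => 0

theorem le_volume_ball {m : ℕ} (h1 : 1 ≤ m) (h8 : m ≤ 8) {r : ℝ} (hr : 0 ≤ r) :
    ENNReal.ofReal (r ^ m * unitBallBound m) ≤
      volume (Metric.ball (0 : EuclideanSpace ℝ (Fin m)) r) := by
  have hpi := Real.pi_gt_d2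
  have hp2 : (3.14 : ℝ) ^ 2 ≤ Real.pi ^ 2 := by gcongr
  have hp3 : (3.14 : ℝ) ^ 3 ≤ Real.pi ^ 3 := by gcongr
  have hp4 : (3.14 : ℝ) ^ 4 ≤ Real.pi ^ 4 := by gcongr
  interval_cases m
  · refine le_volume_ball_of_odd 0 rfl hr ?_
    norm_num [unitBallBound, Nat.doubleFactorial]
  · refine le_volume_ball_of_even 1 rfl (by norm_num) hr ?_
    norm_num [unitBallBound, Nat.factorial] at *; linarith
  · refine le_volume_ball_of_odd 1 rfl hr ?_
    norm_num [unitBallBound, Nat.doubleFactorial] at *; linarith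
  · refine le_volume_ball_of_even 2 rfl (by norm_num) hr ?_
    norm_num [unitBallBound, Nat.factorial] at *; linarith
  · refine le_volume_ball_of_odd 2 rfl hr ?_
    norm_num [unitBallBound, Nat.doubleFactorial] at *; linarith
  · refine le_volume_ball_of_even 3 rfl (by norm_num) hr ?_
    norm_num [unitBallBound, Nat.factorial] at *; linarith
  · refine le_volume_ball_of_odd 3 rfl hr ?_
    norm_num [unitBallBound, Nat.doubleFactorial] at *; linarith
  · refine le_volume_ball_of_even 4 rfl (by norm_num) hr ?_
    norm_num [unitBallBound, Nat.factorial] at *; linarith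

variable {E : Type*} [NormedAddCommGroup E] [InnerProductSpace ℝ E]

/-- A family of pairwise orthogonal vectors of norm `(x, x) = N` in `L`. -/
structure OrthogonalFamilyIn (L : Submodule ℤ E) (N : ℝ) {k : ℕ} (r : Fin k → E) : Prop where
  mem : ∀ i, r i ∈ L
  inner_eq : ∀ i j, ⟪r i, r j⟫ = if i = j then N else 0

theorem OrthogonalFamilyIn.snoc {L : Submodule ℤ E} {N : ℝ} {k : ℕ} {r : Fin k → E}
    (h : OrthogonalFamilyIn L N r) {x : E} (hx : x ∈ L) (hN : ⟪x, x⟫ = N)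
    (h0 : ∀ i, ⟪r i, x⟫ = 0) : OrthogonalFamilyIn L N (Fin.snoc r x : Fin (k + 1) → E) := by
  constructor
  · intro i
    refine Fin.lastCases ?_ (fun i => ?_) i
    · simpa using hx
    · simpa using h.mem i
  · intro i j
    refine Fin.lastCases ?_ (fun i => ?_) i <;> refine Fin.lastCases ?_ (fun j => ?_) j
    · simpa using hN
    · simp only [Fin.snoc_last, Fin.snoc_castSucc]
      rw [real_inner_comm, h0, if_neg (Fin.castSucc_lt_last j).ne']
    · simp only [Fin.snoc_last, Fin.snoc_castSucc]
      rw [h0, if_neg (Fin.castSucc_lt_last i).ne]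
    · simpa using h.inner_eq i j

theorem OrthogonalFamilyIn.inner_sum_smul {L : Submodule ℤ E} {N : ℝ} {k : ℕ} {r : Fin k → E}
    (h : OrthogonalFamilyIn L N r) (c : Fin k → ℝ) (i : Fin k) :
    ⟪r i, ∑ j, c j • r j⟫ = c i * N := by
  simp [inner_sum, inner_smul_right, h.inner_eq]

variable [FiniteDimensional ℝ E]

/-- The volume condition is stated squared, which removes the square roots of `N` and `c` and leaves
a rational inequality to check. -/
theorem IsSelfDual.exists_short {L : Submodule ℤ E}
    [DiscreteTopology L] [IsZLattice ℝ L] (h : IsSelfDual L) {k m : ℕ} (h1 : 1 ≤ m) (h8 : m ≤ 8)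
    (hE : finrank ℝ E = k + m) {N : ℝ} (hN : 0 < N) {r : Fin k → E} (hr : OrthogonalFamilyIn L N r)
    {t c : ℝ} (ht : 0 < t) (hc : 0 < c)
    (hvol : 4 ^ (k + m) < (4 * t ^ 2 / N) ^ k * c ^ m * unitBallBound m ^ 2) :
    ∃ x ∈ L, x ≠ 0 ∧ (∀ i, |⟪r i, x⟫| < t) ∧ ⟪x, x⟫ - ∑ i, ⟪r i, x⟫ ^ 2 / N < c := by
  let _ : MeasurableSpace E := borel E
  have : BorelSpace E := ⟨rfl⟩
  have : NeZero m := ⟨by omega⟩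
  have hsN : 0 < √N := Real.sqrt_pos.2 hN
  have hN2 : √N ^ 2 = N := Real.sq_sqrt hN.le
  have hv : Orthonormal ℝ fun i => (√N)⁻¹ • r i := by
    rw [orthonormal_iff_ite]
    intro i j
    rw [real_inner_smul_left, real_inner_smul_right, hr.inner_eq]
    split_ifs
    · rw [← hN2, Real.sqrt_sq hsN.le]; field_simp
    · simp
  have hW : (0 : ℝ) ≤ unitBallBound m := by
    interval_cases m <;> norm_num [unitBallBound]
  obtain ⟨x, hxL, hx0, hxs, hxc⟩ := h.exists_mem_cylinder hE hv (s := t / √N) (c := c) (by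
    refine lt_of_lt_of_le ?_ (mul_le_mul_right (le_volume_ball h1 h8 (Real.sqrt_nonneg c)) _)
    rw [← ENNReal.ofReal_pow (by positivity), ← ENNReal.ofReal_mul (by positivity)]
    rw [ENNReal.ofReal_lt_ofReal_iff_of_nonneg (by positivity)]
    refine lt_of_pow_lt_pow_left₀ 2 (by positivity) ?_
    calc ((2 : ℝ) ^ (k + m)) ^ 2 = 4 ^ (k + m) := by
          rw [← pow_mul, mul_comm, pow_mul]; norm_num
      _ < _ := hvol
      _ = _ := by
          have e1 : 4 * t ^ 2 / N = (2 * (t / √N)) ^ 2 := by rw [mul_pow, div_pow, hN2]; ring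
          have e2 : c = √c ^ 2 := (Real.sq_sqrt hc.le).symm
          rw [e1]
          generalize 2 * (t / √N) = a
          conv_lhs => rw [e2]
          ring)
  refine ⟨x, hxL, hx0, fun i => ?_, ?_⟩
  · have := hxs i
    rw [real_inner_smul_left, abs_mul, abs_of_pos (inv_pos.2 hsN), inv_mul_eq_div,
      div_lt_div_iff_of_pos_right hsN] at this
    exact this
  · refine lt_of_eq_of_lt ?_ hxc
    congr 1
    refine Finset.sum_congr rfl fun i _ => ?_
    rw [real_inner_smul_left, mul_pow, inv_pow, hN2]
    ring

theorem int_eq_zero_of_abs_lt_one {a : ℝ} (h : ∃ k : ℤ, a = k) (h1 : |a| < 1) : a = 0 := by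
  obtain ⟨k, rfl⟩ := h
  have : |k| < 1 := by exact_mod_cast h1
  rw [Int.abs_lt_one_iff.1 this, Int.cast_zero]

/-- Extending an orthogonal family of shortest vectors. -/
theorem IsSelfDual.exists_orthogonal {L : Submodule ℤ E}
    [DiscreteTopology L] [IsZLattice ℝ L] (h : IsSelfDual L) {k m : ℕ} (h1 : 1 ≤ m) (h8 : m ≤ 8)
    (hE : finrank ℝ E = k + m) {N : ℝ} (hN : 0 < N) {r : Fin k → E} (hr : OrthogonalFamilyIn L N r)
    (hmin : ∀ x ∈ L, x ≠ 0 → ⟪x, x⟫ < 2 * N → ⟪x, x⟫ = N)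
    (hvol : 4 ^ (k + m) < (4 / N) ^ k * (2 * N) ^ m * unitBallBound m ^ 2) :
    ∃ x ∈ L, ⟪x, x⟫ = N ∧ ∀ i, ⟪r i, x⟫ = 0 := by
  -- With `t = 1` the integral products with the family vanish; then `c = 2 * N` bounds the whole
  -- norm, and `hmin` applies.
  obtain ⟨x, hx, hx0, hxr, hxc⟩ := h.exists_short h1 h8 hE hN hr (t := 1) (c := 2 * N) one_pos
    (by positivity) (by simpa using hvol)
  have h0 : ∀ i, ⟪r i, x⟫ = 0 := fun i => by
    have := (h _).1 (hr.mem i) x hx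
    exact int_eq_zero_of_abs_lt_one this (hxr i)
  exact ⟨x, hx, hmin x hx hx0 (by simpa [h0] using hxc), h0⟩

end ShortVectors

section Discrete

variable {E : Type*} [NormedAddCommGroup E] [InnerProductSpace ℝ E]

/-- Integrality keeps nonzero vectors at length at least one. Neighbours and overlattices are built
as bare subgroups and get their discreteness from here. -/
theorem discreteTopology_of_integral {L : Submodule ℤ E}
    (h : ∀ x ∈ L, ∃ k : ℤ, ⟪x, x⟫ = (k : ℝ)) : DiscreteTopology L := by
  refine discreteTopology_of_isOpen_singleton_zero ?_
  have : ({0} : Set L) = Metric.ball 0 1 := by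
    ext x
    simp only [Set.mem_singleton_iff, Metric.mem_ball, dist_zero_right]
    refine ⟨fun h => by simp [h], fun hx => ?_⟩
    have h2 : ⟪(x : E), (x : E)⟫ = 0 := by
      refine int_eq_zero_of_abs_lt_one (h _ x.2) ?_
      rw [real_inner_self_eq_norm_sq, abs_of_nonneg (sq_nonneg _)]
      have h3 : ‖(x : E)‖ < 1 := hx
      nlinarith [norm_nonneg (x : E)]
    exact Subtype.ext (inner_self_eq_zero.1 h2)
  rw [this]
  exact Metric.isOpen_ball

end Discrete


/-! ### Kneser neighbours of even self-dual lattices -/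

section Unimodular

variable {E : Type*} [NormedAddCommGroup E] [InnerProductSpace ℝ E]

/-- The Kneser neighbour `{x ∈ U | (x, f) ∈ ℤ} + ℤ f` of `U`. -/
def neighbour (U : Submodule ℤ E) (f : E) : Submodule ℤ E where
  carrier := {x | ∃ u ∈ U, ∃ k : ℤ, (∃ l : ℤ, ⟪u, f⟫ = (l : ℝ)) ∧ x = u + k • f}
  zero_mem' := ⟨0, U.zero_mem, 0, ⟨0, by simp⟩, by simp⟩
  add_mem' := by
    rintro _ _ ⟨u, hu, k, ⟨l, hl⟩, rfl⟩ ⟨u', hu', k', ⟨l', hl'⟩, rfl⟩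
    exact ⟨u + u', U.add_mem hu hu', k + k', ⟨l + l', by rw [inner_add_left, hl, hl']; push_cast; rfl⟩,
      by rw [add_smul]; abel⟩
  smul_mem' := by
    rintro c _ ⟨u, hu, k, ⟨l, hl⟩, rfl⟩
    refine ⟨c • u, U.smul_mem c hu, c * k, ⟨c * l, ?_⟩, by rw [smul_add, mul_smul]⟩
    rw [← Int.cast_smul_eq_zsmul ℝ c u, real_inner_smul_left, hl]
    push_cast
    rfl

theorem real_inner_zsmul_left (c : ℤ) (x y : E) : ⟪c • x, y⟫ = (c : ℝ) * ⟪x, y⟫ := by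
  rw [← Int.cast_smul_eq_zsmul ℝ c x, real_inner_smul_left]

theorem real_inner_zsmul_right (c : ℤ) (x y : E) : ⟪x, c • y⟫ = (c : ℝ) * ⟪x, y⟫ := by
  rw [← Int.cast_smul_eq_zsmul ℝ c y, real_inner_smul_right]

variable {U : Submodule ℤ E} {f : E}

/-- Products of `U` with `f` are half-integers because `2 f` is in `U`. Were all of them integral,
`f` itself would be in `U`, where norm one is impossible. -/
theorem exists_inner_eq_half (hU : IsSelfDual U) (heven : IsEven U) (hf : ⟪f, f⟫ = 1)
    (h2f : (2 : ℤ) • f ∈ U) : ∃ t ∈ U, ∃ l : ℤ, ⟪t, f⟫ = (l : ℝ) + 1 / 2 := by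
  by_contra! hcon
  have : f ∈ U := by
    refine (hU f).2 fun y hy => ?_
    obtain ⟨k, hk⟩ := (hU _).1 h2f y hy
    rw [real_inner_zsmul_left] at hk
    rcases Int.even_or_odd' k with ⟨c, rfl | rfl⟩
    · exact ⟨c, by push_cast at hk; linarith⟩
    · refine absurd ?_ (hcon y hy c)
      rw [real_inner_comm]
      push_cast at hk
      linarith
  obtain ⟨k, hk⟩ := heven.2 f this
  rw [hf] at hk
  have : (1 : ℤ) = 2 * k := by exact_mod_cast hk
  omega

/-- The vectors of `U` with integral product with `f` have index two in `U`, the other coset being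
that of `t`. A vector that pairs integrally with the neighbour becomes, after a multiple of `f` is
subtracted, integral on both cosets, so it is then in `U`. -/
theorem neighbour_isSelfDual (hU : IsSelfDual U) (heven : IsEven U) (hf : ⟪f, f⟫ = 1)
    (h2f : (2 : ℤ) • f ∈ U) : IsSelfDual (neighbour U f) := by
  intro z
  constructor
  · rintro ⟨u, hu, k, ⟨l, hl⟩, rfl⟩ _ ⟨u', hu', k', ⟨l', hl'⟩, rfl⟩
    obtain ⟨m, hm⟩ := (hU u).1 hu u' hu'
    refine ⟨m + k' * l + k * l' + k * k', ?_⟩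
    rw [inner_add_left, inner_add_right, inner_add_right, real_inner_zsmul_left,
      real_inner_zsmul_left, real_inner_zsmul_right, real_inner_zsmul_right, hm, hl, hf,
      real_inner_comm, hl']
    push_cast
    ring
  · intro hz
    obtain ⟨t, ht, l, hl⟩ := exists_inner_eq_half hU heven hf h2f
    have h2t : (2 : ℤ) • t ∈ neighbour U f := by
      refine ⟨(2 : ℤ) • t, U.smul_mem _ ht, 0, ⟨2 * l + 1, ?_⟩, by simp⟩
      rw [real_inner_zsmul_left, hl]; push_cast; ring
    have hfn : f ∈ neighbour U f := ⟨0, U.zero_mem, 1, ⟨0, by simp⟩, by simp⟩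
    obtain ⟨k, hk⟩ := hz _ h2t
    rw [real_inner_zsmul_right] at hk
    obtain ⟨p, hp⟩ := hz f hfn
    -- correct `z` by a multiple of `f` so that the product with `t` becomes integral
    have hft : ⟪f, t⟫ = (l : ℝ) + 1 / 2 := by rw [real_inner_comm, hl]
    have key : ∀ u ∈ U, ∃ m : ℤ, ⟪z - k • f, u⟫ = (m : ℝ) := by
      have h0 : ⟪z - k • f, t⟫ = ((-(k * l) : ℤ) : ℝ) := by
        rw [inner_sub_left, real_inner_zsmul_left, hft]
        push_cast at hk ⊢
        linarith
      have h1 : ∀ u ∈ U, (∃ m : ℤ, ⟪u, f⟫ = (m : ℝ)) → ∃ m : ℤ, ⟪z - k • f, u⟫ = (m : ℝ) := by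
        rintro u hu ⟨m, hm⟩
        obtain ⟨q, hq⟩ := hz u ⟨u, hu, 0, ⟨m, hm⟩, by simp⟩
        refine ⟨q - k * m, ?_⟩
        rw [inner_sub_left, real_inner_zsmul_left, hq, real_inner_comm, hm]
        push_cast; rfl
      intro u hu
      obtain ⟨m, hm⟩ := (hU _).1 h2f u hu
      rw [real_inner_zsmul_left, real_inner_comm] at hm
      push_cast at hm
      rcases Int.even_or_odd' m with ⟨c, rfl | rfl⟩
      · exact h1 u hu ⟨c, by push_cast at hm; linarith⟩
      · obtain ⟨q, hq⟩ := h1 (u - t) (U.sub_mem hu ht) ⟨c - l, by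
          rw [inner_sub_left, hl]; push_cast at hm ⊢; linarith⟩
        refine ⟨q + -(k * l), ?_⟩
        rw [inner_sub_right, h0] at hq
        push_cast at hq ⊢
        linarith
    refine ⟨z - k • f, (hU _).2 key, k, ?_, by abel⟩
    refine ⟨p - k, ?_⟩
    rw [inner_sub_left, real_inner_zsmul_left, hp, hf]
    push_cast; ring

/-- The norm of `u + k f` is congruent to `k²` modulo two, so it is even only for even `k`. -/
theorem mem_of_mem_neighbour (heven : IsEven U) (hf : ⟪f, f⟫ = 1)
    (h2f : (2 : ℤ) • f ∈ U) {x : E} (hx : x ∈ neighbour U f) (hxx : ∃ k : ℤ, ⟪x, x⟫ = 2 * (k : ℝ)) :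
    x ∈ U := by
  obtain ⟨u, hu, k, ⟨l, hl⟩, rfl⟩ := hx
  obtain ⟨m, hm⟩ := hxx
  obtain ⟨n, hn⟩ := heven.2 u hu
  rw [inner_add_left, inner_add_right, inner_add_right, real_inner_zsmul_left,
    real_inner_zsmul_left, real_inner_zsmul_right, real_inner_zsmul_right, hn, hl, hf,
    real_inner_comm, hl] at hm
  have h1 : 2 * n + k * l + (k * l + k * (k * 1)) = 2 * m := by exact_mod_cast hm
  have h2 : Even k := by
    have : Even (k * k) := ⟨m - n - k * l, by linarith⟩
    exact (Int.even_mul.1 this).elim id id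
  obtain ⟨c, rfl⟩ := h2
  refine U.add_mem hu ?_
  rw [← two_mul, mul_comm, mul_smul]
  exact U.smul_mem _ h2f

end Unimodular

/-! ### Orthogonal roots in an even self-dual lattice of rank eight -/

section E8

variable {E : Type*} [NormedAddCommGroup E] [InnerProductSpace ℝ E]

/-- The coordinate vectors of the lattice `E₈`, multiplied by two. -/
def IsE8Coord (a : Fin 8 → ℤ) : Prop := (∀ i, (2 : ℤ) ∣ a i - a 0) ∧ (4 : ℤ) ∣ ∑ i, a i

/-- `U` is the standard lattice `E₈` with respect to the orthonormal basis `e`. -/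
def IsE8 (U : Submodule ℤ E) (e : OrthonormalBasis (Fin 8) ℝ E) : Prop :=
  ∀ x, x ∈ U ↔ ∃ a : Fin 8 → ℤ, IsE8Coord a ∧ ∀ i, ⟪e i, x⟫ = (a i : ℝ) / 2

theorem OrthogonalFamilyIn.exists_extend [FiniteDimensional ℝ E] {L : Submodule ℤ E}
    [DiscreteTopology L] [IsZLattice ℝ L] (h : IsSelfDual L) (hE : finrank ℝ E = 8) {N : ℝ}
    (hN : 0 < N) (hmin : ∀ x ∈ L, x ≠ 0 → ⟪x, x⟫ < 2 * N → ⟪x, x⟫ = N) {k : ℕ}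
    {r : Fin k → E} (hr : OrthogonalFamilyIn L N r) (n : ℕ) (hn : k ≤ n) (h8 : n ≤ 8)
    (hvol : ∀ j, k ≤ j → j < n →
      4 ^ 8 < (4 / N) ^ j * (2 * N) ^ (8 - j) * unitBallBound (8 - j) ^ 2) :
    ∃ r' : Fin n → E, OrthogonalFamilyIn L N r' ∧ ∀ i : Fin k, r' (Fin.castLE hn i) = r i := by
  induction n, hn using Nat.le_induction with
  | base => exact ⟨r, hr, fun i => rfl⟩
  | succ n hn ih =>
    obtain ⟨r', hr', hrr⟩ := ih (by omega) fun j h1 h2 => hvol j h1 (by omega)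
    obtain ⟨x, hx, hxN, hx0⟩ := h.exists_orthogonal (k := n) (m := 8 - n) (by omega) (by omega)
      (by omega) hN hr' hmin (by
        rw [Nat.add_sub_cancel' (by omega)]
        exact hvol n hn (by omega))
    refine ⟨_, hr'.snoc hx hxN hx0, fun i => ?_⟩
    have : Fin.castLE (Nat.le_succ_of_le hn) i = Fin.castSucc (Fin.castLE hn i) := rfl
    rw [this, Fin.snoc_castSucc, hrr]

/-- Five orthogonal roots leave a complement of dimension three. A nonzero vector with products `0,
±1` with them and a small component in the complement turns out to lie in their span, which makes it
half a signed sum of exactly four of them. -/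
theorem exists_four_roots [FiniteDimensional ℝ E] {U : Submodule ℤ E}
    [DiscreteTopology U] [IsZLattice ℝ U] (hU : IsSelfDual U) (heven : IsEven U)
    (hE : finrank ℝ E = 8) : ∃ r : Fin 4 → E, OrthogonalFamilyIn U 2 r ∧
      (1 / 2 : ℝ) • ∑ i, r i ∈ U := by
  have hmin : ∀ x ∈ U, x ≠ 0 → ⟪x, x⟫ < 2 * 2 → ⟪x, x⟫ = 2 := by
    intro x hx hx0 hlt
    obtain ⟨k, hk⟩ := heven.2 x hx
    have hpos : 0 < ⟪x, x⟫ := real_inner_self_pos.2 hx0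
    rw [hk] at hlt hpos ⊢
    have h1 : 2 * k < 4 := by exact_mod_cast (by linarith : (2 : ℝ) * k < 4)
    have h2 : 0 < 2 * k := by exact_mod_cast hpos
    have : k = 1 := by omega
    subst this; norm_num
  -- Five roots are as far as this volume bound reaches; it fails for a sixth.
  obtain ⟨r, hr, -⟩ := OrthogonalFamilyIn.exists_extend hU hE two_pos hmin (k := 0)
    (r := Fin.elim0) ⟨fun i => i.elim0, fun i => i.elim0⟩ 5 (by norm_num) (by norm_num) (by
      intro j _ hj
      interval_cases j <;> norm_num [unitBallBound])
  -- `t = 2` allows only the products `0, ±1`, and `c = 1 / 2` is small enough to annihilate the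
  -- orthogonal component `y` below.
  obtain ⟨x, hx, hx0, hxr, hxc⟩ := hU.exists_short (k := 5) (m := 3) (by norm_num) (by norm_num)
    hE two_pos hr (t := 2) (c := 1 / 2) (by norm_num) (by norm_num) (by norm_num [unitBallBound])
  have hn : ∀ i, ∃ n : ℤ, ⟪r i, x⟫ = n := fun i => (hU _).1 (hr.mem i) x hx
  choose n hn using hn
  have hn1 : ∀ i, n i = 0 ∨ n i = 1 ∨ n i = -1 := by
    intro i
    have := hxr i
    rw [hn] at this
    have : |n i| < 2 := by exact_mod_cast this
    rw [abs_lt] at this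
    omega
  obtain ⟨k, hk⟩ := heven.2 x hx
  -- The norm of `y` is half the integer `4 k - ∑ n i ^ 2` and lies in `[0, 1/2)`, so it is zero.
  set y : E := x - ∑ i, ((n i : ℝ) / 2) • r i with hy
  have hry : ∀ i, ⟪r i, y⟫ = 0 := by
    intro i
    rw [hy, inner_sub_right, hr.inner_sum_smul, hn]; ring
  have hyy : ⟪y, y⟫ = 2 * k - ∑ i, (n i : ℝ) ^ 2 / 2 := by
    have h1 : ⟪y, y⟫ = ⟪x, y⟫ := by
      have h2 : ⟪x - ∑ i, ((n i : ℝ) / 2) • r i, y⟫ = ⟪x, y⟫ := by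
        rw [inner_sub_left, sum_inner]
        simp only [real_inner_smul_left, hry]
        simp
      rwa [← hy] at h2
    rw [h1, hy, inner_sub_right, hk, inner_sum]
    congr 1
    refine Finset.sum_congr rfl fun i _ => ?_
    rw [real_inner_smul_right, real_inner_comm, hn]; ring
  have hy0 : 0 ≤ ⟪y, y⟫ := real_inner_self_nonneg
  have hk0 : 0 < k := by
    have hpos : 0 < ⟪x, x⟫ := real_inner_self_pos.2 hx0
    rw [hk] at hpos
    exact_mod_cast (by linarith : (0 : ℝ) < k)
  simp only [hn, hk] at hxc
  rw [hyy] at hy0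
  have hsum : ((∑ i, n i ^ 2 : ℤ) : ℝ) = 2 * ∑ i, (n i : ℝ) ^ 2 / 2 := by
    push_cast; rw [Finset.mul_sum]; exact Finset.sum_congr rfl fun i _ => by ring
  have hc1 : 4 * k - ∑ i, n i ^ 2 < 1 := by
    have : ((4 * k - ∑ i, n i ^ 2 : ℤ) : ℝ) < 1 := by rw [Int.cast_sub, hsum]; push_cast; linarith
    exact_mod_cast this
  have hc2 : 0 ≤ 4 * k - ∑ i, n i ^ 2 := by
    have : (0 : ℝ) ≤ ((4 * k - ∑ i, n i ^ 2 : ℤ) : ℝ) := by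
      rw [Int.cast_sub, hsum]; push_cast; linarith
    exact_mod_cast this
  have hyz : y = 0 := by
    rw [← inner_self_eq_zero (𝕜 := ℝ), hyy]
    have : ((4 * k - ∑ i, n i ^ 2 : ℤ) : ℝ) = 0 := by
      have : 4 * k - ∑ i, n i ^ 2 = 0 := by omega
      rw [this]; simp
    rw [Int.cast_sub, hsum] at this
    push_cast at this
    linarith
  have hsq : ∀ i, n i ^ 2 = 0 ∨ n i ^ 2 = 1 := fun i => by
    rcases hn1 i with h | h | h <;> simp [h]
  -- Now `∑ n i ^ 2 = 4 k` is a positive multiple of four with five summands at most one, so just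
  -- one summand vanishes.
  obtain ⟨p, hp0, hp1⟩ : ∃ p : Fin 5, n p = 0 ∧ ∀ j, n (p.succAbove j) ^ 2 = 1 := by
    by_cases hall : ∀ i, n i ^ 2 = 1
    · simp [hall] at hc1 hc2; omega
    push Not at hall
    obtain ⟨p, hp⟩ := hall
    have hp' := (hsq p).resolve_right hp
    refine ⟨p, by simpa using hp', ?_⟩
    rw [Fin.sum_univ_succAbove _ p, hp'] at hc1 hc2
    by_contra! hcon
    obtain ⟨j, hj⟩ := hcon
    have hj' := (hsq (p.succAbove j)).resolve_right hj
    rw [Fin.sum_univ_succAbove _ j, hj'] at hc1 hc2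
    have hle : ∑ i, n (p.succAbove (j.succAbove i)) ^ 2 ≤ ∑ i : Fin 3, 1 :=
      Finset.sum_le_sum fun i _ => by rcases hsq (p.succAbove (j.succAbove i)) with h | h <;> omega
    simp at hle
    have hle0 : 0 ≤ ∑ i, n (p.succAbove (j.succAbove i)) ^ 2 :=
      Finset.sum_nonneg fun i _ => sq_nonneg _
    omega
  refine ⟨fun j => n (p.succAbove j) • r (p.succAbove j),
    ⟨fun j => U.smul_mem _ (hr.mem _), fun i j => ?_⟩, ?_⟩
  · rw [real_inner_zsmul_left, real_inner_zsmul_right, hr.inner_eq]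
    by_cases hij : i = j
    · subst hij
      have := hp1 i
      simp only [if_true]
      have : (n (p.succAbove i) : ℝ) ^ 2 = 1 := by exact_mod_cast this
      nlinarith
    · simp [hij]
  · have : (1 / 2 : ℝ) • ∑ j, n (p.succAbove j) • r (p.succAbove j) = x := by
      have h1 : x = ∑ i, ((n i : ℝ) / 2) • r i := by rwa [hy, sub_eq_zero] at hyz
      rw [h1, Fin.sum_univ_succAbove _ p, hp0, Finset.smul_sum]
      simp only [Int.cast_zero, zero_div, zero_smul, zero_add]
      refine Finset.sum_congr rfl fun j _ => ?_
      rw [← Int.cast_smul_eq_zsmul ℝ, smul_smul]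
      congr 1; ring
    rw [this]; exact hx

end E8


/-! ### Identification with `E₈` -/

section E8

variable {E : Type*} [NormedAddCommGroup E] [InnerProductSpace ℝ E]

theorem orthonormal_expansion (e : OrthonormalBasis (Fin 8) ℝ E) (x y : E) :
    ⟪x, y⟫ = ∑ i, ⟪e i, x⟫ * ⟪e i, y⟫ := by
  rw [← e.sum_inner_mul_inner x y]
  exact Finset.sum_congr rfl fun i _ => by rw [real_inner_comm x]

theorem orthonormal_expansion_self (e : OrthonormalBasis (Fin 8) ℝ E) (x : E) :
    ⟪x, x⟫ = ∑ i, ⟪e i, x⟫ ^ 2 := by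
  rw [orthonormal_expansion e]
  exact Finset.sum_congr rfl fun i _ => (sq _).symm

/-- The even self-dual lattices of rank eight that have a self-dual neighbour `ℤ⁸`. -/
theorem exists_isE8_of_neighbour {U : Submodule ℤ E} (hU : IsSelfDual U) (heven : IsEven U)
    {f : E} (hf : ⟪f, f⟫ = 1) (h2f : (2 : ℤ) • f ∈ U) (e : OrthonormalBasis (Fin 8) ℝ E)
    (he : ∀ i, e i ∈ neighbour U f) : ∃ e : OrthonormalBasis (Fin 8) ℝ E, IsE8 U e := by
  have hN := neighbour_isSelfDual hU heven hf h2f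
  -- The even-sum vectors of `ℤ⁸` and their translates by `t` will exhaust `U`.
  obtain ⟨t, ht, l, hl⟩ := exists_inner_eq_half hU heven hf h2f
  -- the vectors with integral coordinates and even coordinate sum
  have hD : ∀ x : E, ∀ c : Fin 8 → ℤ, (∀ i, ⟪e i, x⟫ = c i) → (x ∈ U ↔ (2 : ℤ) ∣ ∑ i, c i) := by
    intro x c hc
    have hxN : x ∈ neighbour U f := by
      have : x = ∑ i, c i • e i := by
        rw [← e.sum_repr' x]
        exact Finset.sum_congr rfl fun i _ => by rw [hc, Int.cast_smul_eq_zsmul]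
      rw [this]
      exact Submodule.sum_mem _ fun i _ => Submodule.smul_mem _ _ (he i)
    have hxx : ⟪x, x⟫ = ((∑ i, c i ^ 2 : ℤ) : ℝ) := by
      rw [orthonormal_expansion_self e]; push_cast
      exact Finset.sum_congr rfl fun i _ => by rw [hc]
    have hpar : (2 : ℤ) ∣ (∑ i, c i ^ 2) - ∑ i, c i := by
      rw [← Finset.sum_sub_distrib]
      refine Finset.dvd_sum fun i _ => ?_
      have := Int.even_mul_pred_self (c i)
      rw [show c i ^ 2 - c i = c i * (c i - 1) by ring]
      exact this.two_dvd
    constructor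
    · intro hx
      obtain ⟨k, hk⟩ := heven.2 x hx
      rw [hxx] at hk
      have : (∑ i, c i ^ 2) = 2 * k := by exact_mod_cast hk
      omega
    · intro h
      refine mem_of_mem_neighbour heven hf h2f hxN ?_
      obtain ⟨k, hk⟩ : (2 : ℤ) ∣ ∑ i, c i ^ 2 := by omega
      exact ⟨k, by rw [hxx, hk]; push_cast; rfl⟩
  have horth : ∀ i j, ⟪e i, e j⟫ = if i = j then (1 : ℝ) else 0 :=
    fun i j => orthonormal_iff_ite.1 e.orthonormal i j
  -- half integral coordinates
  have hhalf : ∀ x ∈ U, ∃ a : Fin 8 → ℤ, (∀ i, ⟪e i, x⟫ = (a i : ℝ) / 2) ∧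
      ∀ i, (2 : ℤ) ∣ a i - a 0 := by
    intro x hx
    have h1 : ∀ i j, ∃ k : ℤ, ⟪e i, x⟫ - ⟪e j, x⟫ = (k : ℝ) := by
      intro i j
      have : e i - e j ∈ U := by
        refine (hD _ (fun k => (if k = i then 1 else 0) - if k = j then 1 else 0) fun k => ?_).2 ?_
        · rw [inner_sub_right, horth, horth]; push_cast; rfl
        · simp
      obtain ⟨k, hk⟩ := (hU _).1 this x hx
      exact ⟨k, by rw [← hk, inner_sub_left]⟩
    have h2 : ∀ i, ∃ k : ℤ, ⟪e i, x⟫ = (k : ℝ) / 2 := by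
      intro i
      have : (2 : ℤ) • e i ∈ U := by
        refine (hD _ (fun k => 2 * if k = i then 1 else 0) fun k => ?_).2 ?_
        · rw [real_inner_zsmul_right, horth]; push_cast; rfl
        · simp
      obtain ⟨k, hk⟩ := (hU _).1 this x hx
      rw [real_inner_zsmul_left] at hk
      exact ⟨k, by push_cast at hk; linarith⟩
    choose a ha using h2
    refine ⟨a, ha, fun i => ?_⟩
    obtain ⟨k, hk⟩ := h1 i 0
    rw [ha, ha] at hk
    exact ⟨k, by exact_mod_cast (by linarith : (a i : ℝ) - a 0 = 2 * k)⟩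
  obtain ⟨b, hb, hb2⟩ := hhalf t ht
  -- the coordinates of `t` are not integral
  have hbodd : ∀ i, ¬ (2 : ℤ) ∣ b i := by
    intro i hi
    have h0 : ∀ j, (2 : ℤ) ∣ b j := fun j => by have := hb2 i; have := hb2 j; omega
    have htN : t ∈ neighbour U f := by
      have : t = ∑ i, (b i / 2) • e i := by
        rw [← e.sum_repr' t]
        refine Finset.sum_congr rfl fun j _ => ?_
        rw [hb, ← Int.cast_smul_eq_zsmul ℝ]
        congr 1
        obtain ⟨q, hq⟩ := h0 j
        rw [hq]; simp
      rw [this]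
      exact Submodule.sum_mem _ fun i _ => Submodule.smul_mem _ _ (he i)
    have hfN : f ∈ neighbour U f := ⟨0, U.zero_mem, 1, ⟨0, by simp⟩, by simp⟩
    obtain ⟨k, hk⟩ := (hN t).1 htN f hfN
    rw [hl] at hk
    have : (2 * l + 1 : ℤ) = 2 * k := by exact_mod_cast (by linarith : (2 * l + 1 : ℝ) = 2 * k)
    omega
  -- Eight numbers of equal parity have an even sum. If it is not divisible by four, one sign change
  -- alters it by twice an odd number, which repairs this.
  have hbsum : (2 : ℤ) ∣ ∑ i, b i := by
    have h2 : ∑ i, b i = ∑ i, (b i - b 0) + 8 * b 0 := by simp [Finset.sum_sub_distrib]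
    have h3 : (2 : ℤ) ∣ ∑ i, (b i - b 0) := Finset.dvd_sum fun i _ => hb2 i
    omega
  -- change the sign of a basis vector so that the coordinate sum of `t` becomes even
  obtain ⟨σ, hσ, hσb⟩ : ∃ σ : Fin 8 → ℤ, (∀ i, σ i = 1 ∨ σ i = -1) ∧
      (4 : ℤ) ∣ ∑ i, σ i * b i := by
    by_cases h4 : (4 : ℤ) ∣ ∑ i, b i
    · exact ⟨fun _ => 1, fun _ => Or.inl rfl, by simpa using h4⟩
    · refine ⟨fun i => if i = 0 then -1 else 1, fun i => by by_cases h : i = 0 <;> simp [h], ?_⟩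
      have h5 : ∑ i, (if i = 0 then (-1 : ℤ) else 1) * b i = ∑ i, b i - 2 * b 0 := by
        rw [Fin.sum_univ_succ, Fin.sum_univ_succ (f := b)]
        simp [Fin.succ_ne_zero]
        ring
      have := hbodd 0
      rw [h5]
      omega
  have hσσ : ∀ i, σ i * σ i = 1 := fun i => by rcases hσ i with h | h <;> simp [h]
  have hparity : ∀ c : Fin 8 → ℤ, (2 : ℤ) ∣ ∑ i, σ i * c i ↔ (2 : ℤ) ∣ ∑ i, c i := by
    intro c
    have h3 : (2 : ℤ) ∣ ∑ i, (σ i * c i - c i) := Finset.dvd_sum fun i _ => by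
      rcases hσ i with h | h <;> rw [h] <;> omega
    rw [Finset.sum_sub_distrib] at h3
    omega
  let o : OrthonormalBasis (Fin 8) ℝ E := OrthonormalBasis.mk (v := fun i => (σ i : ℝ) • e i) (by
    rw [orthonormal_iff_ite]
    intro i j
    rw [real_inner_smul_left, real_inner_smul_right, horth]
    split_ifs with h
    · subst h
      have := hσσ i
      rw [mul_one]; exact_mod_cast this
    · simp) (by
    rw [← e.toBasis.span_eq, Submodule.span_le]
    rintro _ ⟨i, rfl⟩
    have : e i = (σ i : ℝ) • (σ i : ℝ) • e i := by
      rw [smul_smul, ← Int.cast_mul, hσσ]; simp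
    rw [OrthonormalBasis.coe_toBasis, this]
    exact Submodule.smul_mem _ _ (Submodule.subset_span ⟨i, rfl⟩))
  have ho : ∀ i x, ⟪o i, x⟫ = σ i * ⟪e i, x⟫ := fun i x => by simp [o, real_inner_smul_left]
  refine ⟨o, fun x => ?_⟩
  have hcong : ∀ i, (2 : ℤ) ∣ σ i * b i - b 0 := fun i => by
    have := hb2 i
    rcases hσ i with h | h <;> rw [h] <;> omega
  constructor
  · intro hx
    obtain ⟨a, ha, ha2⟩ := hhalf x hx
    have hc2 : ∀ i, (2 : ℤ) ∣ σ i * a i - a 0 := fun i => by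
      have := ha2 i
      rcases hσ i with h | h <;> rw [h] <;> omega
    refine ⟨fun i => σ i * a i, ⟨fun i => ?_, ?_⟩, fun i => ?_⟩
    · have h1 := hc2 i
      have h2 := hc2 0
      change (2 : ℤ) ∣ σ i * a i - σ 0 * a 0
      omega
    · by_cases hev : (2 : ℤ) ∣ a 0
      · have h0 : ∀ i, (2 : ℤ) ∣ a i := fun i => by have := ha2 i; omega
        choose c hc using h0
        have := (hparity c).2 ((hD x c fun i => by rw [ha, hc]; push_cast; ring).1 hx)
        have h3 : ∑ i, σ i * a i = 2 * ∑ i, σ i * c i := by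
          rw [Finset.mul_sum]
          exact Finset.sum_congr rfl fun i _ => by rw [hc]; ring
        rw [h3]; omega
      · have h0 : ∀ i, (2 : ℤ) ∣ a i - b i := fun i => by
          have := ha2 i; have := hb2 i; have := hbodd 0; omega
        choose c hc using h0
        have := (hparity c).2 ((hD (x - t) c fun i => by
          rw [inner_sub_right, ha, hb, ← sub_div, ← Int.cast_sub, hc]; push_cast; ring).1
          (U.sub_mem hx ht))
        have h3 : ∑ i, σ i * a i = 2 * ∑ i, σ i * c i + ∑ i, σ i * b i := by
          rw [Finset.mul_sum, ← Finset.sum_add_distrib]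
          refine Finset.sum_congr rfl fun i _ => ?_
          have : a i = 2 * c i + b i := by linarith [hc i]
          rw [this]; ring
        rw [h3]; omega
    · have : (σ i : ℝ) * σ i = 1 := by exact_mod_cast hσσ i
      rw [ho, ha]
      push_cast
      ring
  · rintro ⟨a, ⟨ha2, ha4⟩, ha⟩
    have ha' : ∀ i, ⟪e i, x⟫ = ((σ i * a i : ℤ) : ℝ) / 2 := by
      intro i
      have h1 : (σ i : ℝ) * σ i = 1 := by exact_mod_cast hσσ i
      have h2 := ha i
      rw [ho] at h2
      push_cast
      calc ⟪e i, x⟫ = σ i * (σ i * ⟪e i, x⟫) := by rw [← mul_assoc, h1, one_mul]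
        _ = _ := by rw [h2]; ring
    by_cases hev : (2 : ℤ) ∣ a 0
    · have h0 : ∀ i, (2 : ℤ) ∣ a i := fun i => by have := ha2 i; omega
      choose c hc using h0
      refine (hD x (fun i => σ i * c i) fun i => ?_).2 ((hparity c).2 ?_)
      · rw [ha', hc]; push_cast; ring
      · have : ∑ i, a i = 2 * ∑ i, c i := by
          rw [Finset.mul_sum]; exact Finset.sum_congr rfl fun i _ => hc i
        omega
    · have h0 : ∀ i, (2 : ℤ) ∣ a i - σ i * b i := fun i => by
        have := ha2 i; have := hcong i; have := hbodd 0; omega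
      choose c hc using h0
      have hxt : x - t ∈ U := by
        refine (hD _ (fun i => σ i * c i) fun i => ?_).2 ((hparity c).2 ?_)
        · rw [inner_sub_right, ha', hb]
          have h5 : (a i : ℝ) = 2 * c i + σ i * b i := by
            have := hc i
            exact_mod_cast (by linarith : a i = 2 * c i + σ i * b i)
          have h1 : (σ i : ℝ) * σ i = 1 := by exact_mod_cast hσσ i
          push_cast
          rw [h5]
          linear_combination (b i : ℝ) / 2 * h1
        · have h6 : ∑ i, (a i - σ i * b i) = 2 * ∑ i, c i := by
            rw [Finset.mul_sum]; exact Finset.sum_congr rfl fun i _ => hc i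
          rw [Finset.sum_sub_distrib] at h6
          omega
      have := U.add_mem hxt ht
      rwa [sub_add_cancel] at this

/-- The even self-dual lattices of rank eight are isometric to `E₈`. -/
theorem exists_isE8 [FiniteDimensional ℝ E] {U : Submodule ℤ E}
    [DiscreteTopology U] [IsZLattice ℝ U] (hU : IsSelfDual U) (heven : IsEven U)
    (hE : finrank ℝ E = 8) : ∃ e : OrthonormalBasis (Fin 8) ℝ E, IsE8 U e := by
  obtain ⟨r, hr, hr4⟩ := exists_four_roots hU heven hE
  set f : E := (1 / 2 : ℝ) • (r 0 + r 1) with hfdef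
  have hI := hr.inner_eq
  have h2f' : (2 : ℤ) • f = r 0 + r 1 := by
    rw [← Int.cast_smul_eq_zsmul ℝ, hfdef, smul_smul]; norm_num
  have h2f : (2 : ℤ) • f ∈ U := by rw [h2f']; exact U.add_mem (hr.mem 0) (hr.mem 1)
  have hf : ⟪f, f⟫ = 1 := by
    rw [hfdef, real_inner_smul_left, real_inner_smul_right, inner_add_left, inner_add_right,
      inner_add_right]
    simp only [hI]
    norm_num
  have hN := neighbour_isSelfDual hU heven hf h2f
  have : DiscreteTopology (neighbour U f) :=
    discreteTopology_of_integral fun x hx => (hN x).1 hx x hx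
  have : IsZLattice ℝ (neighbour U f) := by
    constructor
    rw [eq_top_iff, ← IsZLattice.span_top (K := ℝ) (L := U), Submodule.span_le]
    intro u hu
    have h2u : (2 : ℤ) • u ∈ neighbour U f := by
      obtain ⟨k, hk⟩ := (hU _).1 h2f u hu
      refine ⟨(2 : ℤ) • u, U.smul_mem _ hu, 0, ⟨k, ?_⟩, by simp⟩
      rw [← hk, real_inner_zsmul_left, real_inner_zsmul_left, real_inner_comm]
    have : u = (1 / 2 : ℝ) • ((2 : ℤ) • u) := by
      rw [← Int.cast_smul_eq_zsmul ℝ, smul_smul]; norm_num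
    rw [this]
    exact Submodule.smul_mem _ _ (Submodule.subset_span h2u)
  -- These are `(r 0 ± r 1) / 2` and `(r 2 ± r 3) / 2`. A start with four orthonormal vectors is
  -- essential: for fewer, the volume bound used to extend the family by a unit vector fails.
  let s : Fin 4 → E := ![f, f - r 1, (1 / 2 : ℝ) • ∑ i, r i - f,
    (1 / 2 : ℝ) • ∑ i, r i - f - r 3]
  have hfr : ∀ i, ⟪r i, f⟫ = if i = 0 ∨ i = 1 then 1 else 0 := by
    intro i
    rw [hfdef, real_inner_smul_right, inner_add_right, hI, hI]
    fin_cases i <;> simp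
  have hr' : ∀ i, ⟪r i, (1 / 2 : ℝ) • ∑ j, r j⟫ = 1 := by
    intro i
    rw [real_inner_smul_right, inner_sum]
    simp [hI]
  have hhN : ∀ u ∈ U, ∀ k l : ℤ, ⟪u, f⟫ = l → u + k • f ∈ neighbour U f :=
    fun u hu k l hl => ⟨u, hu, k, ⟨l, hl⟩, rfl⟩
  have hhf : ⟪(1 / 2 : ℝ) • ∑ j, r j, f⟫ = 1 := by
    rw [real_inner_smul_left, sum_inner, Fin.sum_univ_four]
    have h2 : ¬ ((2 : Fin 4) = 0 ∨ (2 : Fin 4) = 1) := by decide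
    have h3 : ¬ ((3 : Fin 4) = 0 ∨ (3 : Fin 4) = 1) := by decide
    simp only [hfr, if_neg h2, if_neg h3]
    norm_num
  have hs : OrthogonalFamilyIn (neighbour U f) 1 s := by
    constructor
    · intro i
      fin_cases i
      · have := hhN 0 U.zero_mem 1 0 (by simp)
        simpa [s] using this
      · have := hhN (-r 1) (U.neg_mem (hr.mem 1)) 1 (-1) (by rw [inner_neg_left, hfr]; simp)
        simpa [s, sub_eq_neg_add] using this
      · have := hhN _ hr4 (-1) 1 (by rw [hhf]; simp)
        simpa [s, sub_eq_add_neg] using this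
      · have := hhN _ (U.sub_mem hr4 (hr.mem 3)) (-1) 1 (by
          rw [inner_sub_left, hhf, hfr]; simp)
        simpa [s, sub_eq_add_neg, add_assoc, add_comm, add_left_comm] using this
    · have hrr : ∑ i, r i = r 0 + r 1 + r 2 + r 3 := Fin.sum_univ_four r
      have hs' : ∀ i, s i = (1 / 2 : ℝ) • (r (![0, 0, 2, 2] i) +
          (![1, -1, 1, -1] i : ℝ) • r (![1, 1, 3, 3] i)) := by
        intro i
        fin_cases i
        · simp [s, hfdef]
        · simp only [s, hfdef]; simp; module
        · simp only [s, hfdef, hrr]; simp; module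
        · simp only [s, hfdef, hrr]; simp; module
      intro i j
      rw [hs', hs']
      simp only [real_inner_smul_left, real_inner_smul_right, inner_add_left, inner_add_right, hI]
      fin_cases i <;> fin_cases j <;> simp <;> norm_num
  have hmin : ∀ x ∈ neighbour U f, x ≠ 0 → ⟪x, x⟫ < 2 * 1 → ⟪x, x⟫ = 1 := by
    intro x hx hx0 hlt
    obtain ⟨k, hk⟩ := (hN x).1 hx x hx
    have hpos : 0 < ⟪x, x⟫ := real_inner_self_pos.2 hx0
    rw [hk] at hlt hpos ⊢
    have h1 : k < 2 := by exact_mod_cast (by linarith : (k : ℝ) < 2)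
    have h2 : 0 < k := by exact_mod_cast hpos
    have : k = 1 := by omega
    subst this; norm_num
  obtain ⟨r', hr', -⟩ := OrthogonalFamilyIn.exists_extend hN hE one_pos hmin hs 8
    (by norm_num) le_rfl (by
      intro j _ hj
      interval_cases j <;> norm_num [unitBallBound])
  have ho : Orthonormal ℝ r' := orthonormal_iff_ite.2 hr'.inner_eq
  let e : OrthonormalBasis (Fin 8) ℝ E := OrthonormalBasis.mk ho (by
    rw [ho.linearIndependent.span_eq_top_of_card_eq_finrank (by rw [hE]; rfl)])
  exact exists_isE8_of_neighbour hU heven hf h2f e fun i => by simpa [e] using hr'.mem i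

end E8


/-! ### The fundamental alcove of `E₈` dilated by five -/

section Alcove

variable {E : Type*} [NormedAddCommGroup E] [InnerProductSpace ℝ E]

/-- The vector with coordinates `a i / 2` with respect to an orthonormal basis. -/
noncomputable def coordVec (e : OrthonormalBasis (Fin 8) ℝ E) (a : Fin 8 → ℤ) : E :=
  ∑ i, ((a i : ℝ) / 2) • e i

theorem inner_basis_coordVec (e : OrthonormalBasis (Fin 8) ℝ E) (a : Fin 8 → ℤ) (i : Fin 8) :
    ⟪e i, coordVec e a⟫ = (a i : ℝ) / 2 := by
  have h : ∀ j, ⟪e i, e j⟫ = if i = j then (1 : ℝ) else 0 :=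
    fun j => orthonormal_iff_ite.1 e.orthonormal i j
  simp [coordVec, inner_sum, real_inner_smul_right, h]

theorem inner_coordVec_left (e : OrthonormalBasis (Fin 8) ℝ E) (a : Fin 8 → ℤ) (x : E) :
    ⟪coordVec e a, x⟫ = ∑ i, (a i : ℝ) / 2 * ⟪e i, x⟫ := by
  simp [coordVec, sum_inner, real_inner_smul_left]

theorem inner_coordVec (e : OrthonormalBasis (Fin 8) ℝ E) (a b : Fin 8 → ℤ) :
    ⟪coordVec e a, coordVec e b⟫ = ((∑ i, a i * b i : ℤ) : ℝ) / 4 := by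
  rw [inner_coordVec_left]
  push_cast
  rw [Finset.sum_div]
  exact Finset.sum_congr rfl fun i _ => by rw [inner_basis_coordVec]; ring

theorem eq_coordVec (e : OrthonormalBasis (Fin 8) ℝ E) {a : Fin 8 → ℤ} {x : E}
    (h : ∀ i, ⟪e i, x⟫ = (a i : ℝ) / 2) : x = coordVec e a := by
  rw [← e.sum_repr' x]
  exact Finset.sum_congr rfl fun i _ => by rw [h]

theorem IsE8.coordVec_mem {U : Submodule ℤ E} {e : OrthonormalBasis (Fin 8) ℝ E} (h : IsE8 U e)
    {a : Fin 8 → ℤ} (ha : IsE8Coord a) : coordVec e a ∈ U :=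
  (h _).2 ⟨a, ha, inner_basis_coordVec e a⟩

/-- Transporting an `E₈`-basis by an isometry that preserves the lattice. -/
theorem IsE8.map {U : Submodule ℤ E} {e : OrthonormalBasis (Fin 8) ℝ E} (h : IsE8 U e)
    (g : E ≃ₗᵢ[ℝ] E) (hg : ∀ x, g x ∈ U ↔ x ∈ U) : IsE8 U (e.map g) := by
  intro x
  have h1 : ∀ i, ⟪(e.map g) i, x⟫ = ⟪e i, g.symm x⟫ := fun i => by
    rw [OrthonormalBasis.map_apply, ← g.inner_map_map (e i), g.apply_symm_apply]
  simp only [h1]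
  rw [← h, ← hg (g.symm x), g.apply_symm_apply]

/-- The reflection in a vector `r` of norm `2`. -/
noncomputable def rootReflection (r : E) (hr : ⟪r, r⟫ = 2) : E ≃ₗᵢ[ℝ] E where
  toFun x := x - ⟪r, x⟫ • r
  map_add' x y := by rw [inner_add_right, add_smul]; abel
  map_smul' c x := by
    rw [real_inner_smul_right, RingHom.id_apply, smul_sub, mul_smul]
  invFun x := x - ⟪r, x⟫ • r
  left_inv x := by
    simp only [inner_sub_right, real_inner_smul_right, hr]; module
  right_inv x := by
    simp only [inner_sub_right, real_inner_smul_right, hr]; module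
  norm_map' x := by
    rw [← sq_eq_sq₀ (norm_nonneg _) (norm_nonneg _), ← real_inner_self_eq_norm_sq,
      ← real_inner_self_eq_norm_sq]
    simp only [LinearEquiv.coe_mk, LinearMap.coe_mk, AddHom.coe_mk, inner_sub_left,
      inner_sub_right, real_inner_smul_left, real_inner_smul_right, hr, real_inner_comm r x]
    ring

theorem rootReflection_apply (r : E) (hr : ⟪r, r⟫ = 2) (x : E) :
    rootReflection r hr x = x - ⟪r, x⟫ • r := rfl

theorem rootReflection_mem {U : Submodule ℤ E}
    (hint : ∀ x ∈ U, ∀ y ∈ U, ∃ k : ℤ, ⟪x, y⟫ = (k : ℝ)) {r : E} (hr : ⟪r, r⟫ = 2) (hrU : r ∈ U)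
    (x : E) : rootReflection r hr x ∈ U ↔ x ∈ U := by
  have h1 : ∀ x ∈ U, rootReflection r hr x ∈ U := by
    intro x hx
    obtain ⟨k, hk⟩ := hint r hrU x hx
    rw [rootReflection_apply, hk, Int.cast_smul_eq_zsmul]
    exact U.sub_mem hx (U.smul_mem k hrU)
  refine ⟨fun h => ?_, h1 x⟩
  have := h1 _ h
  rwa [show rootReflection r hr (rootReflection r hr x) = x from
    (rootReflection r hr).left_inv x] at this

/-- The simple roots of `E₈` (multiplied by two), in Bourbaki's numbering. -/
def simpleRoot : Fin 8 → Fin 8 → ℤ :=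
  ![![1, -1, -1, -1, -1, -1, -1, 1], ![2, 2, 0, 0, 0, 0, 0, 0], ![-2, 2, 0, 0, 0, 0, 0, 0],
    ![0, -2, 2, 0, 0, 0, 0, 0], ![0, 0, -2, 2, 0, 0, 0, 0], ![0, 0, 0, -2, 2, 0, 0, 0],
    ![0, 0, 0, 0, -2, 2, 0, 0], ![0, 0, 0, 0, 0, -2, 2, 0]]

/-- The highest root of `E₈` (multiplied by two). -/
def highestRoot : Fin 8 → ℤ := ![0, 0, 0, 0, 0, 0, 2, 2]

/-- The Weyl vector of `E₈`. -/
def weylVector : Fin 8 → ℤ := ![0, 1, 2, 3, 4, 5, 6, 23]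

instance (a : Fin 8 → ℤ) : Decidable (IsE8Coord a) := by unfold IsE8Coord; infer_instance

/-- A measure for the distance of a vector from the barycentric point of the fundamental alcove. -/
def alcoveDist (a : Fin 8 → ℤ) : ℕ := (∑ i, (3 * a i - weylVector i) ^ 2).toNat

/-- `alcoveDist` is 36 times the squared distance to `ρ/6 = 5 ρ/30`, where `30` is the Coxeter
number; this point is inside the dilated alcove. Here `n` is the product of the vector with the root
`A / 2` and `p` is the height of that root. -/
theorem alcoveDist_sub_lt {a A : Fin 8 → ℤ} {n h p : ℤ} (hA : ∑ i, A i ^ 2 = 8)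
    (hn : ∑ i, A i * a i = 4 * n) (hp : ∑ i, A i * weylVector i = 2 * p)
    (hlt : 0 < h * (6 * n - 6 * h - p)) :
    alcoveDist (fun i => a i - h * A i) < alcoveDist a := by
  have h0 : ∀ b : Fin 8 → ℤ, 0 ≤ ∑ i, (3 * b i - weylVector i) ^ 2 :=
    fun b => Finset.sum_nonneg fun i _ => sq_nonneg _
  have h1 : ∑ i, (3 * (a i - h * A i) - weylVector i) ^ 2 =
      ∑ i, (3 * a i - weylVector i) ^ 2 - 18 * h * (∑ i, A i * a i) +
        6 * h * (∑ i, A i * weylVector i) + 9 * h ^ 2 * ∑ i, A i ^ 2 := by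
    simp only [Finset.mul_sum, ← Finset.sum_sub_distrib, ← Finset.sum_add_distrib]
    exact Finset.sum_congr rfl fun i _ => by ring
  rw [hA, hn, hp] at h1
  have h2 : ∑ i, (3 * (a i - h * A i) - weylVector i) ^ 2 < ∑ i, (3 * a i - weylVector i) ^ 2 := by
    linarith
  exact (Int.toNat_lt_toNat (lt_of_le_of_lt (h0 fun i => a i - h * A i) h2)).2 h2

/-- Every coset of `5 U` has a representative in the fundamental alcove, for a suitable choice of
the basis. -/
theorem IsE8.exists_alcove {U : Submodule ℤ E} {e₀ : OrthonormalBasis (Fin 8) ℝ E}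
    (h₀ : IsE8 U e₀) (hint : ∀ x ∈ U, ∀ y ∈ U, ∃ k : ℤ, ⟪x, y⟫ = (k : ℝ)) {w : E} (hw : w ∈ U) :
    ∃ e : OrthonormalBasis (Fin 8) ℝ E, IsE8 U e ∧ ∃ a : Fin 8 → ℤ, IsE8Coord a ∧
      (∃ u ∈ U, w = coordVec e a + (5 : ℤ) • u) ∧
      (∀ s, 0 ≤ ∑ i, simpleRoot s i * a i) ∧ ∑ i, highestRoot i * a i ≤ 20 := by
  classical
  -- The affine Weyl group acts by changing the basis and translating by `5 U`. A representative
  -- closest to the interior point is in the alcove, since reflection in a violated wall would bring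
  -- it closer.
  let P : ℕ → Prop := fun N => ∃ e : OrthonormalBasis (Fin 8) ℝ E, IsE8 U e ∧
    ∃ a : Fin 8 → ℤ, IsE8Coord a ∧ (∃ u ∈ U, w = coordVec e a + (5 : ℤ) • u) ∧ alcoveDist a = N
  have hP : ∃ N, P N := by
    obtain ⟨a, ha, haw⟩ := (h₀ w).1 hw
    exact ⟨_, e₀, h₀, a, ha, ⟨0, U.zero_mem, by rw [smul_zero, add_zero]; exact eq_coordVec e₀ haw⟩,
      rfl⟩
  obtain ⟨e, he, a, ha, ⟨u, hu, hwu⟩, hN⟩ := Nat.find_spec hP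
  have hmin : ∀ (e' : OrthonormalBasis (Fin 8) ℝ E), IsE8 U e' → ∀ a' : Fin 8 → ℤ,
      (∃ u ∈ U, w = coordVec e' a' + (5 : ℤ) • u) → ¬ alcoveDist a' < alcoveDist a := by
    rintro e' he' a' ⟨u', hu', hwu'⟩ hlt
    rw [hN] at hlt
    refine Nat.find_min hP hlt ⟨e', he', a', ?_, ⟨u', hu', hwu'⟩, rfl⟩
    have hz : coordVec e' a' ∈ U := by
      rw [eq_sub_of_add_eq hwu'.symm]; exact U.sub_mem hw (U.smul_mem _ hu')
    obtain ⟨b, hb, hbz⟩ := (he' _).1 hz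
    have : a' = b := by
      ext i
      have := hbz i
      rw [inner_basis_coordVec] at this
      exact_mod_cast (by linarith : (a' i : ℝ) = b i)
    rwa [this]
  have hinner : ∀ A : Fin 8 → ℤ, IsE8Coord A → ∃ n : ℤ, ∑ i, A i * a i = 4 * n := by
    intro A hA
    obtain ⟨n, hn⟩ := hint _ (he.coordVec_mem hA) _ (he.coordVec_mem ha)
    rw [inner_coordVec] at hn
    exact ⟨n, by exact_mod_cast (by linarith : ((∑ i, A i * a i : ℤ) : ℝ) = 4 * n)⟩
  -- the reflection in the root `A`, followed by the translation by `5 m A`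
  have hrefl : ∀ A : Fin 8 → ℤ, IsE8Coord A → ∑ i, A i ^ 2 = 8 → ∀ n m : ℤ,
      ∑ i, A i * a i = 4 * n → ¬ alcoveDist (fun i => a i - (n - 5 * m) * A i) < alcoveDist a := by
    intro A hA hA8 n m hn
    have hAU := he.coordVec_mem hA
    have hr : ⟪coordVec e A, coordVec e A⟫ = 2 := by
      rw [inner_coordVec, show ∑ i, A i * A i = 8 by
        rw [← hA8]; exact Finset.sum_congr rfl fun i _ => (sq _).symm]
      norm_num
    have hmem := rootReflection_mem hint hr hAU
    refine hmin _ (he.map (rootReflection _ hr) hmem) _ ⟨u + m • coordVec e A, U.add_mem hu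
      (U.smul_mem _ hAU), ?_⟩
    have hinv : rootReflection _ hr (coordVec e A) = - coordVec e A := by
      rw [rootReflection_apply, hr]; module
    have h1 : coordVec (e.map (rootReflection _ hr)) (fun i => a i - (n - 5 * m) * A i) =
        rootReflection _ hr (coordVec e a - ((n : ℝ) - 5 * m) • coordVec e A) := by
      simp only [coordVec, OrthonormalBasis.map_apply, Finset.smul_sum, ← Finset.sum_sub_distrib,
        map_sum, map_sub, map_smul]
      refine Finset.sum_congr rfl fun i _ => ?_
      push_cast
      rw [smul_smul, ← sub_smul]
      congr 1; ring
    rw [h1, map_sub, map_smul, hinv, rootReflection_apply, inner_coordVec, hn, hwu]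
    rw [← Int.cast_smul_eq_zsmul ℝ 5, ← Int.cast_smul_eq_zsmul ℝ 5, ← Int.cast_smul_eq_zsmul ℝ m]
    push_cast
    module
  refine ⟨e, he, a, ha, ⟨u, hu, hwu⟩, fun s => ?_, ?_⟩
  · have hA : IsE8Coord (simpleRoot s) ∧ ∑ i, simpleRoot s i ^ 2 = 8 ∧
        ∑ i, simpleRoot s i * weylVector i = 2 * 1 := by revert s; decide
    obtain ⟨n, hn⟩ := hinner _ hA.1
    by_contra hneg
    refine hrefl _ hA.1 hA.2.1 n 0 hn (alcoveDist_sub_lt hA.2.1 hn hA.2.2 ?_)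
    have : n < 0 := by omega
    nlinarith
  -- The highest root has height `29`, just below `30 = 6 * 5`; this puts the reference point on the
  -- inner side of the wall at height five.
  · have hA : IsE8Coord highestRoot ∧ ∑ i, highestRoot i ^ 2 = 8 ∧
        ∑ i, highestRoot i * weylVector i = 2 * 29 := by decide
    obtain ⟨n, hn⟩ := hinner _ hA.1
    by_contra hneg
    refine hrefl _ hA.1 hA.2.1 n 1 hn (alcoveDist_sub_lt hA.2.1 hn hA.2.2 ?_)
    have : 5 < n := by omega
    nlinarith

end Alcove


/-! ### Rootlessness forces the vertex of type `A₄ + A₄` -/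

section RootSubsystem

variable {E : Type*} [NormedAddCommGroup E] [InnerProductSpace ℝ E]

/-- The combination of the simple roots of `E₈` with coefficients `c` (multiplied by two). -/
def rootComb (c : Fin 8 → ℤ) (j : Fin 8) : ℤ := ∑ s, c s * simpleRoot s j

/-- Six partial sums take only five values. In terms of roots: every linear map from the root
lattice `A₅` to `ℤ/5` kills a root. -/
theorem exists_Ico_sum_eq_zero (x : ℕ → ZMod 5) :
    ∃ a b, a < b ∧ b ≤ 5 ∧ ∑ k ∈ Finset.Ico a b, x k = 0 := by
  obtain ⟨i, j, hij, h⟩ := Fintype.exists_ne_map_eq_of_card_lt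
    (fun m : Fin 6 => ∑ k ∈ Finset.range m, x k) (by simp [ZMod.card])
  wlog hlt : i < j generalizing i j
  · exact this j i hij.symm h.symm (lt_of_le_of_ne (not_lt.1 hlt) hij.symm)
  refine ⟨i, j, hlt, by omega, ?_⟩
  rw [Finset.sum_Ico_eq_sub _ hlt.le, sub_eq_zero]
  exact h.symm

/-- The same for `D₄`: the alternatives run over its twelve positive roots, with `t` at the central
node. -/
theorem exists_D4_sum_eq_zero : ∀ x y z t : ZMod 5, x = 0 ∨ y = 0 ∨ z = 0 ∨ t = 0 ∨ x + t = 0 ∨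
    y + t = 0 ∨ t + z = 0 ∨ x + y + t = 0 ∨ x + t + z = 0 ∨ y + t + z = 0 ∨ x + y + t + z = 0 ∨
    x + y + 2 * t + z = 0 := by
  decide

/-- The sum of the simple roots `p a, …, p (b - 1)`. -/
def chainCoeff (p : ℕ → Fin 8) (a b : ℕ) (s : Fin 8) : ℤ :=
  ∑ k ∈ Finset.Ico a b, if p k = s then 1 else 0

theorem sum_chainCoeff_mul (p : ℕ → Fin 8) (a b : ℕ) (f : Fin 8 → ℤ) :
    ∑ s, chainCoeff p a b s * f s = ∑ k ∈ Finset.Ico a b, f (p k) := by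
  simp only [chainCoeff, Finset.sum_mul]
  rw [Finset.sum_comm]
  simp

/-- A sublattice of index `25` of `E₈` without roots determines a vertex of type `A₄ + A₄` of the
fundamental alcove. -/
theorem simpleRoot_values_eq {n f : Fin 8 → ℤ} (hn : ∀ s, 0 ≤ n s)
    (h5 : 2 * n 0 + 3 * n 1 + 4 * n 2 + 6 * n 3 + 5 * n 4 + 4 * n 5 + 3 * n 6 + 2 * n 7 ≤ 5)
    (hf : ∀ c : Fin 8 → ℤ, IsE8Coord (rootComb c) → ∑ j, rootComb c j ^ 2 = 8 →
      ∑ s, c s * n s = 0 → ((∑ s, c s * f s : ℤ) : ZMod 5) ≠ 0) :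
    n = ![0, 0, 0, 0, 1, 0, 0, 0] := by
  have hn' : 0 ≤ n 0 ∧ 0 ≤ n 1 ∧ 0 ≤ n 2 ∧ 0 ≤ n 3 ∧ 0 ≤ n 4 ∧ 0 ≤ n 5 ∧ 0 ≤ n 6 ∧ 0 ≤ n 7 :=
    ⟨hn 0, hn 1, hn 2, hn 3, hn 4, hn 5, hn 6, hn 7⟩
  have hA5 : ∀ p : ℕ → Fin 8, (∀ k < 5, n (p k) = 0) → (∀ b ≤ 5, ∀ a < b,
      IsE8Coord (rootComb (chainCoeff p a b)) ∧
        ∑ j, rootComb (chainCoeff p a b) j ^ 2 = 8) → False := by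
    intro p hp hroot
    obtain ⟨a, b, hab, hb, h0⟩ := exists_Ico_sum_eq_zero fun k => (f (p k) : ZMod 5)
    refine hf _ (hroot b hb a hab).1 (hroot b hb a hab).2 ?_ ?_
    · rw [sum_chainCoeff_mul]
      exact Finset.sum_eq_zero fun k hk => hp k (by have := Finset.mem_Ico.1 hk; omega)
    · rw [sum_chainCoeff_mul]; push_cast; exact h0
  -- The coefficients in `h5` are the marks of the highest root. A nonzero value at the node of mark
  -- five uses up the whole bound. Otherwise the node of mark six also has value zero, and the nodes
  -- of value zero contain a diagram `D₄` or `A₅`, on which `f` kills a root.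
  by_cases h4 : n 4 = 0
  · exfalso
    by_cases h2 : n 2 = 0
    · by_cases h1 : n 1 = 0
      · have h3 : n 3 = 0 := by omega
        have key : ∀ c₁ c₂ c₃ c₄ : ℤ, IsE8Coord (rootComb ![0, c₁, c₂, c₃, c₄, 0, 0, 0]) →
            ∑ j, rootComb ![0, c₁, c₂, c₃, c₄, 0, 0, 0] j ^ 2 = 8 →
            (c₁ * f 1 + c₂ * f 2 + c₃ * f 3 + c₄ * f 4 : ZMod 5) ≠ 0 := by
          intro c₁ c₂ c₃ c₄ ha hb
          have := hf _ ha hb (by simp [Fin.sum_univ_eight, h1, h2, h3, h4])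
          simpa [Fin.sum_univ_eight] using this
        rcases exists_D4_sum_eq_zero (f 1) (f 2) (f 4) (f 3) with
          h | h | h | h | h | h | h | h | h | h | h | h
        · exact key 1 0 0 0 (by decide) (by decide) (by simpa using h)
        · exact key 0 1 0 0 (by decide) (by decide) (by simpa using h)
        · exact key 0 0 0 1 (by decide) (by decide) (by simpa using h)
        · exact key 0 0 1 0 (by decide) (by decide) (by simpa using h)
        · exact key 1 0 1 0 (by decide) (by decide) (by simpa using h)
        · exact key 0 1 1 0 (by decide) (by decide) (by simpa using h)
        · exact key 0 0 1 1 (by decide) (by decide) (by simpa using h)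
        · exact key 1 1 1 0 (by decide) (by decide) (by simpa using h)
        · exact key 1 0 1 1 (by decide) (by decide) (by simpa using h)
        · exact key 0 1 1 1 (by decide) (by decide) (by simpa using h)
        · exact key 1 1 1 1 (by decide) (by decide) (by simpa using h)
        · exact key 1 1 2 1 (by decide) (by decide) (by simpa using h)
      · refine hA5 (fun k => ![2, 3, 4, 5, 6] (Fin.ofNat 5 k)) (fun k hk => ?_) (by decide)
        have h : n 2 = 0 ∧ n 3 = 0 ∧ n 4 = 0 ∧ n 5 = 0 ∧ n 6 = 0 := by omega
        interval_cases k
        exacts [h.1, h.2.1, h.2.2.1, h.2.2.2.1, h.2.2.2.2]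
    · refine hA5 (fun k => ![1, 3, 4, 5, 6] (Fin.ofNat 5 k)) (fun k hk => ?_) (by decide)
      have h : n 1 = 0 ∧ n 3 = 0 ∧ n 4 = 0 ∧ n 5 = 0 ∧ n 6 = 0 := by omega
      interval_cases k
      exacts [h.1, h.2.1, h.2.2.1, h.2.2.2.1, h.2.2.2.2]
  · ext s
    fin_cases s <;> simp <;> omega

/-- Two orthogonal systems of five minimal vectors of the dual of the root lattice `A₄`. -/
structure IsA4Frame (ω : Fin 2 → Fin 5 → E) : Prop where
  inner_eq : ∀ s i t j, ⟪ω s i, ω t j⟫ = if s = t then (if i = j then 4 / 5 else -1 / 5) else 0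

/-- Representatives of the frame vectors in the lattice `E₈`. -/
def frameRep : Fin 2 → Fin 5 → Fin 8 → ℤ :=
  ![![![0, 0, 0, -2, -2, -2, -2, -4], ![-1, 1, 1, -1, -1, -1, -1, -5],
      ![1, -1, 1, -1, -1, -1, -1, -5], ![1, 1, -1, -1, -1, -1, -1, -5],
      ![-1, -1, -1, -1, -1, -1, -1, -5]],
    ![![0, 0, 0, -2, 0, 0, 0, -2], ![0, 0, 0, 0, -2, 0, 0, -2], ![0, 0, 0, 0, 0, -2, 0, -2],
      ![0, 0, 0, 0, 0, 0, -2, -2], ![0, 0, 0, 0, 0, 0, 0, 0]]]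

/-- The fundamental coweight of `E₈` at the node with mark five (multiplied by two). -/
def coweight : Fin 8 → ℤ := ![0, 0, 0, 2, 2, 2, 2, 8]

/-- The multiples of the coweight that correct `frameRep`. -/
def frameShift : Fin 2 → ℤ := ![3, 1]

theorem IsE8.exists_A4Frame {U : Submodule ℤ E} {e₀ : OrthonormalBasis (Fin 8) ℝ E}
    (h₀ : IsE8 U e₀) (hint : ∀ x ∈ U, ∀ y ∈ U, ∃ k : ℤ, ⟪x, y⟫ = (k : ℝ)) {y y' : E}
    (hy : (5 : ℤ) • y ∈ U) (hy' : (5 : ℤ) • y' ∈ U)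
    (hroot : ∀ r ∈ U, ⟪r, r⟫ = 2 → (∃ k : ℤ, ⟪r, y⟫ = (k : ℝ)) → ¬ ∃ k : ℤ, ⟪r, y'⟫ = (k : ℝ)) :
    ∃ ω : Fin 2 → Fin 5 → E, IsA4Frame ω ∧ (∀ s i, ∃ u ∈ U, ∃ c : ℤ, ω s i = u + c • y) ∧
      ∀ s i j, ω s i - ω s j ∈ U ∧ ∃ k : ℤ, ⟪ω s i - ω s j, y⟫ = (k : ℝ) := by
  obtain ⟨e, he, a, ha, ⟨u, hu, hw⟩, hs, hθ⟩ := h₀.exists_alcove hint hy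
  have hS : ∀ s, IsE8Coord (simpleRoot s) := by decide
  have hSU := fun s => he.coordVec_mem (hS s)
  have hn : ∀ s, ∃ n : ℤ, ∑ i, simpleRoot s i * a i = 4 * n := by
    intro s
    obtain ⟨n, hn⟩ := hint _ (hSU s) _ (he.coordVec_mem ha)
    rw [inner_coordVec] at hn
    exact ⟨n, by exact_mod_cast (by linarith : ((∑ i, simpleRoot s i * a i : ℤ) : ℝ) = 4 * n)⟩
  choose n hn using hn
  choose f hf using fun s => hint _ (hSU s) _ hy'
  have hcomb : ∀ c x, ⟪coordVec e (rootComb c), x⟫ =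
      ∑ s, (c s : ℝ) * ⟪coordVec e (simpleRoot s), x⟫ := by
    intro c x
    simp only [inner_coordVec_left, rootComb, Finset.mul_sum]
    rw [Finset.sum_comm]
    refine Finset.sum_congr rfl fun i _ => ?_
    push_cast
    rw [Finset.sum_div, Finset.sum_mul]
    exact Finset.sum_congr rfl fun j _ => by ring
  have hexp : ∀ s, simpleRoot s 0 * a 0 + simpleRoot s 1 * a 1 + simpleRoot s 2 * a 2 +
      simpleRoot s 3 * a 3 + simpleRoot s 4 * a 4 + simpleRoot s 5 * a 5 + simpleRoot s 6 * a 6 +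
      simpleRoot s 7 * a 7 = 4 * n s := fun s => by rw [← hn, Fin.sum_univ_eight]
  have e0 := hexp 0
  have e1 := hexp 1
  have e2 := hexp 2
  have e3 := hexp 3
  have e4 := hexp 4
  have e5 := hexp 5
  have e6 := hexp 6
  have e7 := hexp 7
  simp [simpleRoot] at e0 e1 e2 e3 e4 e5 e6 e7
  simp [Fin.sum_univ_eight, highestRoot] at hθ
  have hn1 := simpleRoot_values_eq (n := n) (f := f)
    (fun s => by have := hs s; rw [hn] at this; omega) (by omega) (by
      intro c hc hc8 hc0 hcf
      have h2 : ⟪coordVec e (rootComb c), coordVec e (rootComb c)⟫ = 2 := by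
        rw [inner_coordVec, show ∑ i, rootComb c i * rootComb c i = 8 by
          rw [← hc8]; exact Finset.sum_congr rfl fun i _ => (sq _).symm]
        norm_num
      refine hroot _ (he.coordVec_mem hc) h2 ?_ ?_
      · obtain ⟨k, hk⟩ := hint _ (he.coordVec_mem hc) _ hu
        have h1 : ⟪coordVec e (rootComb c), (5 : ℤ) • y⟫ = 5 * (k : ℝ) := by
          rw [hw, inner_add_right, real_inner_zsmul_right, hk, hcomb]
          have : ∑ s, (c s : ℝ) * ⟪coordVec e (simpleRoot s), coordVec e a⟫ =
              ((∑ s, c s * n s : ℤ) : ℝ) := by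
            push_cast
            refine Finset.sum_congr rfl fun s _ => ?_
            rw [inner_coordVec, hn]; push_cast; ring
          rw [this, hc0]; push_cast; ring
        rw [real_inner_zsmul_right] at h1
        exact ⟨k, by push_cast at h1; linarith⟩
      · have h1 : ⟪coordVec e (rootComb c), (5 : ℤ) • y'⟫ = ((∑ s, c s * f s : ℤ) : ℝ) := by
          rw [hcomb]; push_cast
          exact Finset.sum_congr rfl fun s _ => by rw [hf]
        obtain ⟨k, hk⟩ := (ZMod.intCast_zmod_eq_zero_iff_dvd _ 5).1 hcf
        rw [hk, real_inner_zsmul_right] at h1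
        exact ⟨k, by push_cast at h1; linarith⟩)
  rw [hn1] at e0 e1 e2 e3 e4 e5 e6 e7
  simp at e0 e1 e2 e3 e4 e5 e6 e7
  have haz : a = coweight := by
    ext i
    fin_cases i <;> simp [coweight] <;> omega
  subst haz
  -- Coordinates of the frame vectors, doubled and multiplied by five to stay integral. This is why
  -- `80` and `-20` below stand for `4/5` and `-1/5`.
  set W : Fin 2 → Fin 5 → Fin 8 → ℤ := fun s i j =>
    5 * frameRep s i j + frameShift s * coweight j with hW
  have hR : ∀ s i, IsE8Coord (frameRep s i) := by decide
  have hyu : y = (1 / 5 : ℝ) • coordVec e coweight + u := by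
    have : y = (1 / 5 : ℝ) • ((5 : ℤ) • y) := by
      rw [← Int.cast_smul_eq_zsmul ℝ, smul_smul]; norm_num
    rw [this, hw, smul_add, ← Int.cast_smul_eq_zsmul ℝ 5, smul_smul]
    norm_num
  have hωeq : ∀ s i, (1 / 5 : ℝ) • coordVec e (W s i) =
      coordVec e (frameRep s i) + (frameShift s / 5 : ℝ) • coordVec e coweight := by
    intro s i
    simp only [coordVec, Finset.smul_sum, ← Finset.sum_add_distrib, smul_smul, ← add_smul]
    refine Finset.sum_congr rfl fun j _ => ?_
    congr 1
    simp only [hW]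
    push_cast; ring
  have hsub : ∀ s i j, (1 / 5 : ℝ) • coordVec e (W s i) - (1 / 5 : ℝ) • coordVec e (W s j) =
      coordVec e (frameRep s i) - coordVec e (frameRep s j) := fun s i j => by
    rw [hωeq, hωeq]; abel
  refine ⟨fun s i => (1 / 5 : ℝ) • coordVec e (W s i), ⟨fun s i t j => ?_⟩, fun s i => ?_,
    fun s i j => ?_⟩
  · have h1 : ∀ s i t j, ∑ k, (5 * frameRep s i k + frameShift s * coweight k) *
        (5 * frameRep t j k + frameShift t * coweight k) =
        if s = t then (if i = j then 80 else -20) else 0 := by decide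
    rw [real_inner_smul_left, real_inner_smul_right, inner_coordVec, h1]
    split_ifs <;> norm_num
  · refine ⟨coordVec e (frameRep s i) - frameShift s • u,
      U.sub_mem (he.coordVec_mem (hR s i)) (U.smul_mem _ hu), frameShift s, ?_⟩
    simp only [hωeq, hyu, ← Int.cast_smul_eq_zsmul ℝ]
    module
  · have hmem : coordVec e (frameRep s i) - coordVec e (frameRep s j) ∈ U :=
      U.sub_mem (he.coordVec_mem (hR s i)) (he.coordVec_mem (hR s j))
    rw [hsub]
    refine ⟨hmem, ?_⟩
    obtain ⟨k, hk⟩ := hint _ hmem _ hu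
    have h1 : ∀ s i j, (20 : ℤ) ∣ ∑ k, frameRep s i k * coweight k -
      ∑ k, frameRep s j k * coweight k := by decide
    obtain ⟨q, hq⟩ := h1 s i j
    refine ⟨q + k, ?_⟩
    rw [hyu, inner_add_right, hk, real_inner_smul_right, inner_sub_left, inner_coordVec,
      inner_coordVec, ← sub_div, ← Int.cast_sub, hq]
    push_cast; ring

end RootSubsystem


/-! ### Weights of `A₄ + A₄` -/

section Frame

theorem sum_zsmul_mem_of_sub_mem {M : Type*} [AddCommGroup M] {A : Submodule ℤ M} {v : Fin 5 → M}
    (hA : ∀ i j, v i - v j ∈ A) {c : Fin 5 → ℤ} (hc : ∑ i, c i = 0) : ∑ i, c i • v i ∈ A := by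
  have : ∑ i, c i • v i = ∑ i, c i • (v i - v 0) := by
    simp only [smul_sub, Finset.sum_sub_distrib, ← Finset.sum_smul, hc, zero_smul, sub_zero]
  rw [this]
  exact Submodule.sum_mem _ fun i _ => A.smul_mem _ (hA i 0)

variable {E : Type*} [NormedAddCommGroup E] [InnerProductSpace ℝ E]

namespace IsA4Frame

variable {ω : Fin 2 → Fin 5 → E} (h : IsA4Frame ω)

include h

theorem inner_same (s : Fin 2) (i j : Fin 5) :
    ⟪ω s i, ω s j⟫ = (if i = j then 1 else 0) - 1 / 5 := by
  rw [h.inner_eq, if_pos rfl]; split_ifs <;> norm_num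

theorem inner_ne {s t : Fin 2} (hst : s ≠ t) (i j : Fin 5) : ⟪ω s i, ω t j⟫ = 0 := by
  rw [h.inner_eq, if_neg hst]

theorem sum_eq_zero (s : Fin 2) : ∑ i, ω s i = 0 := by
  rw [← inner_self_eq_zero (𝕜 := ℝ), sum_inner]
  simp only [inner_sum, h.inner_same]
  simp

theorem inner_sub_sub {s : Fin 2} {i j : Fin 5} (hij : i ≠ j) :
    ⟪ω s i - ω s j, ω s i - ω s j⟫ = 2 := by
  simp only [inner_sub_left, inner_sub_right, h.inner_same]
  simp [hij, hij.symm]; norm_num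

theorem span_eq_top (hE : finrank ℝ E = 8) :
    Submodule.span ℝ (Set.range fun p : Fin 2 × Fin 5 => ω p.1 p.2) = ⊤ := by
  have hli : LinearIndependent ℝ fun p : Fin 2 × Fin 4 => ω p.1 p.2.castSucc := by
    rw [Fintype.linearIndependent_iff]
    intro c hc p
    have h1 := congrArg (fun z => ⟪z, ω p.1 p.2.castSucc - ω p.1 (Fin.last 4)⟫) hc
    simp only [sum_inner, inner_zero_left, real_inner_smul_left] at h1
    rw [Finset.sum_eq_single p] at h1
    · rw [inner_sub_right, h.inner_same, h.inner_same, if_pos rfl,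
        if_neg (Fin.castSucc_lt_last _).ne] at h1
      simpa using h1
    · intro q _ hq
      by_cases hs : q.1 = p.1
      · have h2 : q.2 ≠ p.2 := fun h2 => hq (Prod.ext hs h2)
        rw [hs, inner_sub_right, h.inner_same, h.inner_same,
          if_neg (fun h3 => h2 (Fin.castSucc_injective _ h3)), if_neg (Fin.castSucc_lt_last _).ne]
        simp
      · rw [inner_sub_right, h.inner_ne hs, h.inner_ne hs]; simp
    · simp
  have := hli.span_eq_top_of_card_eq_finrank (by rw [hE]; rfl)
  rw [eq_top_iff, ← this]
  exact Submodule.span_mono (by rintro _ ⟨p, rfl⟩; exact ⟨(p.1, p.2.castSucc), rfl⟩)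

/-- Each block is a tight frame: its Gram matrix is the identity minus a constant matrix, and the
constant part is killed because the block sums to zero. -/
theorem sum_inner_smul (hE : finrank ℝ E = 8) (z : E) : ∑ s, ∑ i, ⟪ω s i, z⟫ • ω s i = z := by
  have hz : z ∈ Submodule.span ℝ (Set.range fun p : Fin 2 × Fin 5 => ω p.1 p.2) := by
    rw [h.span_eq_top hE]; trivial
  induction hz using Submodule.span_induction with
  | mem x hx =>
    obtain ⟨⟨t, j⟩, rfl⟩ := hx
    rw [Finset.sum_eq_single t]
    · simp only [h.inner_same, sub_smul, Finset.sum_sub_distrib, ← Finset.smul_sum,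
        h.sum_eq_zero]
      simp
    · intro s _ hst
      simp [h.inner_ne hst]
    · simp
  | zero => simp
  | add x y _ _ hx hy =>
    simp only [inner_add_right, add_smul, Finset.sum_add_distrib, hx, hy]
  | smul c x _ hx =>
    simp only [real_inner_smul_right, mul_smul, ← Finset.smul_sum, hx]

theorem inner_sum_smul_self (k : Fin 2 → Fin 5 → ℤ) :
    5 * ⟪∑ s, ∑ i, k s i • ω s i, ∑ s, ∑ i, k s i • ω s i⟫ =
      ((∑ s, (5 * ∑ i, k s i ^ 2 - (∑ i, k s i) ^ 2) : ℤ) : ℝ) := by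
  have h1 : ∀ s, ⟪∑ i, k s i • ω s i, ∑ i, k s i • ω s i⟫ =
      ∑ i, (k s i : ℝ) ^ 2 - (∑ i, (k s i : ℝ)) ^ 2 / 5 := by
    intro s
    rw [sum_inner]
    simp only [inner_sum, real_inner_zsmul_left, real_inner_zsmul_right, h.inner_same]
    simp only [mul_sub, Finset.sum_sub_distrib, mul_ite, mul_one, mul_zero, Finset.sum_ite_eq,
      Finset.mem_univ, if_true, ← Finset.sum_mul, ← Finset.mul_sum]
    congr 1
    · exact Finset.sum_congr rfl fun i _ => (sq _).symm
    · ring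
  have h2 : ∀ s t, s ≠ t → ⟪∑ i, k s i • ω s i, ∑ i, k t i • ω t i⟫ = 0 := by
    intro s t hst
    rw [sum_inner]
    simp [inner_sum, real_inner_zsmul_left, real_inner_zsmul_right, h.inner_ne hst]
  rw [Fin.sum_univ_two (f := fun s => ∑ i, k s i • ω s i), inner_add_left, inner_add_right,
    inner_add_right, h1, h1, h2 0 1 (by decide), h2 1 0 (by decide), Fin.sum_univ_two]
  push_cast
  ring

/-- Vectors that have integral products with the roots of `A₄ + A₄`. -/
theorem exists_int_coords (hE : finrank ℝ E = 8) {z : E}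
    (hz : ∀ s i j, ∃ k : ℤ, ⟪ω s i - ω s j, z⟫ = (k : ℝ)) :
    ∃ k : Fin 2 → Fin 5 → ℤ, z = ∑ s, ∑ i, k s i • ω s i ∧ ∀ s, |∑ i, k s i| ≤ 2 := by
  choose m hm using fun s i => hz s i 0
  -- Since a block sums to zero, its coefficients may be shifted together. This moves the
  -- coefficient sum by multiples of five; the shift chosen makes it the centred residue.
  refine ⟨fun s i => m s i - (∑ i, m s i + 2) / 5, ?_, fun s => ?_⟩
  · conv_lhs => rw [← h.sum_inner_smul hE z]
    refine Finset.sum_congr rfl fun s _ => ?_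
    have h1 : ∀ i, ⟪ω s i, z⟫ • ω s i = (m s i - (∑ i, m s i + 2) / 5) • ω s i +
        (⟪ω s 0, z⟫ + ((∑ i, m s i + 2) / 5 : ℤ)) • ω s i := by
      intro i
      have := hm s i
      rw [inner_sub_left] at this
      rw [← Int.cast_smul_eq_zsmul ℝ, ← add_smul]
      congr 1
      push_cast
      linarith
    simp only [h1, Finset.sum_add_distrib, ← Finset.smul_sum, h.sum_eq_zero]
    simp
  · rw [Finset.sum_sub_distrib, abs_le]
    simp only [Finset.sum_const, Finset.card_univ, Fintype.card_fin, nsmul_eq_mul,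
      Nat.cast_ofNat]
    constructor <;> omega

/-- Modulo five the coefficient sums `a`, `b` of the blocks satisfy `a² + b² = 1`, so one is `0` and
the other `±1`. A combination with coefficient sum zero in each block is a combination of roots. -/
theorem exists_sub_mem (hE : finrank ℝ E = 8) {A : Submodule ℤ E}
    (hA : ∀ s i j, ω s i - ω s j ∈ A) {z : E}
    (hz : ∀ s i j, ∃ k : ℤ, ⟪ω s i - ω s j, z⟫ = (k : ℝ))
    (hzz : ∃ N : ℤ, ⟪z, z⟫ = 4 / 5 + 2 * (N : ℝ)) :
    ∃ s, ∃ ε : ℤ, (ε = 1 ∨ ε = -1) ∧ ∀ i, z - ε • ω s i ∈ A := by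
  obtain ⟨k, rfl, hk⟩ := h.exists_int_coords hE hz
  obtain ⟨N, hN⟩ := hzz
  have h5 := h.inner_sum_smul_self k
  rw [hN, Fin.sum_univ_two] at h5
  have h6 : (4 + 10 * N : ℤ) = 5 * ∑ i, k 0 i ^ 2 - (∑ i, k 0 i) ^ 2 +
      (5 * ∑ i, k 1 i ^ 2 - (∑ i, k 1 i) ^ 2) := by
    have : ((4 + 10 * N : ℤ) : ℝ) = 5 * (4 / 5 + 2 * (N : ℝ)) := by push_cast; ring
    rw [h5] at this
    exact_mod_cast this
  have hcase : ∃ s t : Fin 2, s ≠ t ∧ ∑ i, k t i = 0 ∧ (∑ i, k s i = 1 ∨ ∑ i, k s i = -1) := by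
    have h0 := abs_le.1 (hk 0)
    have h1 := abs_le.1 (hk 1)
    generalize ∑ i, k 0 i ^ 2 = p at h6
    generalize ∑ i, k 1 i ^ 2 = q at h6
    have : (∑ i, k 1 i = 0 ∧ (∑ i, k 0 i = 1 ∨ ∑ i, k 0 i = -1)) ∨
        (∑ i, k 0 i = 0 ∧ (∑ i, k 1 i = 1 ∨ ∑ i, k 1 i = -1)) := by
      generalize ∑ i, k 0 i = a at h0 h6 ⊢
      generalize ∑ i, k 1 i = b at h1 h6 ⊢
      obtain ⟨ha, ha'⟩ := h0
      obtain ⟨hb, hb'⟩ := h1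
      interval_cases a <;> interval_cases b <;> omega
    rcases this with h' | h'
    · exact ⟨0, 1, by decide, h'.1, h'.2⟩
    · exact ⟨1, 0, by decide, h'.1, h'.2⟩
  obtain ⟨s, t, hst, ht, hs⟩ := hcase
  refine ⟨s, ∑ i, k s i, hs, fun i => ?_⟩
  have hsum : ∑ s, ∑ i, k s i • ω s i = ∑ i, k s i • ω s i + ∑ i, k t i • ω t i := by
    have : s = 0 ∧ t = 1 ∨ s = 1 ∧ t = 0 := by omega
    rw [Fin.sum_univ_two]
    rcases this with ⟨rfl, rfl⟩ | ⟨rfl, rfl⟩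
    · rfl
    · exact add_comm _ _
  have h7 : ∑ j, k s j • ω s j - (∑ j, k s j) • ω s i =
      ∑ j, (k s j - if j = i then ∑ j, k s j else 0) • ω s j := by
    simp [sub_smul, Finset.sum_sub_distrib, ite_smul]
  rw [hsum, add_sub_right_comm, h7]
  exact A.add_mem (sum_zsmul_mem_of_sub_mem (hA s) (by simp)) (sum_zsmul_mem_of_sub_mem (hA t) ht)

/-- The coefficient sums would satisfy `a² + b² = 3` modulo five, hence both be `±2`. The norm then
allows the squared coefficients a total of only two, while each block needs at least two. -/
theorem inner_self_ne (hE : finrank ℝ E = 8) {z : E}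
    (hz : ∀ s i j, ∃ k : ℤ, ⟪ω s i - ω s j, z⟫ = (k : ℝ)) : ⟪z, z⟫ ≠ 2 / 5 := by
  obtain ⟨k, rfl, hk⟩ := h.exists_int_coords hE hz
  intro hN
  have h5 := h.inner_sum_smul_self k
  rw [hN, Fin.sum_univ_two] at h5
  have h6 : (2 : ℤ) = 5 * ∑ i, k 0 i ^ 2 - (∑ i, k 0 i) ^ 2 +
      (5 * ∑ i, k 1 i ^ 2 - (∑ i, k 1 i) ^ 2) := by
    have : ((2 : ℤ) : ℝ) = 5 * (2 / 5) := by norm_num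
    rw [h5] at this
    exact_mod_cast this
  have hle : ∀ s, |∑ i, k s i| ≤ ∑ i, k s i ^ 2 := fun s =>
    (Finset.abs_sum_le_sum_abs _ _).trans (Finset.sum_le_sum fun i _ => by
      rw [← sq_abs]; exact Int.le_self_sq _)
  have h0 := abs_le.1 (hk 0)
  have h1 := abs_le.1 (hk 1)
  have h2 := abs_le.1 (hle 0)
  have h3 := abs_le.1 (hle 1)
  generalize ∑ i, k 0 i ^ 2 = p at h6 h2
  generalize ∑ i, k 1 i ^ 2 = q at h6 h3
  generalize ∑ i, k 0 i = a at h0 h6 h2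
  generalize ∑ i, k 1 i = b at h1 h6 h3
  obtain ⟨ha, ha'⟩ := h0
  obtain ⟨hb, hb'⟩ := h1
  interval_cases a <;> interval_cases b <;> omega

end IsA4Frame

end Frame


/-! ### Overlattices and short dual vectors from a hyperbolic discriminant form -/

section HyperbolicCoordinates

variable {E : Type*} [NormedAddCommGroup E] [InnerProductSpace ℝ E]

theorem hyperbolicForm_two_apply {F : Type*} [CommRing F] (v : Fin 2 ⊕ Fin 2 → F) :
    hyperbolicForm 2 F v = v (.inl 0) * v (.inr 0) + v (.inl 1) * v (.inr 1) := by
  simp [hyperbolicForm, Fin.sum_univ_two]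

theorem mem_dual_iff {L : Submodule ℤ E} (hL : Submodule.span ℝ (L : Set E) = ⊤) {x : E} :
    x ∈ dual L ↔ ∀ y ∈ L, ∃ k : ℤ, ⟪x, y⟫ = (k : ℝ) :=
  ⟨fun h => h.2, fun h => ⟨by rw [hL]; trivial, h⟩⟩

theorem IsEven.le_dual {L : Submodule ℤ E} (h : IsEven L) : L ≤ dual L :=
  fun x hx => ⟨Submodule.subset_span hx, h.1 x hx⟩

/-- Coordinates that identify the discriminant group of `R`, together with five halves of its
quadratic form, with the hyperbolic quadratic space of dimension four over the field with five
elements. -/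
structure HyperbolicCoord (R : Submodule ℤ E) where
  coord : dual R →ₗ[ℤ] (Fin 2 ⊕ Fin 2 → ZMod 5)
  surjective : Function.Surjective coord
  coord_eq_zero_iff : ∀ x : dual R, coord x = 0 ↔ (x : E) ∈ R
  inner_self : ∀ x : dual R, ∃ m : ℤ, ⟪(x : E), (x : E)⟫ = 2 * m / 5 ∧
    (m : ZMod 5) = hyperbolicForm 2 (ZMod 5) (coord x)

namespace HyperbolicCoord

variable {R : Submodule ℤ E} (C : HyperbolicCoord R)

theorem inner_eq (x y : dual R) : ∃ n : ℤ, ⟪(x : E), (y : E)⟫ = n / 5 ∧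
    (n : ZMod 5) = C.coord x (.inl 0) * C.coord y (.inr 0) +
      C.coord x (.inr 0) * C.coord y (.inl 0) + C.coord x (.inl 1) * C.coord y (.inr 1) +
      C.coord x (.inr 1) * C.coord y (.inl 1) := by
  obtain ⟨m, hm, hm'⟩ := C.inner_self x
  obtain ⟨n, hn, hn'⟩ := C.inner_self y
  obtain ⟨p, hp, hp'⟩ := C.inner_self (x + y)
  refine ⟨p - m - n, ?_, ?_⟩
  · rw [Submodule.coe_add, inner_add_left, inner_add_right, inner_add_right, hm, hn,
      real_inner_comm] at hp
    push_cast
    rw [real_inner_comm]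
    linarith
  · push_cast
    rw [hm', hn', hp', map_add]
    simp only [hyperbolicForm_two_apply, Pi.add_apply]
    ring

/-- The inner product is integral if and only if the polar form vanishes. -/
theorem exists_inner_eq_int_iff (x y : dual R) : (∃ k : ℤ, ⟪(x : E), (y : E)⟫ = k) ↔
    C.coord x (.inl 0) * C.coord y (.inr 0) +
      C.coord x (.inr 0) * C.coord y (.inl 0) + C.coord x (.inl 1) * C.coord y (.inr 1) +
      C.coord x (.inr 1) * C.coord y (.inl 1) = 0 := by
  obtain ⟨n, hn, hn'⟩ := C.inner_eq x y
  rw [← hn', hn]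
  constructor
  · rintro ⟨k, hk⟩
    have : n = 5 * k := by exact_mod_cast (by linarith : (n : ℝ) = 5 * k)
    rw [this]; push_cast
    rw [show (5 : ZMod 5) = 0 from rfl, zero_mul]
  · intro h
    obtain ⟨k, rfl⟩ := (ZMod.intCast_zmod_eq_zero_iff_dvd _ 5).1 h
    exact ⟨k, by push_cast; ring⟩

theorem coord_eq_iff (x y : dual R) : C.coord x = C.coord y ↔ (x : E) - y ∈ R := by
  rw [← sub_eq_zero, ← map_sub, C.coord_eq_zero_iff]; rfl

/-- The self-dual lattice that corresponds to a maximal totally singular subspace. -/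
def unimodular : Submodule ℤ E where
  carrier := {x | ∃ h : x ∈ dual R, ∀ i, C.coord ⟨x, h⟩ (.inr i) = 0}
  zero_mem' := ⟨Submodule.zero_mem _, fun i => by
    have := map_zero C.coord
    exact congrFun this _⟩
  add_mem' := by
    rintro x y ⟨hx, hx'⟩ ⟨hy, hy'⟩
    refine ⟨Submodule.add_mem _ hx hy, fun i => ?_⟩
    have := map_add C.coord ⟨x, hx⟩ ⟨y, hy⟩
    refine (congrFun this _).trans ?_
    rw [Pi.add_apply, hx', hy', add_zero]
  smul_mem' := by
    rintro c x ⟨hx, hx'⟩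
    refine ⟨Submodule.smul_mem _ c hx, fun i => ?_⟩
    have := map_smul C.coord c ⟨x, hx⟩
    refine (congrFun this _).trans ?_
    rw [Pi.smul_apply, hx', smul_zero]

theorem le_unimodular (heven : IsEven R) : R ≤ C.unimodular := by
  intro x hx
  refine ⟨heven.le_dual hx, fun i => ?_⟩
  rw [(C.coord_eq_zero_iff ⟨x, _⟩).2 hx]; rfl

theorem unimodular_le_dual : C.unimodular ≤ dual R := fun _ hx => hx.1

theorem unimodular_isEven : IsEven C.unimodular := by
  constructor
  · rintro x ⟨hx, hx'⟩ y ⟨hy, hy'⟩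
    exact (C.exists_inner_eq_int_iff ⟨x, hx⟩ ⟨y, hy⟩).2 (by simp [hx', hy'])
  · rintro x ⟨hx, hx'⟩
    obtain ⟨m, hm, hm'⟩ := C.inner_self ⟨x, hx⟩
    rw [hyperbolicForm_two_apply, hx', hx', mul_zero, mul_zero, add_zero] at hm'
    obtain ⟨k, rfl⟩ := (ZMod.intCast_zmod_eq_zero_iff_dvd _ 5).1 hm'
    exact ⟨k, by rw [hm]; push_cast; ring⟩

/-- The totally singular subspace is its own orthogonal complement: pairing with a lift of the basis
vector at `inl i` reads off the coordinate at `inr i`. -/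
theorem unimodular_isSelfDual (heven : IsEven R) (hR : Submodule.span ℝ (R : Set E) = ⊤) :
    IsSelfDual C.unimodular := by
  intro x
  refine ⟨fun hx y hy => C.unimodular_isEven.1 x hx y hy, fun h => ?_⟩
  have hx : x ∈ dual R := (mem_dual_iff hR).2 fun y hy => h y (C.le_unimodular heven hy)
  refine ⟨hx, fun i => ?_⟩
  obtain ⟨z, hz⟩ := C.surjective (Pi.single (.inl i) 1)
  have hzU : (z : E) ∈ C.unimodular := ⟨z.2, fun j => by
    have : (⟨(z : E), z.2⟩ : dual R) = z := rfl
    rw [this, hz]; simp⟩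
  have := (C.exists_inner_eq_int_iff ⟨x, hx⟩ z).1 (h z hzU)
  rw [hz] at this
  fin_cases i <;> simpa using this

theorem exists_coord_inr_ne (y : dual R) (hy : ¬ ∃ N : ℤ, ⟪(y : E), (y : E)⟫ = 2 * (N : ℝ)) :
    ∃ i, C.coord y (.inr i) ≠ 0 := by
  by_contra! h
  exact hy (C.unimodular_isEven.2 y ⟨y.2, h⟩)

theorem form_coord_eq_two {x : dual R} (hx : ⟪(x : E), (x : E)⟫ = 4 / 5) :
    hyperbolicForm 2 (ZMod 5) (C.coord x) = 2 := by
  obtain ⟨m, hm, hm'⟩ := C.inner_self x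
  rw [hx] at hm
  have : m = 2 := by exact_mod_cast (by linarith : (m : ℝ) = 2)
  rw [← hm', this]; rfl

include C

theorem five_smul_mem (x : dual R) : (5 : ℤ) • (x : E) ∈ R := by
  have h1 : C.coord ((5 : ℤ) • x) = 0 := by
    rw [map_smul]
    ext i
    rw [Pi.smul_apply, zsmul_eq_mul, Int.cast_ofNat, show ((5 : ZMod 5)) = 0 from rfl, zero_mul]
    rfl
  have := (C.coord_eq_zero_iff _).1 h1
  simpa using this

variable [FiniteDimensional ℝ E] [DiscreteTopology R] [IsZLattice ℝ R]

theorem exists_isE8_unimodular (hE : finrank ℝ E = 8) (heven : IsEven R) :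
    ∃ e, IsE8 C.unimodular e := by
  have hR : Submodule.span ℝ (R : Set E) = ⊤ := IsZLattice.span_top
  have h := C.unimodular_isSelfDual heven hR
  have : DiscreteTopology C.unimodular :=
    discreteTopology_of_integral fun x hx => (h x).1 hx x hx
  have : IsZLattice ℝ C.unimodular := ⟨by
    rw [eq_top_iff, ← hR]
    exact Submodule.span_mono (C.le_unimodular heven)⟩
  exact exists_isE8 h C.unimodular_isEven hE

/-- The frame of type `A₄ + A₄` attached to a vector of the dual lattice. -/
theorem exists_frame (hE : finrank ℝ E = 8) (heven : IsEven R) (hroot : IsRootless R)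
    (y : dual R) {i : Fin 2} (hi : C.coord y (.inr i) ≠ 0) :
    ∃ ω : Fin 2 → Fin 5 → E, IsA4Frame ω ∧ (∀ s i, ω s i ∈ dual R) ∧ ∃ A : Submodule ℤ E,
      ∃ y' : dual R, (∀ s i j, ω s i - ω s j ∈ A) ∧ A ≤ dual R ∧
      (∀ s i j, ∃ k : ℤ, ⟪ω s i - ω s j, (y : E)⟫ = k) ∧
      (∀ z ∈ A, z ∈ R ↔ ∃ k : ℤ, ⟪z, (y' : E)⟫ = k) := by
  classical
  have h5 : Fact (Nat.Prime 5) := ⟨by norm_num⟩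
  obtain ⟨e, he⟩ := C.exists_isE8_unimodular hE heven
  -- `y` and `y'` are independent modulo the singular subspace, so integrality against both cuts `R`
  -- out of `U`. The lattice `A` lies between: integrality against `y` alone. Rootlessness of `R`
  -- thus says that no root of `U` is integral on both vectors.
  obtain ⟨y', hy'⟩ := C.surjective (Pi.single (.inr (1 - i)) 1)
  let A : Submodule ℤ E :=
    { carrier := {z | z ∈ C.unimodular ∧ ∃ k : ℤ, ⟪z, (y : E)⟫ = k}
      zero_mem' := ⟨Submodule.zero_mem _, 0, by simp⟩
      add_mem' := by
        rintro a b ⟨ha, k, hk⟩ ⟨hb, l, hl⟩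
        exact ⟨Submodule.add_mem _ ha hb, k + l, by rw [inner_add_left, hk, hl]; push_cast; rfl⟩
      smul_mem' := by
        rintro c a ⟨ha, k, hk⟩
        exact ⟨Submodule.smul_mem _ c ha, c * k, by
          rw [real_inner_zsmul_left, hk]; push_cast; rfl⟩ }
  have hA : ∀ z ∈ A, z ∈ R ↔ ∃ k : ℤ, ⟪z, (y' : E)⟫ = k := by
    rintro z ⟨⟨hz, hz0⟩, hzy⟩
    refine ⟨fun h => ?_, fun h => ?_⟩
    · obtain ⟨k, hk⟩ := y'.2.2 z h
      exact ⟨k, by rw [real_inner_comm, hk]⟩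
    · refine (C.coord_eq_zero_iff ⟨z, hz⟩).1 ?_
      have h1 := (C.exists_inner_eq_int_iff ⟨z, hz⟩ y).1 hzy
      have h2 := (C.exists_inner_eq_int_iff ⟨z, hz⟩ y').1 h
      rw [hy'] at h2
      simp only [hz0, zero_mul, add_zero] at h1 h2
      have h3 : ∀ j, C.coord ⟨z, hz⟩ (.inl j) = 0 := by
        have hi' : i = 0 ∨ i = 1 := by omega
        rcases hi' with rfl | rfl
        · have h4 : C.coord ⟨z, hz⟩ (.inl 1) = 0 := by simpa using h2
          rw [h4, zero_mul, add_zero] at h1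
          have h5 := (mul_eq_zero.1 h1).resolve_right hi
          intro j; fin_cases j
          exacts [h5, h4]
        · have h4 : C.coord ⟨z, hz⟩ (.inl 0) = 0 := by simpa using h2
          rw [h4, zero_mul, zero_add] at h1
          have h5 := (mul_eq_zero.1 h1).resolve_right hi
          intro j; fin_cases j
          exacts [h4, h5]
      ext (j | j)
      · exact h3 j
      · exact hz0 j
  obtain ⟨ω, hω, hωU, hωA⟩ := he.exists_A4Frame C.unimodular_isEven.1 (y := y) (y' := y')
    (C.le_unimodular heven (C.five_smul_mem y)) (C.le_unimodular heven (C.five_smul_mem y'))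
    (fun r hr hr2 hry hry' => hroot r ((hA r ⟨hr, hry⟩).2 hry') hr2)
  refine ⟨ω, hω, fun s i => ?_, A, y', hωA, fun z hz => C.unimodular_le_dual hz.1,
    fun s i j => (hωA s i j).2, hA⟩
  obtain ⟨u, hu, c, hc⟩ := hωU s i
  rw [hc]
  exact Submodule.add_mem _ (C.unimodular_le_dual hu) (Submodule.smul_mem _ _ y.2)

/-- The classes with norm `4 / 5` modulo `2` are represented by vectors of norm `4 / 5`. -/
theorem exists_short_representative (hE : finrank ℝ E = 8) (heven : IsEven R)
    (hroot : IsRootless R) (y : dual R) (hy : ∃ N : ℤ, ⟪(y : E), (y : E)⟫ = 4 / 5 + 2 * (N : ℝ)) :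
    ∃ x ∈ dual R, ⟪x, x⟫ = 4 / 5 ∧ (y : E) - x ∈ R := by
  obtain ⟨i, hi⟩ := C.exists_coord_inr_ne y (by
    rintro ⟨M, hM⟩
    obtain ⟨N, hN⟩ := hy
    rw [hM] at hN
    have : (10 * M : ℤ) = 4 + 10 * N := by
      exact_mod_cast (by linarith : (10 * M : ℝ) = 4 + 10 * N)
    omega)
  obtain ⟨ω, hω, hωR, A, y', hωA, hAR, hωy, hA⟩ := C.exists_frame hE heven hroot y hi
  obtain ⟨s, ε, hε, hmem⟩ := hω.exists_sub_mem hE hωA hωy hy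
  have hεε : (ε : ℝ) * ε = 1 := by rcases hε with rfl | rfl <;> norm_num
  -- The five vectors lie in `A` and differ by roots, which are not in `R`. So their products with
  -- `y'`, which are fifths of integers, are distinct modulo one, and exactly one of them is
  -- integral.
  have hex : ∃ j, (y : E) - ε • ω s j ∈ R := by
    choose n hn using fun j => C.inner_eq ⟨_, hAR (hmem j)⟩ y'
    have hinj : Function.Injective fun j => (n j : ZMod 5) := by
      intro j k hjk
      by_contra hne
      obtain ⟨q, hq⟩ := (ZMod.intCast_zmod_eq_zero_iff_dvd (n j - n k) 5).1 (by
        push_cast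
        exact sub_eq_zero.2 hjk)
      push_cast at hq
      refine hroot (ω s j - ω s k) ((hA _ (hωA s j k)).2 ⟨-(ε * q), ?_⟩)
        (hω.inner_sub_sub hne)
      have h1 : ω s j - ω s k = -(ε • (((y : E) - ε • ω s j) - ((y : E) - ε • ω s k))) := by
        simp only [← Int.cast_smul_eq_zsmul ℝ]
        rw [sub_sub_sub_cancel_left, smul_sub, smul_smul, smul_smul, hεε]
        module
      have h2 := (hn j).1
      have h3 := (hn k).1
      simp only at h2 h3
      rw [h1, inner_neg_left, real_inner_zsmul_left, inner_sub_left, h2, h3, ← sub_div,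
        ← Int.cast_sub, hq]
      push_cast; ring
    obtain ⟨j, hj⟩ := ((Fintype.bijective_iff_injective_and_card _).2
      ⟨hinj, by simp [ZMod.card]⟩).2 0
    refine ⟨j, (hA _ (hmem j)).2 ?_⟩
    obtain ⟨q, hq⟩ := (ZMod.intCast_zmod_eq_zero_iff_dvd _ 5).1 hj
    exact ⟨q, by rw [(hn j).1, hq]; push_cast; ring⟩
  obtain ⟨j, hj⟩ := hex
  refine ⟨ε • ω s j, Submodule.smul_mem _ _ (hωR s j), ?_, hj⟩
  rw [real_inner_zsmul_left, real_inner_zsmul_right, hω.inner_same, if_pos rfl, ← mul_assoc, hεε]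
  norm_num

/-- The vector pairs integrally with the roots of the frame built from itself, so it is a weight of
`A₄ + A₄`, and no weight has this norm. -/
theorem inner_self_ne_two_fifths (hE : finrank ℝ E = 8) (heven : IsEven R)
    (hroot : IsRootless R) {y : E} (hy : y ∈ dual R) : ⟪y, y⟫ ≠ 2 / 5 := by
  intro h
  obtain ⟨i, hi⟩ := C.exists_coord_inr_ne ⟨y, hy⟩ (by
    rintro ⟨M, hM⟩
    rw [h] at hM
    have : (10 * M : ℤ) = 2 := by
      exact_mod_cast (by linarith : (10 * M : ℝ) = 2)
    omega)
  obtain ⟨ω, hω, hωR, A, y', hωA, hAR, hωy, hA⟩ := C.exists_frame hE heven hroot ⟨y, hy⟩ hi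
  exact hω.inner_self_ne hE hωy h

theorem exists_short_of_form_eq_two (hE : finrank ℝ E = 8) (heven : IsEven R)
    (hroot : IsRootless R) {v : Fin 2 ⊕ Fin 2 → ZMod 5} (hv : hyperbolicForm 2 (ZMod 5) v = 2) :
    ∃ x : dual R, ⟪(x : E), (x : E)⟫ = 4 / 5 ∧ C.coord x = v := by
  obtain ⟨y, hy⟩ := C.surjective v
  obtain ⟨m, hm, hm'⟩ := C.inner_self y
  rw [hy, hv] at hm'
  obtain ⟨q, hq⟩ := (ZMod.intCast_zmod_eq_zero_iff_dvd (m - 2) 5).1 (by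
    push_cast
    exact sub_eq_zero.2 hm')
  push_cast at hq
  obtain ⟨x, hx, hxx, hyx⟩ := C.exists_short_representative hE heven hroot y ⟨q, by
    have : (m : ℝ) = 2 + 5 * q := by exact_mod_cast (by linarith : m = 2 + 5 * q)
    rw [hm, this]; ring⟩
  refine ⟨⟨x, hx⟩, hxx, ?_⟩
  rw [← hy]
  exact ((C.coord_eq_iff y ⟨x, hx⟩).2 hyx).symm

/-- The dual lattice is generated by its vectors of norm `4 / 5`. -/
theorem dual_le_span (hE : finrank ℝ E = 8) (heven : IsEven R) (hroot : IsRootless R) :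
    dual R ≤ Submodule.span ℤ {x | x ∈ dual R ∧ ⟪x, x⟫ = 4 / 5} := by
  set S := Submodule.span ℤ {x | x ∈ dual R ∧ ⟪x, x⟫ = 4 / 5}
  -- Frame vectors are dual vectors of norm `4/5`, so vectors of `R` pair integrally with their
  -- differences and are integral combinations of them.
  have hRS : R ≤ S := by
    intro z hz
    obtain ⟨y, hy⟩ := C.surjective (Pi.single (.inr 0) 1)
    obtain ⟨ω, hω, hωR, -⟩ := C.exists_frame hE heven hroot y (i := 0) (by
      rw [hy, Pi.single_eq_same]; decide)
    obtain ⟨k, hk, -⟩ := hω.exists_int_coords hE (z := z) fun s i j =>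
      (Submodule.sub_mem _ (hωR s i) (hωR s j)).2 z hz
    rw [hk]
    refine Submodule.sum_mem _ fun s _ => Submodule.sum_mem _ fun i _ => Submodule.smul_mem _ _
      (Submodule.subset_span ⟨hωR s i, ?_⟩)
    rw [hω.inner_same, if_pos rfl]; norm_num
  have hclass : ∀ v, hyperbolicForm 2 (ZMod 5) v = 2 → ∃ x ∈ S, ∃ hx : x ∈ dual R,
      C.coord ⟨x, hx⟩ = v := by
    intro v hv
    obtain ⟨x, hx, hxv⟩ := C.exists_short_of_form_eq_two hE heven hroot hv
    exact ⟨x, Submodule.subset_span ⟨x.2, hx⟩, x.2, hxv⟩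
  intro y hy
  -- In each hyperbolic plane `(1, 2)` and `(2, 1)` have form value `2` and form a basis; `α` and
  -- `β` are lifts of the coordinates in it.
  have hpq : ∀ i : Fin 2, ∃ p ∈ S, ∃ hp : p ∈ dual R, ∃ q ∈ S, ∃ hq : q ∈ dual R,
      C.coord ⟨p, hp⟩ = Pi.single (.inl i) 1 + Pi.single (.inr i) 2 ∧
      C.coord ⟨q, hq⟩ = Pi.single (.inl i) 2 + Pi.single (.inr i) 1 := by
    intro i
    have hQ : ∀ i : Fin 2,
        hyperbolicForm 2 (ZMod 5) (Pi.single (.inl i) 1 + Pi.single (.inr i) 2) = 2 ∧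
        hyperbolicForm 2 (ZMod 5) (Pi.single (.inl i) 2 + Pi.single (.inr i) 1) = 2 := by decide
    obtain ⟨p, hpS, hp, hp'⟩ := hclass _ (hQ i).1
    obtain ⟨q, hqS, hq, hq'⟩ := hclass _ (hQ i).2
    exact ⟨p, hpS, hp, q, hqS, hq, hp', hq'⟩
  choose p hpS hp q hqS hq hcp hcq using hpq
  set v := C.coord ⟨y, hy⟩ with hv
  obtain ⟨α, hα⟩ : ∃ α : Fin 2 → ℤ, ∀ i, (α i : ZMod 5) = 3 * v (.inl i) + 4 * v (.inr i) :=
    ⟨fun i => (3 * v (.inl i) + 4 * v (.inr i)).val, fun i => by simp⟩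
  obtain ⟨β, hβ⟩ : ∃ β : Fin 2 → ℤ, ∀ i, (β i : ZMod 5) = 4 * v (.inl i) + 3 * v (.inr i) :=
    ⟨fun i => (4 * v (.inl i) + 3 * v (.inr i)).val, fun i => by simp⟩
  have hxR : ∑ i, (α i • p i + β i • q i) ∈ dual R := Submodule.sum_mem _ fun i _ =>
    Submodule.add_mem _ (Submodule.smul_mem _ _ (hp i)) (Submodule.smul_mem _ _ (hq i))
  have hxS : ∑ i, (α i • p i + β i • q i) ∈ S := Submodule.sum_mem _ fun i _ =>
    Submodule.add_mem _ (Submodule.smul_mem _ _ (hpS i)) (Submodule.smul_mem _ _ (hqS i))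
  have hcx : C.coord ⟨_, hxR⟩ = v := by
    have h1 : (⟨_, hxR⟩ : dual R) = ∑ i, (α i • ⟨p i, hp i⟩ + β i • ⟨q i, hq i⟩) := by
      ext; simp
    rw [h1, map_sum]
    simp only [map_add, map_smul, hcp, hcq, Fin.sum_univ_two]
    have h5 : (5 : ZMod 5) = 0 := rfl
    ext (j | j) <;> fin_cases j <;> simp [hα, hβ] <;> ring_nf <;> reduce_mod_char
  have := (C.coord_eq_iff ⟨y, hy⟩ ⟨_, hxR⟩).1 (hv.symm.trans hcx.symm)
  have h2 := S.add_mem (hRS this) hxS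
  rwa [sub_add_cancel] at h2

end HyperbolicCoord

end HyperbolicCoordinates


/-! ### Lifting isometries of discriminant forms -/

section Lifting

variable {E : Type*} [NormedAddCommGroup E] [InnerProductSpace ℝ E]
variable {E' : Type*} [NormedAddCommGroup E'] [InnerProductSpace ℝ E']

namespace HyperbolicCoord

variable {R : Submodule ℤ E} (C : HyperbolicCoord R)

theorem inner_eq_form (x y : dual R) : ∃ n : ℤ, ⟪(x : E), (y : E)⟫ = n / 5 ∧
    (n : ZMod 5) = hyperbolicForm 2 (ZMod 5) (C.coord x + C.coord y) -
      hyperbolicForm 2 (ZMod 5) (C.coord x) - hyperbolicForm 2 (ZMod 5) (C.coord y) := by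
  obtain ⟨n, hn, hn'⟩ := C.inner_eq x y
  refine ⟨n, hn, ?_⟩
  rw [hn']
  simp only [hyperbolicForm_two_apply, Pi.add_apply]
  ring

/-- A class contains at most one vector of norm `4 / 5`. -/
theorem short_unique (heven : IsEven R) (hroot : IsRootless R) {x y : dual R}
    (hx : ⟪(x : E), (x : E)⟫ = 4 / 5) (hy : ⟪(y : E), (y : E)⟫ = 4 / 5)
    (h : C.coord x = C.coord y) : x = y := by
  have hR := (C.coord_eq_iff x y).1 h
  obtain ⟨k, hk⟩ := heven.2 _ hR
  have hne := hroot _ hR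
  -- By the parallelogram law the difference has norm at most `16/5`; this norm is even and not `2`,
  -- so it is zero.
  have h1 : (0 : ℝ) ≤ ⟪(x : E) + y, (x : E) + y⟫ := real_inner_self_nonneg
  have h2 : (0 : ℝ) ≤ ⟪(x : E) - y, (x : E) - y⟫ := real_inner_self_nonneg
  have h3 : ⟪(x : E) + y, (x : E) + y⟫ = 16 / 5 - ⟪(x : E) - y, (x : E) - y⟫ := by
    simp only [inner_add_left, inner_add_right, inner_sub_left, inner_sub_right, hx, hy]
    ring
  rw [h3, hk] at h1
  rw [hk] at h2 hne
  have h4 : k < 2 := by exact_mod_cast (by linarith : (k : ℝ) < 2)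
  have h5 : 0 ≤ k := by exact_mod_cast (by linarith : (0 : ℝ) ≤ k)
  have h6 : k ≠ 1 := by rintro rfl; norm_num at hne
  have h7 : k = 0 := by omega
  rw [h7, Int.cast_zero, mul_zero, inner_self_eq_zero, sub_eq_zero] at hk
  exact Subtype.ext hk

variable [FiniteDimensional ℝ E] [DiscreteTopology R] [IsZLattice ℝ R]

include C in
/-- The possible inner products of two vectors of norm `4 / 5`. -/
theorem inner_short (hE : finrank ℝ E = 8) (heven : IsEven R) (hroot : IsRootless R)
    {x y : dual R} (hx : ⟪(x : E), (x : E)⟫ = 4 / 5) (hy : ⟪(y : E), (y : E)⟫ = 4 / 5)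
    (hxy : x ≠ y) (hxy' : x ≠ -y) {n : ℤ} (hn : ⟪(x : E), (y : E)⟫ = n / 5) : |n| ≤ 2 := by
  -- The difference has norm `(8 - 2 n) / 5`: positivity excludes `n ≥ 4`, and the absence of norm
  -- `2/5` excludes `n = 3`.
  have key : ∀ z : dual R, ⟪(z : E), (z : E)⟫ = 4 / 5 → x ≠ z → ∀ n : ℤ,
      ⟪(x : E), (z : E)⟫ = n / 5 → n ≤ 2 := by
    intro z hz hxz n hn
    have h1 : ⟪(x : E) - z, (x : E) - z⟫ = (8 - 2 * n) / 5 := by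
      have h0 : ⟪(z : E), (x : E)⟫ = n / 5 := by rw [real_inner_comm, hn]
      simp only [inner_sub_left, inner_sub_right, hx, hz, hn, h0]
      ring
    have h2 : (0 : ℝ) < ⟪(x : E) - z, (x : E) - z⟫ :=
      real_inner_self_pos.2 (sub_ne_zero.2 fun h => hxz (Subtype.ext h))
    have h3 := C.inner_self_ne_two_fifths hE heven hroot (x - z).2
    rw [Submodule.coe_sub, h1] at h3
    rw [h1] at h2
    have h4 : n < 4 := by exact_mod_cast (by linarith : (n : ℝ) < 4)
    have h5 : n ≠ 3 := by rintro rfl; norm_num at h3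
    omega
  rw [abs_le]
  have h1 := key y hy hxy n hn
  have h2 := key (-y) (by simpa using hy) hxy' (-n) (by
    rw [Submodule.coe_neg, inner_neg_right, hn]; push_cast; ring)
  constructor <;> omega

variable [FiniteDimensional ℝ E'] {R' : Submodule ℤ E'} [DiscreteTopology R'] [IsZLattice ℝ R']
  (C' : HyperbolicCoord R')

/-- Every isometry between the discriminant forms is induced by an isometry of the lattices. -/
theorem exists_isometry (hE : finrank ℝ E = 8) (heven : IsEven R) (hroot : IsRootless R)
    (hE' : finrank ℝ E' = 8) (heven' : IsEven R') (hroot' : IsRootless R') (γ : OPlus 2 (ZMod 5)) :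
    ∃ φ : E ≃ₗᵢ[ℝ] E', (∀ x, φ x ∈ R' ↔ x ∈ R) ∧
      ∀ x : dual R, ∃ h : φ x ∈ dual R', C'.coord ⟨φ x, h⟩ = γ.1 (C.coord x) := by
  classical
  let X := {x : dual R // ⟪(x : E), (x : E)⟫ = 4 / 5}
  have hf : ∀ x : X, ∃ x' : dual R', ⟪(x' : E'), (x' : E')⟫ = 4 / 5 ∧
      C'.coord x' = γ.1 (C.coord x.1) := fun x =>
    C'.exists_short_of_form_eq_two hE' heven' hroot' (by
      rw [γ.2, C.form_coord_eq_two x.2])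
  choose f hf hfc using hf
  -- Away from equal and opposite pairs, five times the product is an integer in `[-2, 2]`,
  -- determined by its residue modulo five, which `γ` preserves.
  have hinner : ∀ x y : X, ⟪(f x : E'), (f y : E')⟫ = ⟪(x.1 : E), (y.1 : E)⟫ := by
    intro x y
    by_cases hxy : x.1 = y.1
    · have : x = y := Subtype.ext hxy
      subst this
      rw [hf, x.2]
    by_cases hxy' : x.1 = -y.1
    · have : f x = -f y := C'.short_unique heven' hroot' (hf x) (by simpa using hf y) (by
        rw [map_neg, hfc, hfc, hxy', map_neg, map_neg])
      rw [this, hxy', Submodule.coe_neg, Submodule.coe_neg, inner_neg_left, inner_neg_left, hf, y.2]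
    obtain ⟨n, hn, hn'⟩ := C.inner_eq_form x.1 y.1
    obtain ⟨m, hm, hm'⟩ := C'.inner_eq_form (f x) (f y)
    have h1 := abs_le.1 (C.inner_short hE heven hroot x.2 y.2 hxy hxy' hn)
    have h2 := abs_le.1 (C'.inner_short hE' heven' hroot' (hf x) (hf y) (fun h => hxy (by
        refine C.short_unique heven hroot x.2 y.2 (γ.1.injective ?_)
        rw [← hfc, ← hfc, h])) (fun h => hxy' (by
        refine C.short_unique heven hroot x.2 (by simpa using y.2) (γ.1.injective ?_)
        rw [map_neg, map_neg, ← hfc, ← hfc, h, map_neg])) hm)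
    rw [hfc, hfc, ← map_add, γ.2, γ.2, γ.2, ← hn', ← sub_eq_zero, ← Int.cast_sub] at hm'
    have h3 := (ZMod.intCast_zmod_eq_zero_iff_dvd _ 5).1 hm'
    push_cast at h3
    have : m = n := by omega
    rw [hm, hn, this]
  have hspan : Submodule.span ℝ (Set.range fun x : X => (x.1 : E)) = ⊤ := by
    rw [eq_top_iff, ← IsZLattice.span_top (K := ℝ) (L := R), Submodule.span_le]
    intro z hz
    have h1 := C.dual_le_span hE heven hroot (heven.le_dual hz)
    have h2 : Submodule.span ℤ {x | x ∈ dual R ∧ ⟪x, x⟫ = 4 / 5} ≤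
        (Submodule.span ℝ (Set.range fun x : X => (x.1 : E))).restrictScalars ℤ :=
      Submodule.span_le.2 fun x hx => Submodule.subset_span ⟨⟨⟨x, hx.1⟩, hx.2⟩, rfl⟩
    exact h2 h1
  obtain ⟨b, hbX, hbs, hbl⟩ := exists_linearIndependent ℝ (Set.range fun x : X => (x.1 : E))
  have hb : ∀ i : b, ∃ x : X, (x.1 : E) = i := fun i => hbX i.2
  choose x hx using hb
  let B : Basis b ℝ E := Basis.mk hbl (by rw [Subtype.range_coe, hbs, hspan])
  have hB : ∀ i, B i = ((x i).1 : E) := fun i => by rw [hx]; exact Basis.mk_apply _ _ i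
  let T : E →ₗ[ℝ] E' := B.constr ℝ fun i => (f (x i) : E')
  have hTB : ∀ i, T (B i) = f (x i) := fun i => B.constr_basis ℝ _ i
  have hTT : ∀ y z, ⟪T y, T z⟫ = ⟪y, z⟫ := by
    have : (innerₗ E').compl₁₂ T T = innerₗ E := by
      refine LinearMap.ext_basis B B fun i j => ?_
      simp only [LinearMap.compl₁₂_apply, innerₗ_apply_apply, hTB]
      rw [hinner, hB, hB]
    intro y z
    exact LinearMap.congr_fun₂ this y z
  let φ : E ≃ₗᵢ[ℝ] E' := (T.isometryOfInner hTT).toLinearIsometryEquiv (by rw [hE, hE'])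
  have hφT : ∀ y, φ y = T y := fun y => rfl
  -- `T` was prescribed only on a basis of short vectors. For any other short vector, the difference
  -- of the two images is orthogonal to the images of that basis, hence zero.
  have hφX : ∀ y : X, φ y.1 = f y := by
    intro y
    rw [← sub_eq_zero, ← inner_self_eq_zero (𝕜 := ℝ)]
    have h0 : ∀ z, ⟪φ y.1 - f y, φ z⟫ = 0 := by
      have h1 : (innerₗ E' (φ y.1 - f y)) ∘ₗ T = 0 := by
        refine B.ext fun i => ?_
        simp only [LinearMap.comp_apply, innerₗ_apply_apply, LinearMap.zero_apply, inner_sub_left]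
        rw [hφT, hTT, hTB, hinner, hB, sub_self]
      intro z
      exact LinearMap.congr_fun h1 z
    have := h0 (φ.symm (φ y.1 - f y))
    rwa [φ.apply_symm_apply] at this
  have hdual : ∀ z : dual R, ∃ h : φ z ∈ dual R', C'.coord ⟨φ z, h⟩ = γ.1 (C.coord z) := by
    rintro ⟨z, hz⟩
    have h1 : ∃ h : z ∈ dual R, ∃ h' : φ z ∈ dual R', C'.coord ⟨φ z, h'⟩ = γ.1 (C.coord ⟨z, h⟩) := by
      have h2 := C.dual_le_span hE heven hroot hz
      clear hz
      induction h2 using Submodule.span_induction with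
      | mem z hz =>
        refine ⟨hz.1, ?_⟩
        have h3 := hφX ⟨⟨z, hz.1⟩, hz.2⟩
        simp only at h3
        have h4 := hfc ⟨⟨z, hz.1⟩, hz.2⟩
        refine ⟨by rw [h3]; exact (f _).2, ?_⟩
        rw [← h4]
        congr 1
        exact Subtype.ext h3
      | zero =>
        refine ⟨Submodule.zero_mem _, by rw [map_zero]; exact Submodule.zero_mem _, ?_⟩
        have h3 : (⟨0, Submodule.zero_mem _⟩ : dual R) = 0 := rfl
        rw [h3, map_zero C.coord, map_zero γ.1]
        refine (C'.coord_eq_zero_iff _).2 ?_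
        change φ 0 ∈ R'
        rw [map_zero]
        exact Submodule.zero_mem _
      | add y z _ _ hy hz =>
        obtain ⟨hy1, hy2, hy3⟩ := hy
        obtain ⟨hz1, hz2, hz3⟩ := hz
        refine ⟨Submodule.add_mem _ hy1 hz1, by rw [map_add]; exact Submodule.add_mem _ hy2 hz2, ?_⟩
        have h3 : (⟨y + z, Submodule.add_mem _ hy1 hz1⟩ : dual R) = ⟨y, hy1⟩ + ⟨z, hz1⟩ := rfl
        rw [h3, map_add C.coord, map_add γ.1, ← hy3, ← hz3, ← map_add C'.coord]
        congr 1
        exact Subtype.ext (map_add φ y z)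
      | smul c y _ hy =>
        obtain ⟨hy1, hy2, hy3⟩ := hy
        have h5 : φ (c • y) = c • φ y := map_zsmul φ c y
        refine ⟨Submodule.smul_mem _ c hy1, by rw [h5]; exact Submodule.smul_mem _ c hy2, ?_⟩
        have h3 : (⟨c • y, Submodule.smul_mem _ c hy1⟩ : dual R) = c • ⟨y, hy1⟩ := rfl
        rw [h3, map_smul C.coord, map_zsmul γ.1, ← hy3, ← map_smul C'.coord]
        congr 1
        exact Subtype.ext h5
    obtain ⟨_, h2⟩ := h1
    exact h2
  have hRR : ∀ z ∈ R, φ z ∈ R' := by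
    intro z hz
    obtain ⟨h1, h2⟩ := hdual ⟨z, heven.le_dual hz⟩
    refine (C'.coord_eq_zero_iff ⟨_, h1⟩).1 ?_
    rw [h2, (C.coord_eq_zero_iff ⟨z, _⟩).2 hz, map_zero]
  refine ⟨φ, fun z => ⟨fun hz => ?_, hRR z⟩, hdual⟩
  have hzd : z ∈ dual R := (mem_dual_iff IsZLattice.span_top).2 fun y hy => by
    obtain ⟨k, hk⟩ := heven'.1 _ hz _ (hRR y hy)
    exact ⟨k, by rw [← hk, φ.inner_map_map]⟩
  obtain ⟨h1, h2⟩ := hdual ⟨z, hzd⟩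
  rw [(C'.coord_eq_zero_iff ⟨_, h1⟩).2 hz, eq_comm, LinearEquiv.map_eq_zero_iff] at h2
  exact (C.coord_eq_zero_iff ⟨z, hzd⟩).1 h2

include C in
/-- An isometry that acts trivially on the discriminant group is the identity. -/
theorem eq_one_of_coord_eq (hE : finrank ℝ E = 8) (heven : IsEven R) (hroot : IsRootless R)
    (g : isometryGroup R) (hg : ∀ x : dual R, g.1 x - (x : E) ∈ R) : g = 1 := by
  refine Subtype.ext (LinearIsometryEquiv.ext fun z => ?_)
  have h1 : ∀ z ∈ Submodule.span ℤ {x | x ∈ dual R ∧ ⟪x, x⟫ = 4 / 5}, g.1 z = z := by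
    intro z hz
    induction hz using Submodule.span_induction with
    | mem z hz =>
      have hgz := isometryGroup_mem_dual g hz.1
      have := C.short_unique heven hroot (x := ⟨g.1 z, hgz⟩) (y := ⟨z, hz.1⟩)
        (by rw [g.1.inner_map_map]; exact hz.2) hz.2
        ((C.coord_eq_iff _ _).2 (hg ⟨z, hz.1⟩))
      exact congrArg Subtype.val this
    | zero => exact map_zero _
    | add y z _ _ hy hz => rw [map_add, hy, hz]
    | smul c y _ hy => rw [map_zsmul, hy]
  have h2 : z ∈ Submodule.span ℝ (R : Set E) := by rw [IsZLattice.span_top]; trivial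
  induction h2 using Submodule.span_induction with
  | mem z hz => exact h1 z (C.dual_le_span hE heven hroot (heven.le_dual hz))
  | zero => exact map_zero _
  | add y z _ _ hy hz => rw [map_add, hy, hz]; rfl
  | smul c y _ hy => rw [map_smul, hy]; rfl

end HyperbolicCoord

end Lifting


/-! ### Quadratic Gauss sums from the theta function at the cusp `1 / (2 a)` -/

section QuadraticGaussSum

open Filter Topology Complex

/-- By dominated convergence only the term `n = 0` survives as the imaginary part grows. -/
theorem tendsto_jacobiTheta₂_ofReal (x : ℝ) {l : Filter ℝ} {τ : ℝ → ℂ}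
    (hτ : Tendsto (fun t => (τ t).im) l atTop) :
    Tendsto (fun t => jacobiTheta₂ x (τ t)) l (𝓝 1) := by
  have h1 : (1 : ℂ) = ∑' n : ℤ, if n = 0 then 1 else 0 := by rw [tsum_ite_eq]
  rw [h1]
  refine tendsto_tsum_of_dominated_convergence
    (bound := fun n : ℤ => ‖jacobiTheta₂_term n (x : ℂ) I‖) ?_ (fun n => ?_) ?_
  · exact (hasSum_jacobiTheta₂_term (x : ℂ) (τ := I) (by simp)).summable.norm
  · split_ifs with h
    · subst h; simpa [jacobiTheta₂_term] using tendsto_const_nhds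
    · rw [tendsto_zero_iff_norm_tendsto_zero]
      simp only [norm_jacobiTheta₂_term, ofReal_im, mul_zero, sub_zero]
      refine Real.tendsto_exp_atBot.comp (hτ.const_mul_atTop_of_neg ?_)
      have : (0 : ℝ) < (n : ℝ) ^ 2 := by positivity
      nlinarith [Real.pi_pos]
  · filter_upwards [hτ.eventually_ge_atTop 1] with t ht n
    rw [norm_jacobiTheta₂_term, norm_jacobiTheta₂_term, Real.exp_le_exp]
    simp only [ofReal_im, mul_zero, sub_zero, I_im]
    have : (0 : ℝ) ≤ Real.pi * (n : ℝ) ^ 2 := by positivity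
    nlinarith

theorem tendsto_jacobiTheta {l : Filter ℝ} {τ : ℝ → ℂ}
    (hτ : Tendsto (fun t => (τ t).im) l atTop) :
    Tendsto (fun t => jacobiTheta (τ t)) l (𝓝 1) := by
  simpa only [jacobiTheta_eq_jacobiTheta₂, ofReal_zero] using tendsto_jacobiTheta₂_ofReal 0 hτ

theorem jacobiTheta_add_two_mul (τ : ℂ) (a : ℕ) : jacobiTheta (τ + 2 * a) = jacobiTheta τ := by
  induction a with
  | zero => simp
  | succ n ih =>
    rw [← ih, ← jacobiTheta_two_add (τ + 2 * n)]
    congr 1; push_cast; ring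

/-- The quadratic Gauss sum `∑ exp (π i k² / N)` over `0 ≤ k < N`, for even `N`. -/
noncomputable def evenGaussSum (N : ℕ) : ℂ := ∑ k : Fin N, cexp (Real.pi * I * (k : ℂ) ^ 2 / N)

/-- The contribution of a residue class to the theta function. -/
theorem tsum_residue_eq {N : ℕ} (hN : 0 < N) (k : ℕ) {ε : ℝ} (hε : 0 < ε) :
    (√ε : ℂ) * ∑' m : ℤ, cexp (-Real.pi * ε * (k + N * m) ^ 2) =
      1 / N * jacobiTheta₂ ((k / N : ℝ) : ℂ) (I / (ε * N ^ 2)) := by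
  have hN' : (N : ℂ) ≠ 0 := by exact_mod_cast hN.ne'
  have hε' : (ε : ℂ) ≠ 0 := by exact_mod_cast hε.ne'
  have h1 : ∑' m : ℤ, cexp (-Real.pi * ε * (k + N * m) ^ 2) =
      cexp (-Real.pi * ε * k ^ 2) * jacobiTheta₂ (I * ε * k * N) (I * ε * N ^ 2) := by
    rw [jacobiTheta₂, ← tsum_mul_left]
    refine tsum_congr fun m => ?_
    rw [jacobiTheta₂_term, ← Complex.exp_add]
    congr 1
    linear_combination (-2 * Real.pi * ε * k * N * m - Real.pi * ε * N ^ 2 * m ^ 2) * I_sq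
  have h2 : (-I * (I * ε * N ^ 2)) = ((ε * N ^ 2 : ℝ) : ℂ) := by
    push_cast; linear_combination (-ε * N ^ 2) * I_sq
  have h3 : ((ε * N ^ 2 : ℝ) : ℂ) ^ (1 / 2 : ℂ) = ((√ε * N : ℝ) : ℂ) := by
    rw [show (1 / 2 : ℂ) = ((1 / 2 : ℝ) : ℂ) by push_cast; rfl,
      ← ofReal_cpow (by positivity), ← Real.sqrt_eq_rpow, Real.sqrt_mul hε.le,
      Real.sqrt_sq (by positivity)]
  have hs : (√ε : ℂ) ≠ 0 := by exact_mod_cast (Real.sqrt_pos.2 hε).ne'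
  rw [h1, jacobiTheta₂_functional_equation, h2, h3]
  have h4 : -Real.pi * I * (I * ε * k * N) ^ 2 / (I * ε * N ^ 2) = Real.pi * ε * k ^ 2 := by
    have : (I * ε * k * N) ^ 2 / (I * ε * N ^ 2) = I * ε * k ^ 2 := by field_simp
    rw [mul_div_assoc, this]
    linear_combination (-(Real.pi : ℂ) * ε * k ^ 2) * I_sq
  have h5 : (I * ε * k * N) / (I * ε * N ^ 2) = ((k / N : ℝ) : ℂ) := by
    push_cast; field_simp
  have h6 : -1 / (I * ε * N ^ 2) = I / (ε * N ^ 2) := by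
    field_simp; linear_combination (-1 : ℂ) * I_sq
  have h7 : cexp (-Real.pi * ε * k ^ 2) * cexp (Real.pi * ε * k ^ 2) = 1 := by
    rw [← Complex.exp_add, ← Complex.exp_zero]
    congr 1; ring
  rw [h4, h5, h6, ofReal_mul, ofReal_natCast]
  set J := jacobiTheta₂ ((k / N : ℝ) : ℂ) (I / (ε * N ^ 2))
  set u := cexp (-Real.pi * ε * k ^ 2)
  set w := cexp (Real.pi * ε * k ^ 2)
  field_simp
  linear_combination J * h7

/-- The growth of the theta function at the cusp `1 / N`, summed over residue classes. -/
theorem tendsto_sqrt_mul_jacobiTheta_residue {a : ℕ} (ha : 0 < a) :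
    Tendsto (fun ε : ℝ => (√ε : ℂ) * jacobiTheta (1 / (2 * a) + I * ε)) (𝓝[>] 0)
      (𝓝 (evenGaussSum (2 * a) / (2 * a))) := by
  have hN : 0 < 2 * a := by omega
  have : NeZero (2 * a) := ⟨hN.ne'⟩
  have ha' : (a : ℂ) ≠ 0 := by exact_mod_cast ha.ne'
  have h1 : ∀ ε : ℝ, 0 < ε → (√ε : ℂ) * jacobiTheta (1 / (2 * a) + I * ε) =
      ∑ k : Fin (2 * a), cexp (Real.pi * I * (k : ℂ) ^ 2 / (2 * a : ℕ)) *
        (1 / (2 * a : ℕ) * jacobiTheta₂ (((k : ℕ) / (2 * a : ℕ) : ℝ) : ℂ)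
          (I / (ε * (2 * a : ℕ) ^ 2))) := by
    intro ε hε
    have hτ : 0 < (1 / (2 * a) + I * ε : ℂ).im := by
      have : (1 / (2 * a) : ℂ) = ((1 / (2 * a) : ℝ) : ℂ) := by push_cast; rfl
      rw [this, add_im, ofReal_im]; simpa using hε
    let e : ℤ ≃ Fin (2 * a) × ℤ := (Int.divModEquiv (2 * a)).trans (Equiv.prodComm _ _)
    have hs : Summable fun p : Fin (2 * a) × ℤ =>
        jacobiTheta₂_term (e.symm p) 0 (1 / (2 * a) + I * ε) :=
      e.symm.summable_iff.2 (hasSum_jacobiTheta₂_term 0 hτ).summable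
    rw [jacobiTheta_eq_jacobiTheta₂, jacobiTheta₂, ← e.symm.tsum_eq, hs.tsum_prod, tsum_fintype,
      Finset.mul_sum]
    refine Finset.sum_congr rfl fun k _ => ?_
    rw [← tsum_residue_eq hN k hε, mul_left_comm]
    congr 1
    rw [← tsum_mul_left]
    refine tsum_congr fun m => ?_
    rw [jacobiTheta₂_term, ← Complex.exp_add, Complex.exp_eq_exp_iff_exists_int]
    have he : e.symm (k, m) = m * (2 * a : ℕ) + (k : ℕ) := rfl
    rw [he]
    -- `(k + 2 a m)² / (2 a)` exceeds `k² / (2 a)` by an even integer, so the phase depends only on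
    -- the residue `k`.
    refine ⟨m * k + a * m ^ 2, ?_⟩
    push_cast
    field_simp
    linear_combination (8 * m * a ^ 2 * k * ε + 8 * m ^ 2 * a ^ 3 * ε + 2 * a * k ^ 2 * ε : ℂ) * I_sq
  have h2 : Tendsto (fun ε : ℝ => ∑ k : Fin (2 * a),
      cexp (Real.pi * I * (k : ℂ) ^ 2 / (2 * a : ℕ)) *
        (1 / (2 * a : ℕ) * jacobiTheta₂ (((k : ℕ) / (2 * a : ℕ) : ℝ) : ℂ)
          (I / (ε * (2 * a : ℕ) ^ 2)))) (𝓝[>] 0)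
      (𝓝 (∑ k : Fin (2 * a), cexp (Real.pi * I * (k : ℂ) ^ 2 / (2 * a : ℕ)) *
        (1 / (2 * a : ℕ) * 1))) := by
    refine tendsto_finsetSum _ fun k _ => ((tendsto_jacobiTheta₂_ofReal _ ?_).const_mul _).const_mul _
    have h3 : ∀ ε : ℝ, (I / (ε * (2 * a : ℕ) ^ 2) : ℂ).im = ((2 * a : ℕ) ^ 2 : ℝ)⁻¹ * ε⁻¹ := by
      intro ε
      have : (I / (ε * (2 * a : ℕ) ^ 2) : ℂ) =
          ((((2 * a : ℕ) ^ 2 : ℝ)⁻¹ * ε⁻¹ : ℝ) : ℂ) * I := by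
        push_cast; rw [div_eq_mul_inv, mul_inv]; ring
      rw [this, im_ofReal_mul, I_im, mul_one]
    simp only [h3]
    exact tendsto_inv_nhdsGT_zero.const_mul_atTop (by positivity)
  have h4 : ∑ k : Fin (2 * a), cexp (Real.pi * I * (k : ℂ) ^ 2 / (2 * a : ℕ)) *
        (1 / (2 * a : ℕ) * 1) = evenGaussSum (2 * a) / (2 * a) := by
    rw [← Finset.sum_mul, evenGaussSum, mul_one, mul_one_div]; push_cast; rfl
  rw [← h4]
  refine h2.congr' ?_
  filter_upwards [self_mem_nhdsWithin] with ε hε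
  exact (h1 ε hε).symm

theorem ofReal_mul_cpow {x : ℝ} (hx : 0 < x) {z : ℂ} (hz : z ≠ 0) (s : ℂ) :
    ((x : ℂ) * z) ^ s = (x : ℂ) ^ s * z ^ s := by
  have hx' : (x : ℂ) ≠ 0 := by exact_mod_cast hx.ne'
  rw [cpow_def_of_ne_zero (mul_ne_zero hx' hz), cpow_def_of_ne_zero hx', cpow_def_of_ne_zero hz,
    log_ofReal_mul hx hz, ← Complex.exp_add, ofReal_log hx.le, add_mul]

/-- The growth of the theta function at the cusp `1 / N`, from its functional equation. -/
theorem tendsto_sqrt_mul_jacobiTheta {a : ℕ} (ha : 0 < a) :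
    Tendsto (fun ε : ℝ => (√ε : ℂ) * jacobiTheta (1 / (2 * a) + I * ε)) (𝓝[>] 0)
      (𝓝 ((-I / (2 * a)) ^ (-(1 / 2) : ℂ) * (2 * a : ℂ)⁻¹)) := by
  have ha' : (a : ℂ) ≠ 0 := by exact_mod_cast ha.ne'
  have ha0 : (0 : ℝ) < a := by exact_mod_cast ha
  set τ : ℝ → ℂ := fun ε => 1 / (2 * a) + I * ε with hτ
  have hτ_tendsto : Tendsto τ (𝓝[>] 0) (𝓝 (1 / (2 * a))) := by
    have : Continuous τ := by fun_prop
    have h := (this.tendsto 0).mono_left (nhdsWithin_le_nhds (s := Set.Ioi 0))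
    simpa [hτ] using h
  have hτ_im : ∀ ε : ℝ, (τ ε).im = ε := by
    intro ε
    have : (1 / (2 * a) : ℂ) = ((1 / (2 * a) : ℝ) : ℂ) := by push_cast; rfl
    simp only [hτ]
    rw [this, add_im, ofReal_im]; simp
  -- Inversion, translation by `2 a`, then inversion again: the middle point `-1 / τ + 2 a = 2 a i ε
  -- / τ` tends to zero, and the last inversion sends it to the cusp at infinity, where theta tends
  -- to one.
  have key : ∀ ε : ℝ, 0 < ε → (√ε : ℂ) * jacobiTheta (τ ε) =
      (-I * τ ε) ^ (-(1 / 2) : ℂ) * (2 * a / τ ε) ^ (-(1 / 2) : ℂ) *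
        jacobiTheta (I * τ ε / (2 * a * ε)) := by
    intro ε hε
    have hε' : (ε : ℂ) ≠ 0 := by exact_mod_cast hε.ne'
    have hτ0 : τ ε ≠ 0 := fun h => by
      have := hτ_im ε
      rw [h] at this; simp at this; exact hε.ne this
    have h1 : -1 / τ ε + 2 * a = I * (2 * a * ε) / τ ε := by
      field_simp
      simp only [hτ]
      field_simp
      ring
    have h2 : -1 / (I * (2 * a * ε) / τ ε) = I * τ ε / (2 * a * ε) := by
      field_simp
      linear_combination (-1 : ℂ) * I_sq
    have h3 := jacobiTheta₂_functional_equation 0 (τ ε)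
    have h4 := jacobiTheta₂_functional_equation 0 (I * (2 * a * ε) / τ ε)
    have h5 : -I * (I * (2 * a * ε) / τ ε) = (ε : ℝ) * (2 * a / τ ε) := by
      linear_combination (-(2 * a * ε / τ ε)) * I_sq
    simp only [ne_eq, OfNat.ofNat_ne_zero, not_false_eq_true, zero_pow, mul_zero, zero_div,
      Complex.exp_zero, mul_one, ← jacobiTheta_eq_jacobiTheta₂] at h3 h4
    rw [h2, ← h1, jacobiTheta_add_two_mul, h1, h5] at h4
    rw [h3, h4, ofReal_mul_cpow hε (div_ne_zero (by simpa using ha') hτ0)]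
    rw [cpow_neg, cpow_neg]
    have h6 : ((ε : ℝ) : ℂ) ^ (1 / 2 : ℂ) = ((√ε : ℝ) : ℂ) := by
      rw [show (1 / 2 : ℂ) = ((1 / 2 : ℝ) : ℂ) by push_cast; rfl,
        ← ofReal_cpow hε.le, ← Real.sqrt_eq_rpow]
    have hs : (√ε : ℂ) ≠ 0 := by exact_mod_cast (Real.sqrt_pos.2 hε).ne'
    rw [h6]
    field_simp
  have hlim : Tendsto (fun ε : ℝ => (-I * τ ε) ^ (-(1 / 2) : ℂ) * (2 * a / τ ε) ^ (-(1 / 2) : ℂ) *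
        jacobiTheta (I * τ ε / (2 * a * ε))) (𝓝[>] 0)
      (𝓝 ((-I / (2 * a)) ^ (-(1 / 2) : ℂ) * (2 * a : ℂ)⁻¹ * 1)) := by
    refine Tendsto.mul (Tendsto.mul ?_ ?_) (tendsto_jacobiTheta ?_)
    · refine Tendsto.cpow ?_ tendsto_const_nhds ?_
      · simpa [div_eq_mul_inv] using hτ_tendsto.const_mul (-I)
      · right
        have : (-I / (2 * a) : ℂ) = ((-(1 / (2 * a)) : ℝ) : ℂ) * I := by push_cast; ring
        rw [this, im_ofReal_mul, I_im, mul_one]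
        exact neg_ne_zero.2 (by positivity)
    · have h1 : (2 * a : ℂ)⁻¹ = (2 * a / (1 / (2 * a)) : ℂ) ^ (-(1 / 2) : ℂ) := by
        have : (2 * a / (1 / (2 * a)) : ℂ) = (((2 * a) ^ 2 : ℝ) : ℂ) := by
          push_cast; field_simp
        rw [this, show (-(1 / 2) : ℂ) = ((-(1 / 2) : ℝ) : ℂ) by push_cast; rfl,
          ← ofReal_cpow (by positivity), Real.rpow_neg (by positivity), ← Real.sqrt_eq_rpow,
          Real.sqrt_sq (by positivity)]
        push_cast; rfl
      rw [h1]
      refine Tendsto.cpow (tendsto_const_nhds.div hτ_tendsto (by simpa using ha')) tendsto_const_nhds ?_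
      left
      have : (2 * a / (1 / (2 * a)) : ℂ) = (((2 * a) ^ 2 : ℝ) : ℂ) := by
        push_cast; field_simp
      rw [this, ofReal_re]; positivity
    · have h3 : ∀ ε : ℝ, 0 < ε → (1 / (2 * a) * (1 / (2 * a)) : ℝ) * ε⁻¹ =
          (I * τ ε / (2 * a * ε) : ℂ).im := by
        intro ε hε
        have hε' : (ε : ℂ) ≠ 0 := by exact_mod_cast hε.ne'
        have : (I * τ ε / (2 * a * ε) : ℂ) =
            ((1 / (2 * a) * (1 / (2 * a)) * ε⁻¹ : ℝ) : ℂ) * I + ((-1 / (2 * a) : ℝ) : ℂ) := by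
          push_cast
          simp only [hτ]
          field_simp
          linear_combination (2 * a * ε : ℂ) * I_sq
        rw [this, add_im, im_ofReal_mul, I_im, ofReal_im, mul_one, add_zero]
      refine (tendsto_inv_nhdsGT_zero.const_mul_atTop (by positivity :
        (0 : ℝ) < 1 / (2 * a) * (1 / (2 * a)))).congr' ?_
      filter_upwards [self_mem_nhdsWithin] with ε hε
      exact h3 ε hε
  rw [mul_one] at hlim
  refine hlim.congr' ?_
  filter_upwards [self_mem_nhdsWithin] with ε hε
  exact (key ε hε).symm

/-- The quadratic Gauss sum modulo `2 a` is a positive multiple of a fixed eighth root of unity. -/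
theorem evenGaussSum_eq {a : ℕ} (ha : 0 < a) :
    evenGaussSum (2 * a) = √(2 * a : ℝ) * (-I) ^ (-(1 / 2) : ℂ) := by
  have ha' : (a : ℂ) ≠ 0 := by exact_mod_cast ha.ne'
  have h := tendsto_nhds_unique (tendsto_sqrt_mul_jacobiTheta_residue ha)
    (tendsto_sqrt_mul_jacobiTheta ha)
  rw [div_eq_mul_inv] at h
  rw [mul_right_cancel₀ (inv_ne_zero (by simpa using ha')) h]
  have h1 : (-I / (2 * a) : ℂ) = (((2 * a)⁻¹ : ℝ) : ℂ) * -I := by push_cast; ring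
  rw [h1, ofReal_mul_cpow (by positivity) (neg_ne_zero.2 I_ne_zero)]
  congr 1
  rw [show (-(1 / 2) : ℂ) = ((-(1 / 2) : ℝ) : ℂ) by push_cast; rfl,
    ← ofReal_cpow (by positivity), Real.inv_rpow (by positivity), Real.rpow_neg (by positivity),
    inv_inv, ← Real.sqrt_eq_rpow]

/-- The common phase of the one-dimensional sums is an eighth root of unity; this is where rank
eight matters. -/
theorem prod_evenGaussSum_pos {a : Fin 8 → ℕ} (ha : ∀ i, 0 < a i) :
    ∃ c : ℝ, 0 < c ∧ ∏ i, evenGaussSum (2 * a i) = c := by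
  refine ⟨∏ i, √(2 * a i : ℝ), Finset.prod_pos fun i _ => Real.sqrt_pos.2 (by
    have := ha i; positivity), ?_⟩
  simp only [fun i => evenGaussSum_eq (ha i)]
  rw [Finset.prod_mul_distrib, Finset.prod_const, Finset.card_fin, ← cpow_mul_nat, ofReal_prod]
  have : (-I) ^ (-(1 / 2) * (8 : ℕ) : ℂ) = 1 := by
    rw [show (-(1 / 2) * (8 : ℕ) : ℂ) = ((-4 : ℤ) : ℂ) by push_cast; norm_num, cpow_intCast]
    rw [zpow_neg]
    have : (-I) ^ (4 : ℤ) = 1 := by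
      rw [show (4 : ℤ) = ((4 : ℕ) : ℤ) from rfl, zpow_natCast, neg_pow, I_pow_four]; norm_num
    rw [this, inv_one]
  rw [this, mul_one]

end QuadraticGaussSum


/-! ### Gauss sums of lattices and finite-index sublattices -/

section LatticeGaussSum

variable {E : Type*} [NormedAddCommGroup E] [InnerProductSpace ℝ E]

/-- The unit complex number `exp (π i (x, x))`. -/
noncomputable def normPhase (x : E) : ℂ := Complex.exp (Real.pi * Complex.I * (⟪x, x⟫ : ℝ))

theorem normPhase_add (x y : E) : normPhase (x + y) =
    normPhase x * normPhase y * Complex.exp (2 * Real.pi * Complex.I * (⟪x, y⟫ : ℝ)) := by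
  rw [normPhase, normPhase, normPhase, ← Complex.exp_add, ← Complex.exp_add, inner_add_left,
    inner_add_right, inner_add_right, real_inner_comm x y]
  congr 1
  push_cast
  ring

theorem IsEven.normPhase_eq_one {L : Submodule ℤ E} (hL : IsEven L) {x : E} (hx : x ∈ L) :
    normPhase x = 1 := by
  obtain ⟨k, hk⟩ := hL.2 x hx
  rw [normPhase, hk, Complex.exp_eq_one_iff]
  exact ⟨k, by push_cast; ring⟩

theorem IsEven.normPhase_add {L : Submodule ℤ E} (hL : IsEven L) {x y : E} (hx : x ∈ dual L)
    (hy : y ∈ L) : normPhase (x + y) = normPhase x := by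
  obtain ⟨k, hk⟩ := hx.2 y hy
  rw [EuclideanLattice.normPhase_add, hL.normPhase_eq_one hy, hk, mul_one,
    (Complex.exp_eq_one_iff (x := 2 * Real.pi * Complex.I * ((k : ℝ) : ℂ))).2
      ⟨k, by push_cast; ring⟩, mul_one]

/-- The function that `normPhase` induces on the discriminant group of an even lattice. -/
noncomputable def discriminantPhase {L : Submodule ℤ E} (d : DiscriminantGroup L) : ℂ :=
  normPhase (Function.surjInv (Submodule.Quotient.mk_surjective (L.submoduleOf (dual L))) d).1

theorem IsEven.discriminantPhase_mk {L : Submodule ℤ E} (hL : IsEven L) (x : dual L) :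
    discriminantPhase (Submodule.Quotient.mk x : DiscriminantGroup L) = normPhase (x : E) := by
  have h1 := (Submodule.Quotient.eq (L.submoduleOf (dual L))).1
    (Function.surjInv_eq (Submodule.Quotient.mk_surjective (L.submoduleOf (dual L)))
      (Submodule.Quotient.mk x))
  have h2 := hL.normPhase_add x.2 (y := _ - (x : E)) h1
  rw [add_sub_cancel] at h2
  exact h2

theorem dual_anti {M L : Submodule ℤ E} (hM : Submodule.span ℝ (M : Set E) = ⊤) (hML : M ≤ L) :
    dual L ≤ dual M :=
  fun _ hx => (mem_dual_iff hM).2 fun y hy => hx.2 y (hML hy)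

/-- The Gauss sum of a sublattice is a positive multiple of that of the lattice. -/
theorem exists_sum_discriminantPhase {M L : Submodule ℤ E}
    (hM : Submodule.span ℝ (M : Set E) = ⊤) (hML : M ≤ L) (hL : IsEven L)
    [Fintype (DiscriminantGroup M)] [Fintype (DiscriminantGroup L)] :
    ∃ n : ℕ, 0 < n ∧ ∑ d : DiscriminantGroup M, discriminantPhase d =
      n * ∑ d : DiscriminantGroup L, discriminantPhase d := by
  classical
  have hMeven : IsEven M :=
    ⟨fun x hx y hy => hL.1 x (hML hx) y (hML hy), fun x hx => hL.2 x (hML hx)⟩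
  have hLtop : Submodule.span ℝ (L : Set E) = ⊤ := by
    rw [eq_top_iff, ← hM]; exact Submodule.span_mono hML
  have hLM := dual_anti hM hML
  have hLd : L ≤ dual M := hL.le_dual.trans hLM
  let π : dual M →ₗ[ℤ] DiscriminantGroup M := (M.submoduleOf (dual M)).mkQ
  have hπ : ∀ x y : dual M, π x = π y ↔ (x : E) - y ∈ M := fun x y =>
    Submodule.Quotient.eq (M.submoduleOf (dual M))
  have hF : ∀ x : dual M, discriminantPhase (π x) = normPhase (x : E) := hMeven.discriminantPhase_mk
  let H : Submodule ℤ (DiscriminantGroup M) := (L.submoduleOf (dual M)).map π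
  have hH : ∀ h : H, ∃ z : dual M, (z : E) ∈ L ∧ π z = h := by
    rintro ⟨h, z, hz, rfl⟩
    exact ⟨z, hz, rfl⟩
  have hπH : ∀ z : dual M, (z : E) ∈ L → π z ∈ H := fun z hz => ⟨z, hz, rfl⟩
  have hmk := Submodule.Quotient.mk_surjective (L.submoduleOf (dual L))
  choose s hs using hmk
  have hsm : ∀ d e, (s d : E) - s e ∈ L → d = e := by
    intro d e h
    rw [← hs d, ← hs e]
    exact (Submodule.Quotient.eq (L.submoduleOf (dual L))).2 h
  -- With `H = L / M`, the image of `G` is the subgroup `L* / M` of `M* / M`.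
  let G : H × DiscriminantGroup L → DiscriminantGroup M := fun p => p.1 + π ⟨s p.2, hLM (s p.2).2⟩
  have hG : Function.Injective G := by
    rintro ⟨h, d⟩ ⟨h', d'⟩ hhd
    obtain ⟨z, hz, hzh⟩ := hH h
    obtain ⟨z', hz', hzh'⟩ := hH h'
    simp only [G, ← hzh, ← hzh', ← map_add] at hhd
    have h1 := hML ((hπ _ _).1 hhd)
    simp only [Submodule.coe_add] at h1
    have hd : d = d' := by
      refine hsm d d' ?_
      have : (s d : E) - s d' = ((z : E) + s d - (z' + s d')) - (z - z') := by abel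
      rw [this]
      exact L.sub_mem h1 (L.sub_mem hz hz')
    subst hd
    rw [map_add, map_add, add_left_inj, hzh, hzh'] at hhd
    rw [Subtype.ext hhd]
  have hGF : ∀ p, discriminantPhase (G p) = discriminantPhase p.2 := by
    rintro ⟨h, d⟩
    obtain ⟨z, hz, hzh⟩ := hH h
    simp only [G, ← hzh, ← map_add]
    rw [hF, Submodule.coe_add, add_comm, hL.normPhase_add (s d).2 hz, ← hL.discriminantPhase_mk, hs]
  -- The sum is averaged over translations by `H`. Outside `L* / M` the translates are twisted by a
  -- nontrivial character of `H` and cancel; inside, the phase is constant.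
  have hT : ∀ a ∉ Finset.univ.image G, ∑ h : H, discriminantPhase (a + h.1) = 0 := by
    intro a ha
    obtain ⟨x, rfl⟩ := Submodule.Quotient.mk_surjective _ a
    have hx : (x : E) ∉ dual L := by
      intro hx
      refine ha (Finset.mem_image.2 ⟨⟨⟨π (x - ⟨s (Submodule.Quotient.mk ⟨x, hx⟩),
        hLM (s _).2⟩), hπH _ ?_⟩, Submodule.Quotient.mk ⟨x, hx⟩⟩, Finset.mem_univ _, ?_⟩)
      · exact (Submodule.Quotient.eq (L.submoduleOf (dual L))).1 (hs (Submodule.Quotient.mk ⟨x, hx⟩)).symm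
      · simp only [G, ← map_add, sub_add_cancel]; rfl
    rw [mem_dual_iff hLtop] at hx
    push Not at hx
    obtain ⟨y, hy, hxy⟩ := hx
    set ω := Complex.exp (2 * Real.pi * Complex.I * (⟪(x : E), y⟫ : ℝ)) with hω
    have hω1 : ω ≠ 1 := by
      rw [hω, Ne, Complex.exp_eq_one_iff]
      rintro ⟨n, hn⟩
      refine hxy n ?_
      rw [mul_comm] at hn
      have := mul_right_cancel₀ Complex.two_pi_I_ne_zero hn
      exact_mod_cast this
    let h0 : H := ⟨π ⟨y, hLd hy⟩, hπH _ hy⟩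
    have h1 : ∑ h : H, discriminantPhase (π x + h.1) = ω * ∑ h : H, discriminantPhase (π x + h.1) := by
      rw [Finset.mul_sum, 
        ← Equiv.sum_comp (Equiv.addRight h0) fun h : H => discriminantPhase (π x + h.1)]
      refine Finset.sum_congr rfl fun h _ => ?_
      obtain ⟨z, hz, hzh⟩ := hH h
      obtain ⟨k, hk⟩ := hL.1 z hz y hy
      simp only [Equiv.coe_addRight, Submodule.coe_add, ← hzh, h0, ← map_add, hF]
      rw [← add_assoc, EuclideanLattice.normPhase_add, hL.normPhase_eq_one hy, inner_add_left, hk,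
        mul_comm ω, mul_one]
      congr 1
      rw [hω, Complex.exp_eq_exp_iff_exists_int]
      exact ⟨k, by push_cast; ring⟩
    have h2 : (1 - ω) * ∑ h : H, discriminantPhase (π x + h.1) = 0 := by
      rw [sub_mul, one_mul, ← h1, sub_self]
    exact (mul_eq_zero.1 h2).resolve_left (sub_ne_zero.2 hω1.symm)
  have hT' : ∀ a ∈ Finset.univ.image G,
      ∑ h : H, discriminantPhase (a + h.1) = Fintype.card H * discriminantPhase a := by
    intro a ha
    obtain ⟨⟨h', d⟩, -, rfl⟩ := Finset.mem_image.1 ha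
    have : ∀ h : H, discriminantPhase (G (h', d) + h.1) = discriminantPhase (G (h', d)) := by
      intro h
      have : G (h', d) + h.1 = G (h' + h, d) := by
        simp only [G, Submodule.coe_add]; abel
      rw [this, hGF, hGF]
    simp only [this, Finset.sum_const, Finset.card_univ, nsmul_eq_mul]
  have hcard : 0 < Fintype.card H := Fintype.card_pos
  refine ⟨Fintype.card H, hcard, ?_⟩
  have hcard' : (Fintype.card H : ℂ) ≠ 0 := by exact_mod_cast hcard.ne'
  refine mul_left_cancel₀ hcard' ?_
  calc (Fintype.card H : ℂ) * ∑ d : DiscriminantGroup M, discriminantPhase d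
      = ∑ h : H, ∑ a : DiscriminantGroup M, discriminantPhase (a + h.1) := by
        have h1 : ∀ h : H, ∑ a : DiscriminantGroup M, discriminantPhase (a + h.1) =
            ∑ a : DiscriminantGroup M, discriminantPhase a := fun h =>
          Equiv.sum_comp (Equiv.addRight h.1) discriminantPhase
        rw [Finset.sum_congr rfl fun h _ => h1 h, Finset.sum_const, Finset.card_univ,
          nsmul_eq_mul]
    _ = ∑ a : DiscriminantGroup M, ∑ h : H, discriminantPhase (a + h.1) := Finset.sum_comm
    _ = ∑ a ∈ Finset.univ.image G, ∑ h : H, discriminantPhase (a + h.1) :=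
        (Finset.sum_subset (Finset.subset_univ _) fun a _ ha => hT a ha).symm
    _ = ∑ a ∈ Finset.univ.image G, Fintype.card H * discriminantPhase a :=
        Finset.sum_congr rfl hT'
    _ = Fintype.card H * ∑ p, discriminantPhase (G p) := by
        rw [← Finset.mul_sum, Finset.sum_image hG.injOn]
    _ = Fintype.card H * (Fintype.card H * ∑ d : DiscriminantGroup L, discriminantPhase d) := by
        rw [Fintype.sum_prod_type]
        simp only [hGF, Finset.sum_const, Finset.card_univ, nsmul_eq_mul]

end LatticeGaussSum


/-! ### Milgram's formula by reduction to an orthogonal sublattice -/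

section OrthogonalSublattice

variable {E : Type*} [NormedAddCommGroup E] [InnerProductSpace ℝ E]

/-- Fewer than `rank L` vectors of an integral lattice `L` have a common orthogonal vector
in `L`. -/
theorem IsEven.exists_orthogonal {L : Submodule ℤ E} (hL : IsEven L) {k : ℕ}
    (hk : k < finrank ℤ L) (m : Fin k → E) (hm : ∀ i, m i ∈ L) :
    ∃ x ∈ L, x ≠ 0 ∧ ∀ i, ⟪m i, x⟫ = 0 := by
  choose f hf using fun (x : L) (i : Fin k) => hL.1 (m i) (hm i) x x.2
  let F : L →ₗ[ℤ] (Fin k → ℤ) :=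
    { toFun := f
      map_add' := fun x y => by
        ext i
        have h := hf (x + y) i
        rw [Submodule.coe_add, inner_add_right, hf, hf] at h
        exact_mod_cast h.symm
      map_smul' := fun c x => by
        ext i
        have h := hf (c • x) i
        rw [Submodule.coe_smul, real_inner_zsmul_right, hf] at h
        exact_mod_cast h.symm }
  have hF : ¬ Function.Injective F := fun h => by
    have := LinearMap.finrank_le_finrank_of_injective h
    rw [finrank_fin_fun] at this
    omega
  rw [← LinearMap.ker_eq_bot, Submodule.eq_bot_iff] at hF
  push Not at hF
  obtain ⟨x, hx, hx0⟩ := hF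
  refine ⟨x, x.2, fun h => hx0 (Subtype.ext h), fun i => ?_⟩
  rw [hf, show f x i = 0 from congrFun hx i, Int.cast_zero]

/-- For `k` equal to the rank this yields a sublattice of finite index on which the Gauss sum is a
product of one-dimensional ones. -/
theorem IsEven.exists_orthogonal_family {L : Submodule ℤ E} (hL : IsEven L) (k : ℕ)
    (hk : k ≤ finrank ℤ L) : ∃ (m : Fin k → E) (a : Fin k → ℕ), (∀ i, m i ∈ L) ∧
      (∀ i, 0 < a i) ∧ ∀ i j, ⟪m i, m j⟫ = if i = j then 2 * (a i : ℝ) else 0 := by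
  induction k with
  | zero => exact ⟨Fin.elim0, Fin.elim0, fun i => i.elim0, fun i => i.elim0, fun i => i.elim0⟩
  | succ k ih =>
    obtain ⟨m, a, hm, ha, hma⟩ := ih (by omega)
    obtain ⟨x, hx, hx0, hmx⟩ := hL.exists_orthogonal (by omega) m hm
    obtain ⟨b, hb⟩ := hL.2 x hx
    have hb0 : 0 < b := by
      have := real_inner_self_pos.2 hx0
      rw [hb] at this
      exact_mod_cast (by linarith : (0 : ℝ) < b)
    refine ⟨Fin.snoc m x, Fin.snoc a b.toNat, fun i => ?_, fun i => ?_, fun i j => ?_⟩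
    · refine Fin.lastCases ?_ (fun i => ?_) i
      · rwa [Fin.snoc_last]
      · rw [Fin.snoc_castSucc]; exact hm i
    · refine Fin.lastCases ?_ (fun i => ?_) i
      · rw [Fin.snoc_last]; omega
      · rw [Fin.snoc_castSucc]; exact ha i
    · have hb' : ((b.toNat : ℕ) : ℝ) = b := by exact_mod_cast Int.toNat_of_nonneg hb0.le
      refine Fin.lastCases ?_ (fun i => ?_) i <;> refine Fin.lastCases ?_ (fun j => ?_) j
      · rw [Fin.snoc_last, Fin.snoc_last, if_pos rfl, hb, hb']
      · rw [Fin.snoc_last, Fin.snoc_castSucc, if_neg (Fin.castSucc_lt_last j).ne',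
          real_inner_comm, hmx]
      · rw [Fin.snoc_last, Fin.snoc_castSucc, if_neg (Fin.castSucc_lt_last i).ne, hmx]
      · simp only [Fin.snoc_castSucc, hma, Fin.castSucc_inj]

variable {n : ℕ}

section

variable {m : Fin n → E} {a : Fin n → ℕ}

theorem inner_sum_smul_of_orthogonal
    (hm : ∀ i j, ⟪m i, m j⟫ = if i = j then 2 * (a i : ℝ) else 0) (c : Fin n → ℝ) (j : Fin n) :
    ⟪∑ i, c i • m i, m j⟫ = c j * (2 * a j) := by
  simp [sum_inner, real_inner_smul_left, hm]

theorem span_eq_top_of_orthogonal [FiniteDimensional ℝ E] (hE : finrank ℝ E = n) (ha : ∀ i, 0 < a i)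
    (hm : ∀ i j, ⟪m i, m j⟫ = if i = j then 2 * (a i : ℝ) else 0) :
    Submodule.span ℝ (Set.range m) = ⊤ := by
  have hli : LinearIndependent ℝ m := by
    refine linearIndependent_of_ne_zero_of_inner_eq_zero (fun i h => ?_) fun i j hij => ?_
    · have h1 := hm i i
      rw [h, inner_zero_left, if_pos rfl] at h1
      have := ha i
      have : (0 : ℝ) < a i := by exact_mod_cast this
      linarith
    · exact (hm i j).trans (if_neg hij)
  exact hli.span_eq_top_of_card_eq_finrank' (by simp [hE])

theorem eq_of_inner_eq_of_orthogonal (hm : Submodule.span ℝ (Set.range m) = ⊤) {x y : E}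
    (h : ∀ i, ⟪x, m i⟫ = ⟪y, m i⟫) : x = y := by
  rw [← sub_eq_zero, ← inner_self_eq_zero (𝕜 := ℝ)]
  have : ∀ z ∈ Submodule.span ℝ (Set.range m), ⟪x - y, z⟫ = 0 := by
    intro z hz
    induction hz using Submodule.span_induction with
    | mem z hz => obtain ⟨i, rfl⟩ := hz; rw [inner_sub_left, h, sub_self]
    | zero => exact inner_zero_right _
    | add y z _ _ hy hz => rw [inner_add_right, hy, hz, add_zero]
    | smul c y _ hy => rw [real_inner_smul_right, hy, mul_zero]
  exact this _ (by rw [hm]; trivial)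

/-- The discriminant group of a lattice with an orthogonal basis is a box, on which the phase is a
product of one-dimensional phases. -/
theorem exists_box_equiv [FiniteDimensional ℝ E] (hE : finrank ℝ E = n) (ha : ∀ i, 0 < a i)
    (hm : ∀ i j, ⟪m i, m j⟫ = if i = j then 2 * (a i : ℝ) else 0)
    (heven : IsEven (Submodule.span ℤ (Set.range m))) :
    ∃ ψ : (∀ i, Fin (2 * a i)) → DiscriminantGroup (Submodule.span ℤ (Set.range m)),
      Function.Bijective ψ ∧ ∀ k, discriminantPhase (ψ k) = ∏ i,
        Complex.exp (Real.pi * Complex.I * (k i : ℂ) ^ 2 / (2 * a i : ℕ)) := by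
  have htop := span_eq_top_of_orthogonal hE ha hm
  set M := Submodule.span ℤ (Set.range m) with hM
  have hMtop : Submodule.span ℝ (M : Set E) = ⊤ := by
    rw [eq_top_iff, ← htop]; exact Submodule.span_mono Submodule.subset_span
  have ha0 : ∀ i, (0 : ℝ) < a i := fun i => by exact_mod_cast ha i
  have hmM : ∀ i, m i ∈ M := fun i => Submodule.subset_span ⟨i, rfl⟩
  have hmem : ∀ x, x ∈ M ↔ ∀ i, ∃ z : ℤ, ⟪x, m i⟫ = z * (2 * a i) := by
    intro x
    constructor
    · intro hx i
      obtain ⟨c, rfl⟩ := (Submodule.mem_span_range_iff_exists_fun ℤ).1 hx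
      refine ⟨c i, ?_⟩
      simp only [← Int.cast_smul_eq_zsmul ℝ]
      exact inner_sum_smul_of_orthogonal hm _ i
    · intro h
      choose z hz using h
      refine (Submodule.mem_span_range_iff_exists_fun ℤ).2 ⟨z, ?_⟩
      refine eq_of_inner_eq_of_orthogonal htop fun i => ?_
      simp only [← Int.cast_smul_eq_zsmul ℝ]
      rw [inner_sum_smul_of_orthogonal hm, hz]
  have hdual : ∀ x, x ∈ dual M ↔ ∀ i, ∃ z : ℤ, ⟪x, m i⟫ = z := by
    intro x
    rw [mem_dual_iff hMtop]
    refine ⟨fun h i => h _ (hmM i), fun h y hy => ?_⟩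
    choose z hz using h
    obtain ⟨c, rfl⟩ := (Submodule.mem_span_range_iff_exists_fun ℤ).1 hy
    refine ⟨∑ i, c i * z i, ?_⟩
    simp only [inner_sum, real_inner_zsmul_right, hz]
    push_cast; rfl
  let v : (∀ i, Fin (2 * a i)) → E := fun k => ∑ i, ((k i : ℕ) / (2 * a i) : ℝ) • m i
  have hv : ∀ k i, ⟪v k, m i⟫ = (k i : ℕ) := by
    intro k i
    rw [inner_sum_smul_of_orthogonal hm]
    have := (ha0 i).ne'
    field_simp
  have hvd : ∀ k, v k ∈ dual M := fun k => (hdual _).2 fun i => ⟨(k i : ℕ), by rw [hv]; simp⟩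
  refine ⟨fun k => Submodule.Quotient.mk ⟨v k, hvd k⟩, ⟨fun k l hkl => ?_, fun d => ?_⟩,
    fun k => ?_⟩
  · have h1 := (Submodule.Quotient.eq (M.submoduleOf (dual M))).1 hkl
    have h2 : v k - v l ∈ M := h1
    rw [hmem] at h2
    ext i
    obtain ⟨z, hz⟩ := h2 i
    rw [inner_sub_left, hv, hv] at hz
    have h3 : ((k i : ℕ) : ℤ) - (l i : ℕ) = z * (2 * a i : ℕ) := by
      push_cast; exact_mod_cast hz
    have h4 : ((k i : ℕ) : ℤ) = ((l i : ℕ) : ℤ) := by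
      refine sub_eq_zero.1 (Int.eq_zero_of_abs_lt_dvd ⟨z, h3.trans (mul_comm _ _)⟩ ?_)
      have := (k i).2
      have := (l i).2
      rw [abs_lt]
      constructor <;> omega
    exact_mod_cast h4
  · obtain ⟨x, rfl⟩ := Submodule.Quotient.mk_surjective _ d
    choose z hz using (hdual _).1 x.2
    have hpos : ∀ i, (0 : ℤ) < (2 * a i : ℕ) := fun i => by have := ha i; omega
    refine ⟨fun i => ⟨(z i % (2 * a i : ℕ)).toNat, ?_⟩, ?_⟩
    · have h1 := Int.emod_nonneg (z i) (hpos i).ne'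
      have h2 := Int.emod_lt_of_pos (z i) (hpos i)
      omega
    · refine (Submodule.Quotient.eq (M.submoduleOf (dual M))).2 ?_
      change v _ - (x : E) ∈ M
      rw [hmem]
      intro i
      refine ⟨-(z i / (2 * a i : ℕ)), ?_⟩
      rw [inner_sub_left, hv, hz]
      have h1 := Int.emod_nonneg (z i) (hpos i).ne'
      have h2 := Int.emod_add_mul_ediv (z i) (2 * a i : ℕ)
      have h3 : (((z i % (2 * a i : ℕ)).toNat : ℕ) : ℤ) - z i =
          -(z i / (2 * a i : ℕ)) * (2 * a i : ℕ) := by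
        rw [Int.toNat_of_nonneg h1]; linarith
      have h4 : ((((z i % (2 * a i : ℕ)).toNat : ℕ) : ℤ) : ℝ) - z i =
          -((z i / (2 * a i : ℕ) : ℤ) : ℝ) * ((2 * a i : ℕ) : ℝ) := by exact_mod_cast h3
      push_cast at h4 ⊢
      exact h4
  · rw [heven.discriminantPhase_mk, normPhase, ← Complex.exp_sum]
    congr 1
    have : ⟪v k, v k⟫ = ∑ i, ((k i : ℕ) : ℝ) ^ 2 / (2 * a i) := by
      conv_lhs => rw [show v k = ∑ i, ((k i : ℕ) / (2 * a i) : ℝ) • m i from rfl, inner_sum]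
      refine Finset.sum_congr rfl fun i _ => ?_
      rw [real_inner_smul_right]
      have h := hv k i
      rw [show v k = ∑ i, ((k i : ℕ) / (2 * a i) : ℝ) • m i from rfl] at h
      rw [h]; ring
    change _ * ((⟪v k, v k⟫ : ℝ) : ℂ) = _
    rw [this]
    push_cast
    rw [Finset.mul_sum]
    exact Finset.sum_congr rfl fun i _ => by ring

end

/-- Milgram's formula: the Gauss sum of an even lattice of rank eight is positive. -/
theorem IsEven.sum_discriminantPhase_pos [FiniteDimensional ℝ E] {L : Submodule ℤ E} [DiscreteTopology L]
    [IsZLattice ℝ L]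
    (hE : finrank ℝ E = 8) (hL : IsEven L) [Fintype (DiscriminantGroup L)] :
    ∃ c : ℝ, 0 < c ∧ ∑ d : DiscriminantGroup L, discriminantPhase d = c := by
  classical
  obtain ⟨m, a, hmL, ha, hm⟩ := hL.exists_orthogonal_family 8 (by rw [ZLattice.rank ℝ L, hE])
  have hML : Submodule.span ℤ (Set.range m) ≤ L :=
    Submodule.span_le.2 (by rintro _ ⟨i, rfl⟩; exact hmL i)
  have heven : IsEven (Submodule.span ℤ (Set.range m)) :=
    ⟨fun x hx y hy => hL.1 x (hML hx) y (hML hy), fun x hx => hL.2 x (hML hx)⟩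
  obtain ⟨ψ, hψ, hψk⟩ := exists_box_equiv hE ha hm heven
  have : Fintype (DiscriminantGroup (Submodule.span ℤ (Set.range m))) :=
    Fintype.ofSurjective ψ hψ.2
  have htop : Submodule.span ℝ (Submodule.span ℤ (Set.range m) : Set E) = ⊤ := by
    rw [eq_top_iff, ← span_eq_top_of_orthogonal hE ha hm]
    exact Submodule.span_mono Submodule.subset_span
  obtain ⟨n, hn, h⟩ := exists_sum_discriminantPhase htop hML hL
  obtain ⟨c, hc, hcg⟩ := prod_evenGaussSum_pos ha
  have h1 : ∑ d : DiscriminantGroup (Submodule.span ℤ (Set.range m)), discriminantPhase d = c := by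
    rw [← hψ.sum_comp, ← hcg]
    simp only [hψk, evenGaussSum]
    rw [Finset.prod_univ_sum, Fintype.piFinset_univ]
  have hn' : (0 : ℝ) < n := by exact_mod_cast hn
  have hn0 : (n : ℂ) ≠ 0 := by exact_mod_cast hn.ne'
  refine ⟨c / n, by positivity, ?_⟩
  rw [h1] at h
  push_cast
  rw [h]
  field_simp

end OrthogonalSublattice


/-! ### Quaternary quadratic forms modulo five -/

section QuadraticFormsModFive

open QuadraticMap

/-- A diagonal form in four variables whose coefficients pair up into equal square classes is
hyperbolic. -/
theorem exists_hyperbolic_of_diagonal (w : Fin 4 → (ZMod 5)ˣ) (σ : Equiv.Perm (Fin 4))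
    (h01 : (w (σ 0) : ZMod 5) ^ 2 = w (σ 1) ^ 2) (h23 : (w (σ 2) : ZMod 5) ^ 2 = w (σ 3) ^ 2) :
    ∃ L : (Fin 4 → ZMod 5) ≃ₗ[ZMod 5] (Fin 2 ⊕ Fin 2 → ZMod 5),
      ∀ v, hyperbolicForm 2 (ZMod 5) (L v) = ∑ i, (w i : ZMod 5) * (v i * v i) := by
  -- Modulo five a unit squares to `1` or `-1` according to its square class.
  have hsq : ∀ a b : (ZMod 5)ˣ, (a : ZMod 5) ^ 2 = b ^ 2 →
      ∃ d : (ZMod 5)ˣ, (b : ZMod 5) = d ^ 2 * a := by decide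
  obtain ⟨c, hc⟩ := hsq _ _ h01
  obtain ⟨d, hd⟩ := hsq _ _ h23
  let p : Fin 4 → (Fin 4 → ZMod 5) →ₗ[ZMod 5] ZMod 5 := fun i => LinearMap.proj (σ i)
  -- Since `-4 = 1`, the form `a s² + a c² t²` factors as `a (s + 2 c t) (s - 2 c t)`.
  let f : (Fin 4 → ZMod 5) →ₗ[ZMod 5] (Fin 2 ⊕ Fin 2 → ZMod 5) := LinearMap.pi
    (Sum.elim ![(w (σ 0) : ZMod 5) • (p 0 + (2 * c : ZMod 5) • p 1),
        (w (σ 2) : ZMod 5) • (p 2 + (2 * d : ZMod 5) • p 3)]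
      ![p 0 - (2 * c : ZMod 5) • p 1, p 2 - (2 * d : ZMod 5) • p 3])
  have hinj : Function.Injective f := by
    rw [injective_iff_map_eq_zero]
    intro v hv
    have h1 : (w (σ 0) : ZMod 5) * (v (σ 0) + 2 * c * v (σ 1)) = 0 := congrFun hv (.inl 0)
    have h2 : (w (σ 2) : ZMod 5) * (v (σ 2) + 2 * d * v (σ 3)) = 0 := congrFun hv (.inl 1)
    have h3 : v (σ 0) - 2 * c * v (σ 1) = 0 := congrFun hv (.inr 0)
    have h4 : v (σ 2) - 2 * d * v (σ 3) = 0 := congrFun hv (.inr 1)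
    have key : ∀ (a c : (ZMod 5)ˣ) (s t : ZMod 5), (a : ZMod 5) * (s + 2 * c * t) = 0 →
        s - 2 * c * t = 0 → s = 0 ∧ t = 0 := by decide
    obtain ⟨h5, h6⟩ := key _ _ _ _ h1 h3
    obtain ⟨h7, h8⟩ := key _ _ _ _ h2 h4
    ext i
    obtain ⟨j, rfl⟩ := σ.surjective i
    fin_cases j
    exacts [h5, h6, h7, h8]
  refine ⟨LinearEquiv.ofBijective f
    ((Fintype.bijective_iff_injective_and_card f).2 ⟨hinj, by simp⟩), fun v => ?_⟩
  rw [LinearEquiv.ofBijective_apply, hyperbolicForm_two_apply,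
    ← Equiv.sum_comp σ, Fin.sum_univ_four, hc, hd]
  change (w (σ 0) : ZMod 5) * (v (σ 0) + 2 * c * v (σ 1)) * (v (σ 0) - 2 * c * v (σ 1)) +
    (w (σ 2) : ZMod 5) * (v (σ 2) + 2 * d * v (σ 3)) * (v (σ 2) - 2 * d * v (σ 3)) = _
  have h5 : (5 : ZMod 5) = 0 := rfl
  linear_combination (-(w (σ 0) : ZMod 5) * c ^ 2 * v (σ 1) ^ 2 -
    (w (σ 2) : ZMod 5) * d ^ 2 * v (σ 3) ^ 2) * h5

/-- Quadratic Gauss sums modulo five are real, and depend up to sign only on whether the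
coefficient is a square. -/
theorem exists_gaussSum_five : ∃ g : ℝ, ∀ w : (ZMod 5)ˣ,
    ((w : ZMod 5) ^ 2 = 1 ∧ ∑ s : ZMod 5, ZMod.stdAddChar ((w : ZMod 5) * (s * s)) = (g : ℂ)) ∨
    ((w : ZMod 5) ^ 2 = -1 ∧ ∑ s : ZMod 5, ZMod.stdAddChar ((w : ZMod 5) * (s * s)) = (-g : ℂ)) := by
  set ψ : AddChar (ZMod 5) ℂ := ZMod.stdAddChar with hψ
  have h0 : ∑ s : ZMod 5, ψ s = 0 := AddChar.sum_eq_zero_of_ne_one (by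
    intro h
    have h1 : ψ 1 = ψ 0 := by rw [h]; rfl
    exact absurd (ZMod.injective_stdAddChar h1) (by decide))
  have h5 : ∀ f : ZMod 5 → ℂ, ∑ s, f s = f 0 + f 1 + f 2 + f 3 + f 4 := Fin.sum_univ_five
  have h1 : ψ 4 = (starRingEnd ℂ) (ψ 1) := by
    rw [← AddChar.map_neg_eq_conj]; rfl
  have hre : ψ 1 + ψ 4 = ((2 * (ψ 1).re : ℝ) : ℂ) := by rw [h1, Complex.add_conj]
  rw [h5, AddChar.map_zero_eq_one] at h0
  have hw : ∀ w : (ZMod 5)ˣ, (w : ZMod 5) = 1 ∨ (w : ZMod 5) = 2 ∨ (w : ZMod 5) = 3 ∨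
      (w : ZMod 5) = 4 := by decide
  -- This is `1 + 2 (ψ 1 + ψ 4)`, the sum for square `w`. For nonsquares it becomes `1 + 2 (ψ 2 + ψ
  -- 3)`, its negative because all values of `ψ` add up to zero.
  refine ⟨1 + 2 * (2 * (ψ 1).re), fun w => ?_⟩
  rw [h5]
  push_cast at hre ⊢
  rw [← hre]
  rcases hw w with h | h | h | h <;> rw [h]
  · refine Or.inl ⟨rfl, ?_⟩
    change ψ 0 + ψ 1 + ψ 4 + ψ 4 + ψ 1 = _
    rw [AddChar.map_zero_eq_one]; ring
  · refine Or.inr ⟨rfl, ?_⟩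
    change ψ 0 + ψ 2 + ψ 3 + ψ 3 + ψ 2 = _
    rw [AddChar.map_zero_eq_one]; linear_combination 2 * h0
  · refine Or.inr ⟨rfl, ?_⟩
    change ψ 0 + ψ 3 + ψ 2 + ψ 2 + ψ 3 = _
    rw [AddChar.map_zero_eq_one]; linear_combination 2 * h0
  · refine Or.inl ⟨rfl, ?_⟩
    change ψ 0 + ψ 4 + ψ 1 + ψ 1 + ψ 4 = _
    rw [AddChar.map_zero_eq_one]; ring

/-- A nondegenerate quadratic form in four variables modulo five with positive Gauss sum is
hyperbolic. -/
theorem exists_hyperbolic_of_gaussSum_pos [Invertible (2 : ZMod 5)]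
    (Q : QuadraticForm (ZMod 5) (Fin 4 → ZMod 5))
    (hQ : (associated (R := ZMod 5) Q).SeparatingLeft)
    {c : ℝ} (hc : 0 < c) (hQc : ∑ v, ZMod.stdAddChar (Q v) = (c : ℂ)) :
    ∃ L : (Fin 4 → ZMod 5) ≃ₗ[ZMod 5] (Fin 2 ⊕ Fin 2 → ZMod 5),
      ∀ v, hyperbolicForm 2 (ZMod 5) (L v) = Q v := by
  have : Fact (Nat.Prime 5) := ⟨by norm_num⟩
  have hdiag := QuadraticForm.equivalent_weightedSumSquares_units_of_nondegenerate' Q hQ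
  rw [finrank_fin_fun] at hdiag
  obtain ⟨w, ⟨e⟩⟩ := hdiag
  have he : ∀ v, ∑ i, (w i : ZMod 5) * (e v i * e v i) = Q v := by
    intro v
    rw [← e.map_app v, weightedSumSquares_apply]
    rfl
  suffices ∃ σ : Equiv.Perm (Fin 4), (w (σ 0) : ZMod 5) ^ 2 = w (σ 1) ^ 2 ∧
      (w (σ 2) : ZMod 5) ^ 2 = w (σ 3) ^ 2 by
    obtain ⟨σ, h01, h23⟩ := this
    obtain ⟨L, hL⟩ := exists_hyperbolic_of_diagonal w σ h01 h23
    exact ⟨e.toLinearEquiv.trans L, fun v => (hL (e v)).trans (he v)⟩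
  obtain ⟨g, hg⟩ := exists_gaussSum_five
  have hprod : ∏ i, ∑ s : ZMod 5, ZMod.stdAddChar ((w i : ZMod 5) * (s * s)) = (c : ℂ) := by
    rw [← hQc, Finset.prod_univ_sum, Fintype.piFinset_univ, ← e.toEquiv.sum_comp]
    refine Finset.sum_congr rfl fun v _ => ?_
    rw [← he v, Fin.sum_univ_four, Fin.prod_univ_four, AddChar.map_add_eq_mul,
      AddChar.map_add_eq_mul, AddChar.map_add_eq_mul]
    rfl
  rw [Fin.prod_univ_four] at hprod
  -- An odd number of nonsquare coefficients would make the product `-g⁴`. With an even number, the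
  -- coefficients can be paired within square classes.
  have hneg : ¬ (c : ℂ) = -(g : ℂ) ^ 4 := by
    intro h
    have h1 : c = -g ^ 4 := by exact_mod_cast h
    have : 0 ≤ g ^ 4 := by positivity
    linarith
  rcases hg (w 0) with ⟨h0, h0'⟩ | ⟨h0, h0'⟩ <;> rcases hg (w 1) with ⟨h1, h1'⟩ | ⟨h1, h1'⟩ <;>
  rcases hg (w 2) with ⟨h2, h2'⟩ | ⟨h2, h2'⟩ <;> rcases hg (w 3) with ⟨h3, h3'⟩ | ⟨h3, h3'⟩ <;>
  rw [h0', h1', h2', h3'] at hprod <;>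
  first
  | exact ⟨1, h0.trans h1.symm, h2.trans h3.symm⟩
  | exact ⟨Equiv.swap 1 2, h0.trans h2.symm, h1.trans h3.symm⟩
  | exact ⟨Equiv.swap 1 3, h0.trans h3.symm, h2.trans h1.symm⟩
  | exact absurd (by rw [← hprod]; ring) hneg

end QuadraticFormsModFive


/-! ### The discriminant form is hyperbolic -/

section DiscriminantForm

variable {E : Type*} [NormedAddCommGroup E] [InnerProductSpace ℝ E] [FiniteDimensional ℝ E]
variable {R : Submodule ℤ E} [DiscreteTopology R] [IsZLattice ℝ R]

/-- A lattice is the dual of its dual. -/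
theorem mem_of_inner_dual {x : E} (hx : ∀ y ∈ dual R, ∃ k : ℤ, ⟪x, y⟫ = k) : x ∈ R := by
  have htop : Submodule.span ℝ (R : Set E) = ⊤ := IsZLattice.span_top
  have := ZLattice.module_free ℝ R
  have := ZLattice.module_finite ℝ R
  let b := (Module.Free.chooseBasis ℤ R).ofZLatticeBasis ℝ R
  have hb : Submodule.span ℤ (Set.range b) = R :=
    (Module.Free.chooseBasis ℤ R).ofZLatticeBasis_span ℝ
  let B : LinearMap.BilinForm ℝ E := innerₗ E
  have hBs : B.IsSymm := ⟨fun x y => real_inner_comm y x⟩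
  have hB : B.Nondegenerate := by
    refine ⟨fun x hx => inner_self_eq_zero.1 (hx x), fun x hx => inner_self_eq_zero.1 (hx x)⟩
  have h := LinearMap.BilinForm.dualSubmodule_dualSubmodule_of_basis (R := ℤ) B hB hBs b
  rw [hb] at h
  rw [← h]
  intro y hy
  rw [Submodule.mem_one]
  obtain ⟨k, hk⟩ := hx y ((mem_dual_iff htop).2 fun z hz => by
    have := hy z hz
    rw [Submodule.mem_one] at this
    obtain ⟨k, hk⟩ := this
    exact ⟨k, hk.symm⟩)
  exact ⟨k, hk.symm⟩

/-- The discriminant form of an even lattice of rank eight whose discriminant group is elementary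
abelian of order `5 ^ 4` is hyperbolic. -/
theorem exists_hyperbolicCoord (hE : finrank ℝ E = 8) (heven : IsEven R)
    (hdisc : Nonempty (DiscriminantGroup R ≃+ (Fin 4 → ZMod 5))) :
    Nonempty (HyperbolicCoord R) := by
  obtain ⟨e⟩ := hdisc
  have htop : Submodule.span ℝ (R : Set E) = ⊤ := IsZLattice.span_top
  let κ : dual R →+ (Fin 4 → ZMod 5) :=
    e.toAddMonoidHom.comp (R.submoduleOf (dual R)).mkQ.toAddMonoidHom
  have hκmk : ∀ x, κ x = e (Submodule.Quotient.mk x) := fun _ => rfl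
  have hκs : Function.Surjective κ := e.surjective.comp (Submodule.Quotient.mk_surjective _)
  have hκ0 : ∀ x : dual R, κ x = 0 ↔ (x : E) ∈ R := fun x => by
    rw [hκmk, EmbeddingLike.map_eq_zero_iff]
    exact Submodule.Quotient.mk_eq_zero (R.submoduleOf (dual R))
  have h5 : ∀ x : dual R, (5 : ℤ) • (x : E) ∈ R := by
    intro x
    have h1 : κ ((5 : ℤ) • x) = 0 := by
      rw [map_zsmul]
      ext i
      rw [Pi.smul_apply, zsmul_eq_mul, Int.cast_ofNat, show ((5 : ZMod 5)) = 0 from rfl, zero_mul]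
      rfl
    exact (hκ0 _).1 h1
  have hn : ∀ x y : dual R, ∃ n : ℤ, ⟪(x : E), (y : E)⟫ = n / 5 := by
    intro x y
    obtain ⟨k, hk⟩ := y.2.2 _ (h5 x)
    rw [real_inner_zsmul_right, real_inner_comm] at hk
    exact ⟨k, by push_cast at hk; linarith⟩
  choose n hn using hn
  have hadd : ∀ x x' y : dual R, n (x + x') y = n x y + n x' y := by
    intro x x' y
    have h := hn (x + x') y
    rw [Submodule.coe_add, inner_add_left, hn, hn] at h
    exact_mod_cast (by linarith : (n (x + x') y : ℝ) = n x y + n x' y)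
  have hcomm : ∀ x y : dual R, n x y = n y x := by
    intro x y
    have h := hn x y
    rw [real_inner_comm, hn] at h
    exact_mod_cast (by linarith : (n x y : ℝ) = n y x)
  have hzero : ∀ x y : dual R, κ x = 0 → (n x y : ZMod 5) = 0 := by
    intro x y hx
    obtain ⟨k, hk⟩ := y.2.2 _ ((hκ0 x).1 hx)
    rw [real_inner_comm, hn] at hk
    have : n x y = 5 * k := by exact_mod_cast (by linarith : (n x y : ℝ) = 5 * k)
    rw [this]; push_cast
    rw [show (5 : ZMod 5) = 0 from rfl, zero_mul]
  have hcongr : ∀ x x' y : dual R, κ x = κ x' → (n x y : ZMod 5) = n x' y := by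
    intro x x' y h
    have h1 := hzero (x - x') y (by rw [map_sub, h, sub_self])
    have h2 := hadd (x - x') x' y
    rw [sub_add_cancel] at h2
    rw [h2, Int.cast_add, h1, zero_add]
  choose t ht using hκs
  have hβl : ∀ v v' w, (n (t (v + v')) (t w) : ZMod 5) = n (t v) (t w) + n (t v') (t w) := by
    intro v v' w
    rw [hcongr (t (v + v')) (t v + t v') (t w) (by rw [map_add, ht, ht, ht]), hadd, Int.cast_add]
  have hβr : ∀ v w w', (n (t v) (t (w + w')) : ZMod 5) = n (t v) (t w) + n (t v) (t w') := by
    intro v w w'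
    rw [hcomm, hβl, hcomm, hcomm (t w')]
  -- The factor `3` is the inverse of `2`, so `B` represents five halves of the inner product.
  let B : LinearMap.BilinForm (ZMod 5) (Fin 4 → ZMod 5) :=
    AddMonoidHom.toZModLinearMap 5 (AddMonoidHom.mk' (fun v => AddMonoidHom.toZModLinearMap 5
      (AddMonoidHom.mk' (fun w => 3 * (n (t v) (t w) : ZMod 5)) fun w w' => by
        rw [hβr, mul_add])) fun v v' => LinearMap.ext fun w => by
          change 3 * (n (t (v + v')) (t w) : ZMod 5) = 3 * _ + 3 * _
          rw [hβl, mul_add])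
  have hB : ∀ x y : dual R, B (κ x) (κ y) = 3 * (n x y : ZMod 5) := by
    intro x y
    change 3 * (n (t (κ x)) (t (κ y)) : ZMod 5) = _
    rw [hcongr _ x _ (ht _), hcomm, hcongr _ y _ (ht _), hcomm]
  have hnorm : ∀ x : dual R, ∃ m : ℤ, ⟪(x : E), (x : E)⟫ = 2 * m / 5 ∧
      (m : ZMod 5) = B (κ x) (κ x) := by
    intro x
    obtain ⟨k, hk⟩ := heven.2 _ (h5 x)
    rw [real_inner_zsmul_left, real_inner_zsmul_right, hn] at hk
    push_cast at hk
    have h1 : 5 * n x x = 2 * k := by exact_mod_cast (by linarith : (5 * n x x : ℝ) = 2 * k)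
    obtain ⟨m, hm⟩ : ∃ m, n x x = 2 * m := ⟨k - 2 * n x x, by omega⟩
    refine ⟨m, by rw [hn, hm]; push_cast; rfl, ?_⟩
    rw [hB, hm]
    push_cast
    rw [← mul_assoc, show (3 * 2 : ZMod 5) = 1 from rfl, one_mul]
  let : Invertible (2 : ZMod 5) := ⟨3, by decide, by decide⟩
  let Q : QuadraticForm (ZMod 5) (Fin 4 → ZMod 5) := LinearMap.BilinMap.toQuadraticMap B
  have hQ : ∀ v, Q v = B v v := fun _ => rfl
  have hassoc : QuadraticMap.associated (R := ZMod 5) Q = B :=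
    QuadraticMap.associated_left_inverse _ fun v w => by
      change 3 * (n (t v) (t w) : ZMod 5) = 3 * (n (t w) (t v) : ZMod 5)
      rw [hcomm]
  -- A class orthogonal to everything is represented in the dual of the dual, which is `R`.
  have hsep : (QuadraticMap.associated (R := ZMod 5) Q).SeparatingLeft := by
    rw [hassoc]
    intro v hv
    rw [← ht v, hκ0]
    refine mem_of_inner_dual fun y hy => ?_
    have h1 := hv (κ ⟨y, hy⟩)
    rw [← ht v, hB] at h1
    have h2 : ∀ a : ZMod 5, 3 * a = 0 → a = 0 := by decide
    obtain ⟨k, hk⟩ := (ZMod.intCast_zmod_eq_zero_iff_dvd _ 5).1 (h2 _ h1)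
    refine ⟨k, (hn (t v) ⟨y, hy⟩).trans ?_⟩
    rw [hk]; push_cast; ring
  have : Fintype (DiscriminantGroup R) := Fintype.ofEquiv _ e.symm.toEquiv
  obtain ⟨c, hc, hsum⟩ := heven.sum_discriminantPhase_pos hE
  have hsumQ : ∑ v, ZMod.stdAddChar (Q v) = (c : ℂ) := by
    rw [← hsum, ← e.toEquiv.sum_comp]
    refine Finset.sum_congr rfl fun d _ => ?_
    obtain ⟨x, rfl⟩ := Submodule.Quotient.mk_surjective _ d
    rw [heven.discriminantPhase_mk]
    obtain ⟨m, hm, hm'⟩ := hnorm x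
    change ZMod.stdAddChar (B (κ x) (κ x)) = _
    rw [← hm', ZMod.stdAddChar_coe, normPhase, hm]
    congr 1
    push_cast; ring
  obtain ⟨L, hL⟩ := exists_hyperbolic_of_gaussSum_pos Q hsep hc hsumQ
  refine ⟨{ coord :=
              { toFun := fun x => L (κ x)
                map_add' := fun x y => by rw [map_add, map_add]
                map_smul' := fun k x => by rw [map_zsmul, map_zsmul]; rfl }
            surjective := fun v => ⟨t (L.symm v), by
              change L (κ (t (L.symm v))) = v
              rw [ht, L.apply_symm_apply]⟩
            coord_eq_zero_iff := fun x => by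
              change L (κ x) = 0 ↔ _
              rw [LinearEquiv.map_eq_zero_iff, hκ0]
            inner_self := fun x => by
              obtain ⟨m, hm, hm'⟩ := hnorm x
              exact ⟨m, hm, hm'.trans (hL (κ x)).symm⟩ }⟩

end DiscriminantForm


/-! ### The isometry group and SSD involutions -/

section IsometryGroup

variable {E : Type*} [NormedAddCommGroup E] [InnerProductSpace ℝ E]

theorem eq_of_zsmul_eq_zsmul {n : ℤ} (hn : n ≠ 0) {x y : E} (h : n • x = n • y) : x = y := by
  rw [← Int.cast_smul_eq_zsmul ℝ, ← Int.cast_smul_eq_zsmul ℝ] at h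
  exact smul_right_injective E (Int.cast_ne_zero.2 hn) h

namespace HyperbolicCoord

variable {R : Submodule ℤ E} (C : HyperbolicCoord R)

/-- An isometry of the lattice induces an isometry of the discriminant form. -/
theorem exists_induced (g : isometryGroup R) : ∃ γ : OPlus 2 (ZMod 5), ∀ x : dual R,
    C.coord ⟨g.1 x, isometryGroup_mem_dual g x.2⟩ = γ.1 (C.coord x) := by
  choose s hs using C.surjective
  let G : dual R →+ dual R :=
    { toFun := fun x => ⟨g.1 x, isometryGroup_mem_dual g x.2⟩
      map_zero' := Subtype.ext (map_zero g.1)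
      map_add' := fun x y => Subtype.ext (map_add g.1 (x : E) y) }
  have hG : ∀ x y, C.coord x = C.coord y → C.coord (G x) = C.coord (G y) := by
    intro x y h
    rw [C.coord_eq_iff] at h ⊢
    change g.1 x - g.1 y ∈ R
    rw [← map_sub]
    exact (g.2 _).2 h
  let f : (Fin 2 ⊕ Fin 2 → ZMod 5) →+ (Fin 2 ⊕ Fin 2 → ZMod 5) :=
    { toFun := fun v => C.coord (G (s v))
      map_zero' := (hG _ 0 (by rw [hs, map_zero])).trans (by rw [map_zero, map_zero])
      map_add' := fun v w =>
        (hG _ (s v + s w) (by rw [map_add, hs, hs, hs])).trans (by rw [map_add, map_add]) }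
  have hf : ∀ x, f (C.coord x) = C.coord (G x) := fun x => hG _ _ (hs _)
  have hinj : Function.Injective f := by
    rw [injective_iff_map_eq_zero]
    intro v hv
    obtain ⟨x, rfl⟩ := C.surjective v
    rw [hf, C.coord_eq_zero_iff] at hv
    exact (C.coord_eq_zero_iff x).2 ((g.2 _).1 hv)
  refine ⟨⟨LinearEquiv.ofBijective (f.toZModLinearMap 5)
    ⟨hinj, Finite.surjective_of_injective hinj⟩, fun v => ?_⟩, fun x => (hf x).symm⟩
  obtain ⟨x, rfl⟩ := C.surjective v
  change hyperbolicForm 2 (ZMod 5) (f (C.coord x)) = _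
  obtain ⟨m, hm, hm'⟩ := C.inner_self x
  obtain ⟨n, hn, hn'⟩ := C.inner_self (G x)
  have h1 : ⟪((G x : dual R) : E), ((G x : dual R) : E)⟫ = ⟪(x : E), (x : E)⟫ :=
    g.1.inner_map_map _ _
  have h2 : n = m := by exact_mod_cast (by linarith : (n : ℝ) = m)
  rw [hf, ← hn', ← hm', h2]

variable [FiniteDimensional ℝ E] [DiscreteTopology R] [IsZLattice ℝ R]

include C in
theorem eq_of_coord_eq (hE : finrank ℝ E = 8) (heven : IsEven R) (hroot : IsRootless R)
    {g h : isometryGroup R} (hgh : ∀ x : dual R, g.1 x - h.1 x ∈ R) : g = h := by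
  rw [← inv_mul_eq_one]
  refine C.eq_one_of_coord_eq hE heven hroot _ fun x => ?_
  rw [← (g.2 _)]
  have h1 : g.1 ((g⁻¹ * h).1 x) = h.1 x := g.1.apply_symm_apply _
  rw [map_sub, h1, ← neg_sub]
  exact R.neg_mem (hgh x)

-- Injectivity holds because an isometry trivial on the discriminant group is the identity;
-- surjectivity is the lifting theorem with `C` on both sides.
include C in
theorem nonempty_mulEquiv (hE : finrank ℝ E = 8) (heven : IsEven R) (hroot : IsRootless R) :
    Nonempty (isometryGroup R ≃* OPlus 2 (ZMod 5)) := by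
  choose Γ hΓ using C.exists_induced
  have hext : ∀ γ δ : OPlus 2 (ZMod 5), (∀ x, γ.1 (C.coord x) = δ.1 (C.coord x)) → γ = δ := by
    intro γ δ h
    refine Subtype.ext (LinearEquiv.ext fun v => ?_)
    obtain ⟨x, rfl⟩ := C.surjective v
    exact h x
  refine ⟨MulEquiv.ofBijective (MonoidHom.mk' Γ fun g h => hext _ _ fun x => ?_) ⟨?_, ?_⟩⟩
  · rw [← hΓ]
    exact (hΓ g ⟨h.1 x, isometryGroup_mem_dual h x.2⟩).trans (congrArg _ (hΓ h x))
  · intro g h hgh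
    refine C.eq_of_coord_eq hE heven hroot fun x => ?_
    refine (C.coord_eq_iff ⟨_, isometryGroup_mem_dual g x.2⟩
      ⟨_, isometryGroup_mem_dual h x.2⟩).1 ?_
    rw [hΓ, hΓ]
    exact congrArg (fun γ : OPlus 2 (ZMod 5) => γ.1 (C.coord x)) hgh
  · intro γ
    obtain ⟨φ, hφ, hφγ⟩ := C.exists_isometry C hE heven hroot hE heven hroot γ
    refine ⟨⟨φ, hφ⟩, hext _ _ fun x => ?_⟩
    obtain ⟨_, h⟩ := hφγ x
    exact (hΓ ⟨φ, hφ⟩ x).symm.trans h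

include C in
theorem discriminantAction_injective (hE : finrank ℝ E = 8) (heven : IsEven R)
    (hroot : IsRootless R) : Function.Injective (discriminantAction R) := by
  intro g h hgh
  refine C.eq_of_coord_eq hE heven hroot fun x => ?_
  have h1 := LinearMap.congr_fun hgh (Submodule.Quotient.mk x)
  have h2 : (Submodule.Quotient.mk ⟨g.1 x, isometryGroup_mem_dual g x.2⟩ : DiscriminantGroup R) =
      Submodule.Quotient.mk ⟨h.1 x, isometryGroup_mem_dual h x.2⟩ := h1
  have h3 := (Submodule.Quotient.eq (R.submoduleOf (dual R))).1 h2
  exact h3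

-- For a dual vector `x`, the projection `p` to `ℝM` is in `M*`, and `t` negates `p` and fixes `x -
-- p`. So `t x - x = -2 p` is in `M`, hence in `R`, and `t` acts trivially on the discriminant
-- group.
include C in
theorem not_exists_isSSDInvolution (hE : finrank ℝ E = 8) (heven : IsEven R)
    (hroot : IsRootless R) : ¬ ∃ t : isometryGroup R, IsSSDInvolution R t := by
  rintro ⟨t, ht, M, hMR, hM, htM, htM'⟩
  have h1 : t = 1 := by
    refine C.eq_one_of_coord_eq hE heven hroot t fun x => ?_
    let S := Submodule.span ℝ (M : Set E)
    have hort : ∀ y ∈ M, ⟪(x : E) - S.starProjection x, y⟫ = 0 := fun y hy =>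
      Submodule.starProjection_inner_eq_zero (K := S) _ _ (Submodule.subset_span hy)
    have hp : S.starProjection (x : E) ∈ dual M := by
      refine ⟨Submodule.starProjection_apply_mem S _, fun y hy => ?_⟩
      obtain ⟨k, hk⟩ := x.2.2 y (hMR hy)
      refine ⟨k, ?_⟩
      rw [← hk, eq_comm, ← sub_eq_zero, ← inner_sub_left, hort y hy]
    have h2p := hM _ hp
    have htp : t.1 (S.starProjection (x : E)) = -S.starProjection (x : E) := by
      have := htM _ h2p
      rw [map_zsmul, ← smul_neg] at this
      exact eq_of_zsmul_eq_zsmul two_ne_zero this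
    have htq : t.1 ((x : E) - S.starProjection x) = (x : E) - S.starProjection x := by
      -- `t` is only known to fix vectors of `R` orthogonal to `M`; both `5 x` and `2 p` are in `R`,
      -- so ten times the orthogonal component is too.
      have h10 : (10 : ℤ) • ((x : E) - S.starProjection x) ∈ R := by
        have : (10 : ℤ) • ((x : E) - S.starProjection x) =
            (2 : ℤ) • (5 : ℤ) • (x : E) - (5 : ℤ) • (2 : ℤ) • S.starProjection (x : E) := by
          module
        rw [this]
        exact R.sub_mem (R.smul_mem _ (C.five_smul_mem x)) (R.smul_mem _ (hMR h2p))
      have := htM' _ h10 fun y hy => by rw [real_inner_zsmul_left, hort y hy, mul_zero]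
      rw [map_zsmul] at this
      exact eq_of_zsmul_eq_zsmul (by norm_num) this
    have : t.1 (x : E) - x = -((2 : ℤ) • S.starProjection (x : E)) := by
      have h3 : t.1 (x : E) = t.1 (S.starProjection (x : E)) +
          t.1 ((x : E) - S.starProjection x) := by rw [← map_add, add_sub_cancel]
      rw [h3, htp, htq]; module
    rw [this]
    exact R.neg_mem (hMR h2p)
  rw [h1, orderOf_one] at ht
  omega

end HyperbolicCoord

end IsometryGroup

end EuclideanLattice

theorem theorem1p1
    {E : Type*} [NormedAddCommGroup E] [InnerProductSpace ℝ E] [FiniteDimensional ℝ E]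
    (R : Submodule ℤ E) [DiscreteTopology R] [IsZLattice ℝ R]
    (hrank : Module.finrank ℤ R = 8)
    (heven : EuclideanLattice.IsEven R)
    (hrootless : EuclideanLattice.IsRootless R)
    (hdisc : Nonempty (EuclideanLattice.DiscriminantGroup R ≃+ (Fin 4 → ZMod 5))) :
    -- uniqueness up to isometry
    (∀ {E' : Type*} [NormedAddCommGroup E'] [InnerProductSpace ℝ E'] [FiniteDimensional ℝ E']
      (R' : Submodule ℤ E') [DiscreteTopology R'] [IsZLattice ℝ R'],
      Module.finrank ℤ R' = 8 →
      EuclideanLattice.IsEven R' →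
      EuclideanLattice.IsRootless R' →
      Nonempty (EuclideanLattice.DiscriminantGroup R' ≃+ (Fin 4 → ZMod 5)) →
      EuclideanLattice.Isometric R R') ∧
    -- the isometry group is the orthogonal group of plus type in dimension 4 over the field with
    -- 5 elements
    Nonempty (EuclideanLattice.isometryGroup R ≃* EuclideanLattice.OPlus 2 (ZMod 5)) ∧
    -- the action on the discriminant group is faithful
    Function.Injective (EuclideanLattice.discriminantAction R) ∧
    -- there are no SSD involutions
    ¬ ∃ t : EuclideanLattice.isometryGroup R, EuclideanLattice.IsSSDInvolution R t := by
  have hE : Module.finrank ℝ E = 8 := (ZLattice.rank ℝ R).symm.trans hrank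
  obtain ⟨C⟩ := EuclideanLattice.exists_hyperbolicCoord hE heven hdisc
  refine ⟨fun R' _ _ hrank' heven' hrootless' hdisc' => ?_,
    C.nonempty_mulEquiv hE heven hrootless,
    C.discriminantAction_injective hE heven hrootless,
    C.not_exists_isSSDInvolution hE heven hrootless⟩
  have hE' := (ZLattice.rank ℝ R').symm.trans hrank'
  obtain ⟨C'⟩ := EuclideanLattice.exists_hyperbolicCoord hE' heven' hdisc'
  -- Both discriminant forms are identified with the same hyperbolic space, so the identity there
  -- already lifts to an isometry.
  obtain ⟨φ, hφ, -⟩ := C.exists_isometry C' hE heven hrootless hE' heven' hrootless' 1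
  exact ⟨φ, hφ⟩
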